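/- Let $n\ge 4$, $G=\mathrm{GL}_n(\mathbb R)$ with centre $Z$, $\Gamma=\mathrm{GL}_n(\mathbb Z)$, $N\subset G$ the group of unipotent upper triangular matrices, and $\psi(x)=e^{2\pi i(x_{1,2}+\cdots+x_{n-1,n})}$ for $x\in N$. Choose for every $\sigma$ in the Weyl group $W=S_n$ a representative $w\in G$, a matrix with $we_j=\pm e_{\sigma(j)}$; the trivial element is represented by $\mathrm I_n$, and the exchange of the first and last index by $w_*=\left(\begin{smallmatrix}&&-1\\&\mathrm I_{n-2}&\\1&&\end{smallmatrix}\right)$. Put $N_w=w^{-1}N^{\top}w\cap N$. Give $N$ and $N_w$ Lebesgue measure in the matrix entries, and for diagonal $a$ let $\delta_w(a)$ be the Jacobian of $x\mapsto axa^{-1}$ on $N_w$. For $\mathbf m=(m_1,\dots,m_{n-1})$ with positive integer entries put $\widetilde{\mathbf m}=\mathrm{diag}(m_1\cdots m_{n-1},\,m_1\cdots m_{n-2},\dots,m_1,1)$, and for $c\in\mathbb Z_{\ne0}^{n-1}$ put $c^*=\mathrm{diag}(1/c_{n-1},\,c_{n-1}/c_{n-2},\dots,c_2/c_1,\,c_1)$.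 Call $c$ admissible for $w$ and $\mathbf m$ if $\psi(\widetilde{\mathbf m}c^*wxw^{-1}(c^*)^{-1}\widetilde{\mathbf m}^{-1})=\psi(\widetilde{\mathbf m}x\widetilde{\mathbf m}^{-1})$ for all $x\in w^{-1}Nw\cap N$, and then set $$S_w(\mathbf m,\mathbf m;c)=\sum_{\gamma=xc^*wy}\psi(\widetilde{\mathbf m}x\widetilde{\mathbf m}^{-1})\,\psi(\widetilde{\mathbf m}y\widetilde{\mathbf m}^{-1}),$$ where $\gamma$ runs over representatives of the double cosets $(N\cap\Gamma)\gamma(N_w\cap\Gamma)$ of elements $\gamma\in\Gamma$ of the form $xc^*wy$ with $x\in N$, $y\in N_w$. For $g\in G$ let $$\mathcal O_{\psi,w}(F;g)=\int_{N_w}\int_N F(xgy)\,\overline{\psi(x)\psi(y)}\,dx\,dy .$$ For $X>1$ and $\tau>0$ let $a_X=\mathrm{diag}(X^{1-n},X^{2-n},\dots,X^{-1},1)$, let $K(X,\tau)$ be the set of $g\in G$ all of whose entries differ from those of $\mathrm I_n$ by less than $\tau/X$, and let $K(X,\tau)^\sharp=a_X^{-1}K(X,\tau)a_X$. There are $\tau_0>0$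 and $X_0>1$, depending only on $n$, such that for all $0<\tau<\tau_0$ and $\varepsilon>0$ there is a constant $C=C(n,\tau,\varepsilon)$ with the following property. Let $X\ge X_0$, let $F\in\mathcal C_c^\infty(G)$ or $F\in\mathcal C_c^\infty(Z\backslash G)$ vanish outside $Z\,K(X,\tau)^\sharp$, and let $\mathbf m=(m,1,\dots,1)$ with an integer $1\le m\le X^{n+2}$. Then, for every $w\in W$ and every $c$ admissible for $w$ and $\mathbf m$, the integral $\mathcal O_{\psi,w}(F;\widetilde{\mathbf m}c^*w\widetilde{\mathbf m}^{-1})$ converges absolutely, and it is zero if $w$ is neither trivial nor $w_*$. Moreover, the following sum converges absolutely and satisfies $$\Bigl|\sum_{w\in W}\ \sum_{\substack{c\in\mathbb Z_{\neq0}^{n-1}\\ \text{admissible}}}\frac{S_w(\mathbf m,\mathbf m;c)}{\delta_w(\widetilde{\mathbf m})}\,\mathcal O_{\psi,w}(F;\widetilde{\mathbf m}c^*w\widetilde{\mathbf m}^{-1})\Bigr|\ \le\ C\,\|F\|_\infty\,X^{\frac{n(n-1)(n-2)}6+\varepsilon}.$$ -/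

import Mathlib

open scoped BigOperators Matrix ContDiff

noncomputable section

namespace GLKuznetsov

open Matrix MeasureTheory

/-! ### Groups and matrices -/

/-- The group `G = GL_n(ℝ)`. -/
abbrev G (n : ℕ) := GL (Fin n) ℝ

/-- Upper triangular unipotent matrices. -/
def N (n : ℕ) : Set (G n) :=
  {g | (∀ i, g.val i i = 1) ∧ ∀ i j, j < i → g.val i j = 0}

/-- Lower triangular unipotent matrices, the transposes of the elements of `N`. -/
def NT (n : ℕ) : Set (G n) :=
  {g | (∀ i, g.val i i = 1) ∧ ∀ i j, i < j → g.val i j = 0}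

/-- `N_w = w⁻¹ Nᵀ w ∩ N`. -/
def Nw {n : ℕ} (w : G n) : Set (G n) := {y | y ∈ N n ∧ w * y * w⁻¹ ∈ NT n}

/-- `Γ = GL_n(ℤ)`, as a subgroup of `GL_n(ℝ)`. -/
def Gam (n : ℕ) : Subgroup (G n) :=
  (Matrix.GeneralLinearGroup.map (n := Fin n) (Int.castRingHom ℝ)).range

/-- Diagonal elements of `G`. -/
def diagG {n : ℕ} (a : Fin n → ℝˣ) : G n where
  val := Matrix.diagonal fun i => (a i : ℝ)
  inv := Matrix.diagonal fun i => ((a i)⁻¹ : ℝˣ)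
  val_inv := by simp [Matrix.diagonal_mul_diagonal]
  inv_val := by simp [Matrix.diagonal_mul_diagonal]

/-- The central element `z I_n`. -/
def central (n : ℕ) (z : ℝˣ) : G n := diagG fun _ => z

/-- Nonzero moduli `c = (c_1, …, c_{n-1})`; the entry with index `j` is `c_{j+1}`. -/
abbrev Modulus (n : ℕ) := Fin (n - 1) → {k : ℤ // k ≠ 0}

/-- `c_k` for `0 ≤ k ≤ n`, with `c_0 = c_n = 1`. -/
def cExt {n : ℕ} (c : Modulus n) (k : ℕ) : ℝˣ :=
  if h : 1 ≤ k ∧ k < n then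
    Units.mk0 (((c ⟨k - 1, by omega⟩ : {k : ℤ // k ≠ 0}) : ℤ) : ℝ)
      (Int.cast_ne_zero.mpr (c ⟨k - 1, by omega⟩).2)
  else 1

/-- `c* = diag(1/c_{n-1}, c_{n-1}/c_{n-2}, …, c_2/c_1, c_1)`. -/
def cStar {n : ℕ} (c : Modulus n) : G n :=
  diagG fun i => cExt c (n - i.val) / cExt c (n - i.val - 1)

/-- The diagonal entries of `diag(m_1⋯m_{n-1}, m_1⋯m_{n-2}, …, m_1, 1)`. -/
def mEntry {n : ℕ} (m : Fin (n - 1) → ℕ+) (i : Fin n) : ℝˣ :=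
  ∏ j : Fin (n - 1), if j.val + i.val + 1 < n then
    Units.mk0 ((m j : ℕ) : ℝ) (Nat.cast_ne_zero.mpr (m j).ne_zero) else 1

/-- `m̃ = diag(m_1⋯m_{n-1}, m_1⋯m_{n-2}, …, m_1, 1)`. -/
def mTilde {n : ℕ} (m : Fin (n - 1) → ℕ+) : G n := diagG (mEntry m)

/-- The vector `(m, 1, …, 1)`. -/
def mVec (n : ℕ) (m : ℕ+) : Fin (n - 1) → ℕ+ := fun j => if j.val = 0 then m else 1

/-- The standard character `ψ(x) = e(x_{1,2} + ⋯ + x_{n-1,n})` of `N`. -/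
def psi {n : ℕ} (x : G n) : ℂ :=
  Complex.exp (2 * Real.pi * Complex.I *
    ((∑ i : Fin n, ∑ j : Fin n, if i.val + 1 = j.val then x.val i j else 0 : ℝ) : ℂ))

/-! ### The Weyl group -/

/-- `w` is a monomial matrix with entries `±1` representing the permutation `σ`, that is
`w e_j = ± e_{σ j}`. -/
def Represents {n : ℕ} (σ : Equiv.Perm (Fin n)) (w : G n) : Prop :=
  ∃ s : Fin n → ℤˣ, ∀ i j, w.val i j = if i = σ j then ((s j : ℤ) : ℝ) else 0

/-- The permutation underlying `w_*`: it exchanges the first and the last index. -/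
def starPerm (n : ℕ) (hn : 0 < n) : Equiv.Perm (Fin n) :=
  Equiv.swap ⟨0, hn⟩ ⟨n - 1, by omega⟩

/-- A system of representatives `σ ↦ w_σ` in `G` of the Weyl group, in which the trivial element
is represented by `I_n` and the exchange of the first and the last index is represented by `w_*`,
the matrix with lower left entry `1`, upper right entry `-1` and middle block `I_{n-2}`. -/
structure IsWeylSystem {n : ℕ} (hn : 0 < n) (rep : Equiv.Perm (Fin n) → G n) : Prop where
  represents : ∀ σ, Represents σ (rep σ)
  one : rep 1 = 1
  star : ∀ i j, (rep (starPerm n hn)).val i j =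
    if i = starPerm n hn j then (if j.val = n - 1 then -1 else 1) else 0

/-! ### Coordinates and measures on `N` and `N_w` -/

/-- Positions strictly above the diagonal. -/
abbrev Pos (n : ℕ) := {p : Fin n × Fin n // p.1 < p.2}

/-- Positions `(i, j)`, `i < j`, with `σ i > σ j`: the coordinates of `N_w` if `w` represents `σ`
(see `range_unipW`). -/
abbrev Inv {n : ℕ} (σ : Equiv.Perm (Fin n)) := {p : Pos n // σ p.1.2 < σ p.1.1}

/-- The unipotent upper triangular matrix with given entries above the diagonal. -/
def unipMat {n : ℕ} (v : Pos n → ℝ) : Matrix (Fin n) (Fin n) ℝ :=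
  Matrix.of fun i j => if h : i < j then v ⟨(i, j), h⟩ else if i = j then 1 else 0

theorem det_unipMat {n : ℕ} (v : Pos n → ℝ) : (unipMat v).det = 1 := by
  rw [Matrix.det_of_isUpperTriangular]
  · simp [unipMat]
  · intro i j hij
    have hji : j < i := hij
    simp [unipMat, not_lt.mpr hji.le, hji.ne']

/-- The element of `N` with given coordinates. -/
def unip {n : ℕ} (v : Pos n → ℝ) : G n :=
  Matrix.GeneralLinearGroup.mkOfDetNeZero (unipMat v) (by rw [det_unipMat]; exact one_ne_zero)

theorem unip_val {n : ℕ} (v : Pos n → ℝ) : (unip v).val = unipMat v := rfl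

/-- The element of `N_w` with given coordinates, `w` representing `σ`. -/
def unipW {n : ℕ} (σ : Equiv.Perm (Fin n)) (v : Inv σ → ℝ) : G n :=
  unip fun p => if h : σ p.1.2 < σ p.1.1 then v ⟨p, h⟩ else 0

theorem range_unip (n : ℕ) : Set.range (unip (n := n)) = N n := by
  ext g
  constructor
  · rintro ⟨v, rfl⟩
    refine ⟨fun i => ?_, fun i j hij => ?_⟩
    · change unipMat v i i = 1
      simp [unipMat]
    · change unipMat v i j = 0
      simp [unipMat, not_lt.mpr hij.le, hij.ne']
  · rintro ⟨h1, h2⟩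
    refine ⟨fun p => g.val p.1.1 p.1.2, ?_⟩
    apply Units.ext
    ext i j
    rw [unip_val]
    rcases lt_trichotomy i j with h | h | h
    · simp [unipMat, h]
    · subst h; simp [unipMat, h1]
    · simp [unipMat, not_lt.mpr h.le, h.ne', h2 i j h]

theorem Represents.conj_apply {n : ℕ} {σ : Equiv.Perm (Fin n)} {w : G n} {s : Fin n → ℤˣ}
    (hs : ∀ i j, w.val i j = if i = σ j then ((s j : ℤ) : ℝ) else 0) (y : G n) (i j : Fin n) :
    (w * y * w⁻¹).val (σ i) (σ j) = ((s i : ℤ) : ℝ) * y.val i j * ((s j : ℤ) : ℝ) := by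
  have key : (w * y).val = (w * y * w⁻¹).val * w.val := by
    rw [← Units.val_mul]; simp
  have e1 : (w * y).val (σ i) j = ((s i : ℤ) : ℝ) * y.val i j := by
    rw [Units.val_mul, Matrix.mul_apply]
    simp [hs]
  have e2 : ((w * y * w⁻¹).val * w.val) (σ i) j =
      (w * y * w⁻¹).val (σ i) (σ j) * ((s j : ℤ) : ℝ) := by
    rw [Matrix.mul_apply]
    simp [hs]
  have e3 : ((s j : ℤ) : ℝ) * ((s j : ℤ) : ℝ) = 1 := by
    rcases Int.units_eq_one_or (s j) with h | h <;> simp [h]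
  have e4 : ((s i : ℤ) : ℝ) * y.val i j = (w * y * w⁻¹).val (σ i) (σ j) * ((s j : ℤ) : ℝ) := by
    rw [← e1, ← e2, ← key]
  rw [e4]
  generalize (w * y * w⁻¹).val (σ i) (σ j) = t
  rw [mul_assoc, e3, mul_one]

theorem range_unipW {n : ℕ} {σ : Equiv.Perm (Fin n)} {w : G n} (hw : Represents σ w) :
    Set.range (unipW σ) = Nw w := by
  obtain ⟨s, hs⟩ := hw
  have hne : ∀ i, ((s i : ℤ) : ℝ) ≠ 0 := fun i => Int.cast_ne_zero.mpr (s i).ne_zero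
  ext g
  constructor
  · rintro ⟨v, rfl⟩
    refine ⟨by rw [← range_unip]; exact ⟨_, rfl⟩, fun i => ?_, fun i j hij => ?_⟩
    · obtain ⟨i, rfl⟩ := σ.surjective i
      rw [Represents.conj_apply hs]
      have : (unipW σ v).val i i = 1 := by
        unfold unipW; rw [unip_val]
        simp [unipMat]
      rw [this]
      rcases Int.units_eq_one_or (s i) with h | h <;> simp [h]
    · obtain ⟨i, rfl⟩ := σ.surjective i
      obtain ⟨j, rfl⟩ := σ.surjective j
      rw [Represents.conj_apply hs]
      have hne' : i ≠ j := fun h => by simp [h] at hij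
      have : (unipW σ v).val i j = 0 := by
        unfold unipW; rw [unip_val]
        simp [unipMat, hne', not_lt.mpr hij.le]
      rw [this]; simp
  · rintro ⟨hN, -, h2⟩
    rw [← range_unip] at hN
    obtain ⟨v, rfl⟩ := hN
    refine ⟨fun p => v p.1, ?_⟩
    unfold unipW
    congr 1
    funext p
    by_cases h : σ p.1.2 < σ p.1.1
    · simp [h]
    · rw [dif_neg h]
      have hlt : σ p.1.1 < σ p.1.2 :=
        lt_of_le_of_ne (not_lt.mp h) fun e => p.2.ne (σ.injective e)
      have := h2 _ _ hlt
      rw [Represents.conj_apply hs] at this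
      have h0 : (unip v).val p.1.1 p.1.2 = 0 := by
        simpa [hne] using this
      have h3 : unipMat v p.1.1 p.1.2 = 0 := h0
      simpa [unipMat, p.2] using h3.symm

/-- `δ_w(a)`, the Jacobian of `x ↦ a x a⁻¹` on `N_w`, `w` representing `σ`, `a = diag(a_i)`: this
map multiplies the coordinate `x_{ij}` by `a_i / a_j`. -/
def deltaW {n : ℕ} (σ : Equiv.Perm (Fin n)) (a : Fin n → ℝˣ) : ℝ :=
  ∏ p : Inv σ, |(a p.1.1.1 : ℝ) / (a p.1.1.2 : ℝ)|

/-! ### Admissible moduli and Kloosterman sums -/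

/-- The modulus `c` is admissible for `m`, `m'` and `w`. -/
def Admissible {n : ℕ} (m m' : Fin (n - 1) → ℕ+) (w : G n) (c : Modulus n) : Prop :=
  ∀ x ∈ N n, w * x * w⁻¹ ∈ N n →
    psi (mTilde m * cStar c * w * x * w⁻¹ * (cStar c)⁻¹ * (mTilde m)⁻¹) =
      psi (mTilde m' * x * (mTilde m')⁻¹)

/-- The set of `γ ∈ Γ` of the form `x c* w y` with `x ∈ N` and `y ∈ N_w`. -/
def Cell {n : ℕ} (w : G n) (c : Modulus n) : Set (G n) :=
  {γ | γ ∈ Gam n ∧ ∃ x ∈ N n, ∃ y ∈ Nw w, γ = x * cStar c * w * y}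

/-- Equality of double cosets `(N ∩ Γ) γ (N_w ∩ Γ)` on `Cell w c`. -/
def cellSetoid {n : ℕ} (w : G n) (c : Modulus n) : Setoid (Cell w c) :=
  (DoubleCoset.setoid (N n ∩ (Gam n : Set (G n))) (Nw w ∩ (Gam n : Set (G n)))).comap
    Subtype.val

/-- The summand `ψ(m̃ x m̃⁻¹) ψ(m̃' y m̃'⁻¹)` at `γ = x c* w y`. The factors `x ∈ N`, `y ∈ N_w` are
determined by `γ`, so that the choice made here is the only possible one. -/
def kloostermanTerm {n : ℕ} (m m' : Fin (n - 1) → ℕ+) (w : G n) (c : Modulus n)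
    (γ : Cell w c) : ℂ :=
  let x := Classical.choose γ.2.2
  let y := Classical.choose (Classical.choose_spec γ.2.2).2
  psi (mTilde m * x * (mTilde m)⁻¹) * psi (mTilde m' * y * (mTilde m')⁻¹)

open Classical in
/-- The Kloosterman sum `S_w(m, m'; c)`, a finite sum over the double cosets of
`N ∩ Γ` and `N_w ∩ Γ` in `Cell w c`. Its terms do not depend on the representatives. It is zero
by convention if `c` is not admissible. -/
def kloosterman {n : ℕ} (m m' : Fin (n - 1) → ℕ+) (w : G n) (c : Modulus n) : ℂ :=
  if Admissible m m' w c then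
    ∑ᶠ q : Quotient (cellSetoid w c), kloostermanTerm m m' w c q.out
  else 0

/-! ### Test functions and orbital integrals -/

/-- `‖F‖_∞`. -/
def supNorm {n : ℕ} (F : G n → ℂ) : ℝ := ⨆ g, ‖F g‖

section Smooth

attribute [local instance] Matrix.normedAddCommGroup Matrix.normedSpace

open Classical in
/-- Smoothness of a function on `G`, an open subset of the space of all matrices. -/
def IsSmooth {n : ℕ} (F : G n → ℂ) : Prop :=
  ContDiffOn ℝ ∞
    (fun A : Matrix (Fin n) (Fin n) ℝ =>
      if h : A.det ≠ 0 then F (Matrix.GeneralLinearGroup.mkOfDetNeZero A h) else 0)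
    {A | A.det ≠ 0}

end Smooth

/-- Test functions on `G`: smooth functions that either are compactly supported on `G`, or are
invariant under the centre `Z` and compactly supported modulo `Z`
(that is, `F ∈ C_c^∞(G)` or `F ∈ C_c^∞(Z \ G)`). -/
def IsTestFunction {n : ℕ} (F : G n → ℂ) : Prop :=
  IsSmooth F ∧
    (HasCompactSupport F ∨
      ((∀ z g, F (central n z * g) = F g) ∧
        ∃ C : Set (G n), IsCompact C ∧ ∀ g, F g ≠ 0 → ∃ z, ∃ k ∈ C, g = central n z * k))

/-- `K(X, τ)`: the elements of `G` at distance less than `τ / X` from `I_n` in every entry. -/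
def K (n : ℕ) (X τ : ℝ) : Set (G n) :=
  {g | ∀ i j, |g.val i j - (1 : Matrix (Fin n) (Fin n) ℝ) i j| < τ / X}

/-- `a_X = diag(X^{1-n}, X^{2-n}, …, X^{-1}, 1)`. -/
def aX (n : ℕ) (X : ℝ) : Matrix (Fin n) (Fin n) ℝ :=
  Matrix.diagonal fun i => X ^ ((i.val : ℤ) + 1 - n)

/-- `K(X, τ)^♯ = a_X⁻¹ K(X, τ) a_X`. -/
def KSharp (n : ℕ) (X τ : ℝ) : Set (G n) :=
  {g | ∃ k ∈ K n X τ, g.val = (aX n X)⁻¹ * k.val * aX n X}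

/-- `F` vanishes outside `Z K(X, τ)^♯`. -/
def SupportedInZKSharp {n : ℕ} (X τ : ℝ) (F : G n → ℂ) : Prop :=
  ∀ g, F g ≠ 0 → ∃ z, ∃ k ∈ KSharp n X τ, g = central n z * k

/-- `W_F(g) = ∫_N F(xg) conj(ψ(x)) dx`, with Lebesgue measure in the coordinates of `N`. -/
def whittaker {n : ℕ} (F : G n → ℂ) (g : G n) : ℂ :=
  ∫ u : Pos n → ℝ, F (unip u * g) * (starRingEnd ℂ) (psi (unip u))

/-- The orbital integral `O_ψ(F; g) = ∫_{N_w} W_F(gy) conj(ψ(y)) dy` on the Bruhat cell of a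
representative `w` of `σ`, with Lebesgue measure in the coordinates of `N_w`. -/
def orbital {n : ℕ} (σ : Equiv.Perm (Fin n)) (F : G n → ℂ) (g : G n) : ℂ :=
  ∫ v : Inv σ → ℝ, whittaker F (g * unipW σ v) * (starRingEnd ℂ) (psi (unipW σ v))

/-- Absolute convergence of the orbital integral, as an integral over `N × N_w`. -/
def OrbitalConverges {n : ℕ} (σ : Equiv.Perm (Fin n)) (F : G n → ℂ) (g : G n) : Prop :=
  Integrable fun p : (Pos n → ℝ) × (Inv σ → ℝ) => F (unip p.1 * (g * unipW σ p.2))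

/-- The element `m̃ c* w m̃⁻¹`. -/
def orbitPoint {n : ℕ} (m : Fin (n - 1) → ℕ+) (c : Modulus n) (w : G n) : G n :=
  mTilde m * cStar c * w * (mTilde m)⁻¹

/-- The index set of the geometric side: Weyl elements with an admissible modulus. -/
abbrev GeomIndex {n : ℕ} (m : Fin (n - 1) → ℕ+) (rep : Equiv.Perm (Fin n) → G n) :=
  {p : Equiv.Perm (Fin n) × Modulus n // Admissible m m (rep p.1) p.2}

/-- The term of the geometric side of the Kuznetsov formula that belongs to a Weyl element and an
admissible modulus. -/
def geomTerm {n : ℕ} (m : Fin (n - 1) → ℕ+) (rep : Equiv.Perm (Fin n) → G n) (F : G n → ℂ)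
    (p : GeomIndex m rep) : ℂ :=
  kloosterman m m (rep p.1.1) p.1.2 / (deltaW p.1.1 (mEntry m) : ℂ) *
    orbital p.1.1 F (orbitPoint m p.1.2 (rep p.1.1))

end GLKuznetsov

end

noncomputable section

namespace GLKuznetsov

open Matrix MeasureTheory

/-! ### The divisor bound -/

/-! Put `s = n(n-1)(n-2)/6`, which is the sum of `j - i - 1` over `i < j`. An element `h` of
`K(X,τ)^♯` has `|h_ij - δ_ij| ≤ τ X^(j-i-1)`, so its entries below the diagonal are tiny. All
elements of the Bruhat cells in question have determinant `±1`, so the central factor `z` in `x g y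
= z h` satisfies `|z| = 1 + O(τ/X)`. The proof compares these sizes with the shape of `x g y`, where
`g = m̃ c* w m̃⁻¹`.

Which cells occur: testing admissibility on root subgroups shows that every ascent of `σ` between
neighbours is by one (`admissible_ascent`), so a descent after `d` places puts the `d` largest
values first. The bottom left minor of order `d` is then invariant under `N` on both sides and has
size `|c_d|/m ≥ X^(-n-2)`. For `2 ≤ d ≤ n-2` this is too large for `K^♯`
(`inv_le_abs_det_orbitPoint`, `abs_det_KSharp_le`). There remain `1`, `w_*` and two rotations
(`UnitAscents.classify`). For a rotation (for the other one, after inversion) the part of `x g y` on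
and below the diagonal consists of entries of a rank one matrix, which contradicts diagonal entries
near `±1` (`rotation_disjoint`).

The cell of `w_*`: admissible moduli are geometric progressions `c_k = c_1 r^(k-1)`. The rank one
identity, applied to the middle diagonal entries minus `r`, gives `|c_1| (|r|-1)² < 1`. This number
is the integer `|c_1| - 2|c_2| + |c_3|`, so `|r| = 1` (`abs_ratio_eq_one`) and all `|c_k|` equal one
number `q ≤ X²`. The support lies in a region (`starBox_of_support`) of volume `≪ X^(s+e)
(qX/m)^(-n) X^(-(n-2))` (`exists_lintegral_starBox_le`); its hyperbolic conditions cost only `X^e`.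
The Kloosterman sum is bounded by its number of terms, `≪ q^(n-1+e)` (`norm_kloosterman_star_le`),
and `δ_w(m̃) = m^(n-1)`. The term is therefore at most `X^(s+e) q^(-1+e) m X^(-(2n-2))` up to a
constant. As `n ≥ 4`, one has `m ≤ X^(n+2) ≤ X^(2n-2)`, and the sum over `q ≤ X²` costs only `X^ε`
(`star_term_arith`).

The cell of `1`: the Kloosterman sum vanishes unless all `c_k = ±1`, and the support in `N` has
volume `≪ X^s`. -/

theorem succ_le_mul_rpow {ε : ℝ} (hε : 0 < ε) {p : ℕ} (hp : 2 ≤ p) (a : ℕ) :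
    ((a : ℝ) + 1) ≤ (if (p : ℝ) ^ ε < 2 then 1 + 1 / (ε * Real.log 2) else 1) *
      ((p : ℝ) ^ a) ^ ε := by
  have hp0 : (0 : ℝ) < p := by positivity
  have hlog : 0 < Real.log 2 := Real.log_pos (by norm_num)
  have hswap : ((p : ℝ) ^ a) ^ ε = ((p : ℝ) ^ ε) ^ a := by
    rw [← Real.rpow_natCast, ← Real.rpow_mul hp0.le, mul_comm, Real.rpow_mul hp0.le,
      Real.rpow_natCast]
  -- For a small prime only `p ≥ 2` is used, through `2^(aε) ≥ 1 + a ε log 2`. For a large prime `a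
  -- + 1 ≤ 2^a ≤ p^(aε)` holds without a constant.
  split_ifs with h
  · have h1 : 1 + a * (ε * Real.log 2) ≤ ((p : ℝ) ^ a) ^ ε := by
      have h2 : (2 : ℝ) ^ (a * ε) ≤ ((p : ℝ) ^ a) ^ ε := by
        rw [← Real.rpow_natCast, ← Real.rpow_mul hp0.le]
        exact Real.rpow_le_rpow (by norm_num) (by exact_mod_cast hp) (by positivity)
      have h3 : (2 : ℝ) ^ (a * ε) = Real.exp (a * (ε * Real.log 2)) := by
        rw [Real.rpow_def_of_pos (by norm_num)]; ring_nf
      have := Real.add_one_le_exp (a * (ε * Real.log 2))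
      linarith
    have hk : 0 < ε * Real.log 2 := by positivity
    calc (a : ℝ) + 1 ≤ (1 + 1 / (ε * Real.log 2)) * (1 + a * (ε * Real.log 2)) := by
          have : (1 + 1 / (ε * Real.log 2)) * (1 + a * (ε * Real.log 2)) =
            1 + a + (a * (ε * Real.log 2) + 1 / (ε * Real.log 2)) := by
              field_simp
              ring
          rw [this]
          have : 0 ≤ a * (ε * Real.log 2) + 1 / (ε * Real.log 2) := by positivity
          linarith
      _ ≤ _ := by gcongr
  · rw [one_mul, hswap]
    have h2 : (2 : ℝ) ^ a ≤ ((p : ℝ) ^ ε) ^ a := pow_le_pow_left₀ (by norm_num) (not_lt.mp h) a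
    have h3 : ((a : ℝ) + 1) ≤ 2 ^ a := by exact_mod_cast Nat.lt_two_pow_self
    linarith

/-- The quotient of the two sides factors over primes, and only primes below `2^(1/ε)` contribute a
factor above `1`. There are at most `P` of them, whence the constant `K ^ P`. -/
theorem exists_card_divisors_le {ε : ℝ} (hε : 0 < ε) :
    ∃ C : ℝ, 1 ≤ C ∧ ∀ c : ℕ, c ≠ 0 → (c.divisors.card : ℝ) ≤ C * (c : ℝ) ^ ε := by
  obtain ⟨P, hP⟩ := exists_nat_ge ((2 : ℝ) ^ (1 / ε))
  set K : ℝ := 1 + 1 / (ε * Real.log 2) with hK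
  have hlog : 0 < Real.log 2 := Real.log_pos (by norm_num)
  have hK1 : 1 ≤ K := by rw [hK]; have : 0 < 1 / (ε * Real.log 2) := by positivity
                         linarith
  refine ⟨K ^ P, one_le_pow₀ hK1, fun c hc => ?_⟩
  rw [Nat.card_divisors hc]
  have hfac : (c : ℝ) ^ ε = ∏ p ∈ c.primeFactors, ((p : ℝ) ^ c.factorization p) ^ ε := by
    rw [Real.finsetProd_rpow _ _ (fun i _ => by positivity)]
    congr 1
    conv_lhs => rw [← Nat.prod_factorization_pow_eq_self hc]
    simp [Finsupp.prod]
  push_cast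
  calc ∏ p ∈ c.primeFactors, ((c.factorization p : ℝ) + 1)
      ≤ ∏ p ∈ c.primeFactors, ((if (p : ℝ) ^ ε < 2 then K else 1) *
          ((p : ℝ) ^ c.factorization p) ^ ε) := by
        apply Finset.prod_le_prod
        · intros; positivity
        · intro p hp
          exact succ_le_mul_rpow hε (Nat.prime_of_mem_primeFactors hp).two_le _
    _ = (∏ p ∈ c.primeFactors, (if (p : ℝ) ^ ε < 2 then K else 1)) * (c : ℝ) ^ ε := by
        rw [Finset.prod_mul_distrib, hfac]
    _ ≤ K ^ P * (c : ℝ) ^ ε := by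
        gcongr
        rw [← Finset.prod_filter, Finset.prod_const]
        apply pow_le_pow_right₀ hK1
        calc _ ≤ (Finset.range P).card := by
              apply Finset.card_le_card
              intro p hp
              rw [Finset.mem_filter] at hp
              rw [Finset.mem_range]
              have h1 : (p : ℝ) < 2 ^ (1 / ε) := by
                have := Real.rpow_lt_rpow (by positivity) hp.2 (show 0 < 1 / ε by positivity)
                rwa [← Real.rpow_mul (by positivity), mul_one_div_cancel hε.ne',
                  Real.rpow_one] at this
              exact_mod_cast h1.trans_le hP
          _ = P := by simp

/-- Pairs of residues modulo `c` with product divisible by `c`. -/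
def zeroPairs (c : ℕ) : Finset (ℕ × ℕ) :=
  (Finset.range c ×ˢ Finset.range c).filter fun p => c ∣ p.1 * p.2

/-- Sort the pairs `(b, v)` by `d = gcd(c, b)`: then `b` is a multiple of `d` and `v` a multiple of
`c/d`, which leaves at most `(c/d) · d = c` pairs for each divisor `d`. -/
theorem card_zeroPairs_le (c : ℕ) : (zeroPairs c).card ≤ c * c.divisors.card := by
  have hsub : zeroPairs c ⊆ c.divisors.biUnion fun d =>
      (Finset.range (c / d) ×ˢ Finset.range d).image fun p => (d * p.1, c / d * p.2) := by
    rintro ⟨b, v⟩ h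
    simp only [zeroPairs, Finset.mem_filter, Finset.mem_product, Finset.mem_range] at h
    obtain ⟨⟨hb, hv⟩, hd⟩ := h
    have hc : 0 < c := by omega
    have hg : 0 < Nat.gcd c b := Nat.gcd_pos_of_pos_left _ hc
    simp only [Finset.mem_biUnion, Finset.mem_image, Finset.mem_product, Finset.mem_range]
    obtain ⟨c', hc'⟩ := Nat.gcd_dvd_left c b
    obtain ⟨b', hb'⟩ := Nat.gcd_dvd_right c b
    have hdiv : c / Nat.gcd c b = c' := Nat.div_eq_of_eq_mul_right hg hc'
    have hcop : Nat.Coprime c' b' := by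
      have := Nat.coprime_div_gcd_div_gcd hg
      rwa [hdiv, show b / Nat.gcd c b = b' from Nat.div_eq_of_eq_mul_right hg hb'] at this
    have hv' : c' ∣ v := by
      apply hcop.dvd_of_dvd_mul_left
      apply Nat.dvd_of_mul_dvd_mul_left hg
      rw [← hc', ← mul_assoc, ← hb']
      exact hd
    obtain ⟨v', rfl⟩ := hv'
    have hc'0 : 0 < c' := by
      rcases Nat.eq_zero_or_pos c' with h | h
      · rw [h] at hc'; omega
      · exact h
    refine ⟨Nat.gcd c b, Nat.mem_divisors.mpr ⟨Nat.gcd_dvd_left c b, hc.ne'⟩, (b', v'), ?_, ?_⟩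
    · rw [hdiv]
      constructor
      · apply Nat.lt_of_mul_lt_mul_left (a := Nat.gcd c b)
        rw [← hb', ← hc']; exact hb
      · apply Nat.lt_of_mul_lt_mul_left (a := c')
        rw [Nat.mul_comm c' (Nat.gcd c b), ← hc']; exact hv
    · rw [hdiv]
      exact Prod.ext hb'.symm rfl
  refine (Finset.card_le_card hsub).trans (Finset.card_biUnion_le.trans ?_)
  rw [mul_comm, ← smul_eq_mul]
  apply Finset.sum_le_card_nsmul
  intro d hd
  refine Finset.card_image_le.trans ?_
  rw [Finset.card_product, Finset.card_range, Finset.card_range]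
  exact (Nat.div_mul_cancel (Nat.dvd_of_mem_divisors hd)).le

/-! ### Permutations whose only ascents are by one -/

section Perm

variable {n : ℕ} {σ : Equiv.Perm (Fin n)}

/-- Every ascent of `σ` between neighbours is by exactly one. -/
def UnitAscents (σ : Equiv.Perm (Fin n)) : Prop :=
  ∀ i j : Fin n, i.val + 1 = j.val → σ i < σ j → (σ i).val + 1 = (σ j).val

/-- Rigidity of distant ascents: `σ` must be a translation on the whole interval. If the first step
went up, it goes up by one and induction applies. If it went down, the later values would increase
by ones through `σ i` again, against injectivity. -/
theorem UnitAscents.eq_add (h : UnitAscents σ) : ∀ (d : ℕ) (i j : Fin n), i.val + d = j.val →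
    σ i < σ j → ∀ k : Fin n, i ≤ k → k ≤ j → (σ k).val + i.val = (σ i).val + k.val := by
  intro d
  induction d with
  | zero =>
    intro i j hij hlt
    have : i = j := Fin.ext (by omega)
    subst this
    exact absurd hlt (lt_irrefl _)
  | succ d ih =>
    intro i j hij hlt k hik hkj
    have hi1 : i.val + 1 < n := by have := j.2; omega
    set i' : Fin n := ⟨i.val + 1, hi1⟩ with hi'
    rcases eq_or_lt_of_le hik with rfl | hik'
    · rfl
    have hk' : i' ≤ k := by
      have : i.val < k.val := hik'
      exact Fin.mk_le_of_le_val (by omega)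
    by_cases hc : σ i < σ i'
    · have h1 := h i i' rfl hc
      rcases Nat.eq_zero_or_pos d with rfl | hd
      · have : k = i' := Fin.ext (by
          have : k.val ≤ j.val := hkj
          have : i'.val ≤ k.val := hk'
          simp only [hi'] at *; omega)
        rw [this]; simp only [hi'] at *; omega
      · have hlt' : σ i' < σ j := by
          refine lt_of_le_of_ne ?_ (fun e => ?_)
          · have : (σ i).val < (σ j).val := hlt
            exact Fin.le_def.mpr (by omega)
          · have := congrArg Fin.val (σ.injective e)
            simp only [hi'] at this; omega
        have := ih i' j (by simp only [hi']; omega) hlt' k hk' hkj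
        simp only [hi'] at *; omega
    · exfalso
      have hne : σ i ≠ σ i' := fun e => by
        have := congrArg Fin.val (σ.injective e)
        simp [hi'] at this
      have hlt1 : (σ i').val < (σ i).val := lt_of_le_of_ne (not_lt.mp hc) (Fin.val_ne_of_ne hne.symm)
      have hlt2 : (σ i).val < (σ j).val := hlt
      have hlt' : σ i' < σ j := Fin.lt_def.mpr (by omega)
      have hj := ih i' j (by simp only [hi']; omega) hlt' j (by
        refine Fin.le_def.mpr ?_; simp only [hi']; omega) le_rfl
      -- The position `i' + e` lies in the interval on which `σ` is already a translation, and its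
      -- value is `σ i`.
      set e := (σ i).val - (σ i').val with he
      have hk2 : i'.val + e < n := by
        have := j.2
        simp only [hi'] at *; omega
      have hm := ih i' j (by simp only [hi']; omega) hlt' ⟨i'.val + e, hk2⟩
        (Fin.le_def.mpr (by simp)) (Fin.le_def.mpr (by simp only [hi'] at *; omega))
      have heq : σ ⟨i'.val + e, hk2⟩ = σ i := Fin.ext (by simp only [hi'] at *; omega)
      have := congrArg Fin.val (σ.injective heq)
      simp only [hi'] at this; omega

/-- Otherwise `σ` would be a translation on `[a, b]`, an interval that contains the descent. -/
theorem UnitAscents.descent (h : UnitAscents σ) {i j : Fin n} (hij : i.val + 1 = j.val)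
    (hd : σ j < σ i) {a b : Fin n} (ha : a ≤ i) (hb : j ≤ b) : σ b < σ a := by
  by_contra hc
  have hab : a.val < b.val := by
    have : a.val ≤ i.val := ha
    have : j.val ≤ b.val := hb
    omega
  have hne : σ a ≠ σ b := fun e => by
    have := congrArg Fin.val (σ.injective e); omega
  have hlt : σ a < σ b := lt_of_le_of_ne (not_lt.mp hc) hne
  have h1 := h.eq_add (b.val - a.val) a b (by omega) hlt i ha (by
    refine Fin.le_def.mpr ?_
    have : j.val ≤ b.val := hb
    omega)
  have h2 := h.eq_add (b.val - a.val) a b (by omega) hlt j (by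
    refine Fin.le_def.mpr ?_
    have : a.val ≤ i.val := ha
    omega) hb
  have : (σ j).val < (σ i).val := hd
  omega

/-- The first `i + 1` values before a descent are the largest ones. -/
theorem UnitAscents.le_of_descent (h : UnitAscents σ) {i j : Fin n} (hij : i.val + 1 = j.val)
    (hd : σ j < σ i) {a : Fin n} (ha : a ≤ i) : n ≤ (σ a).val + j.val := by
  -- The `n - j` positions from `j` on all have values below `σ a`; comparing cardinalities gives
  -- the claim.
  have hsub : (Finset.univ.filter fun b : Fin n => j ≤ b).image σ ⊆
      Finset.univ.filter fun b : Fin n => b < σ a := by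
    intro b hb
    simp only [Finset.mem_image, Finset.mem_filter, Finset.mem_univ, true_and] at hb ⊢
    obtain ⟨b, hb, rfl⟩ := hb
    exact h.descent hij hd ha hb
  have := Finset.card_le_card hsub
  rw [Finset.card_image_of_injective _ σ.injective, Finset.filter_le_eq_Ici,
    Finset.filter_gt_eq_Iio, Fin.card_Ici, Fin.card_Iio] at this
  omega

/-- A permutation with unit ascents all of whose descents are at the first or at the last place
is trivial, the exchange of the extreme indices, or one of the two rotations. -/
theorem UnitAscents.classify (hn : 3 < n) (h : UnitAscents σ)
    (hd : ∀ i j : Fin n, i.val + 1 = j.val → 1 ≤ i.val → i.val + 2 < n → σ i < σ j) :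
    σ = 1 ∨ σ = starPerm n (by omega) ∨
      (∀ i : Fin n, (σ i).val = if i.val = 0 then n - 1 else i.val - 1) ∨
      (∀ i : Fin n, (σ i).val = if i.val + 1 = n then 0 else i.val + 1) := by
  obtain ⟨a0, ha0⟩ : ∃ a : Fin n, a.val = 0 := ⟨⟨0, by omega⟩, rfl⟩
  obtain ⟨a1, ha1⟩ : ∃ a : Fin n, a.val = 1 := ⟨⟨1, by omega⟩, rfl⟩
  obtain ⟨b1, hb1⟩ : ∃ a : Fin n, a.val = n - 2 := ⟨⟨n - 2, by omega⟩, rfl⟩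
  obtain ⟨b0, hb0⟩ : ∃ a : Fin n, a.val = n - 1 := ⟨⟨n - 1, by omega⟩, rfl⟩
  -- On the middle positions every step is an ascent, so `σ` is a translation there and `σ a1`
  -- determines it.
  have hmid : ∀ k : Fin n, 1 ≤ k.val → k.val ≤ n - 2 → (σ k).val + 1 = (σ a1).val + k.val := by
    have : ∀ d : ℕ, ∀ k : Fin n, k.val = 1 + d → k.val ≤ n - 2 →
        (σ k).val + 1 = (σ a1).val + k.val := by
      intro d
      induction d with
      | zero =>
        intro k hk _
        rw [show k = a1 from Fin.ext (by omega), ha1]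
      | succ d ih =>
        intro k hk hk'
        have h1 := ih ⟨1 + d, by omega⟩ rfl (by simp; omega)
        have h2 := h ⟨1 + d, by omega⟩ k (by simp; omega)
          (hd _ _ (by simp; omega) (by simp) (by simp; omega))
        simp only at h1
        omega
    intro k hk1 hk2
    exact this (k.val - 1) k (by omega) hk2
  have hcases : ∀ k : Fin n, k = a0 ∨ k = b0 ∨ (1 ≤ k.val ∧ k.val ≤ n - 2) := by
    intro k
    have := k.2
    rcases Nat.eq_zero_or_pos k.val with h | h
    · exact Or.inl (Fin.ext (by omega))
    · by_cases h' : k.val = n - 1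
      · exact Or.inr (Or.inl (Fin.ext (by omega)))
      · exact Or.inr (Or.inr ⟨h, by omega⟩)
  have hb1v := hmid b1 (by omega) (by omega)
  have inj : ∀ i j : Fin n, i.val ≠ j.val → (σ i).val ≠ (σ j).val := fun i j hij e =>
    hij (congrArg Fin.val (σ.injective (Fin.ext e)))
  have i01 := inj a0 a1 (by omega)
  have i0b := inj a0 b0 (by omega)
  have ibb := inj b1 b0 (by omega)
  -- The middle values fill an interval, so the two end positions take values outside it.
  have avoid : ∀ k : Fin n, (k = a0 ∨ k = b0) →
      (σ k).val < (σ a1).val ∨ (σ b1).val < (σ k).val := by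
    intro k hk
    by_contra hcon
    push Not at hcon
    obtain ⟨l, hl⟩ : ∃ l : Fin n, l.val = (σ k).val + 1 - (σ a1).val :=
      ⟨⟨(σ k).val + 1 - (σ a1).val, by have := (σ k).2; omega⟩, rfl⟩
    have h1 := hmid l (by omega) (by omega)
    have hk' : k.val = 0 ∨ k.val = n - 1 := by
      rcases hk with rfl | rfl
      · exact Or.inl ha0
      · exact Or.inr hb0
    have h2 := inj k l (by omega)
    omega
  have av0 := avoid a0 (Or.inl rfl)
  have avb := avoid b0 (Or.inr rfl)
  have l0 := (σ a0).2
  have lb := (σ b0).2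
  have l1 := (σ b1).2
  have up0 : σ a0 < σ a1 → (σ a0).val + 1 = (σ a1).val := h a0 a1 (by omega)
  have upb : σ b1 < σ b0 → (σ b1).val + 1 = (σ b0).val := h b1 b0 (by omega)
  rw [Fin.lt_def] at up0 upb
  -- The middle interval has `n - 2` of the `n` values, and an ascent at either end must be by one.
  -- This leaves four arrangements.
  have key : ((σ a0).val = 0 ∧ (σ a1).val = 1 ∧ (σ b0).val = n - 1) ∨
      ((σ a0).val = n - 1 ∧ (σ a1).val = 1 ∧ (σ b0).val = 0) ∨
      ((σ a0).val = n - 1 ∧ (σ a1).val = 0 ∧ (σ b0).val = n - 2) ∨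
      ((σ a0).val = 1 ∧ (σ a1).val = 2 ∧ (σ b0).val = 0) := by
    omega
  have hval : ∀ k : Fin n, k.val = 0 ∧ (σ k).val = (σ a0).val ∨
      k.val = n - 1 ∧ (σ k).val = (σ b0).val ∨
      1 ≤ k.val ∧ k.val ≤ n - 2 ∧ (σ k).val + 1 = (σ a1).val + k.val := by
    intro k
    rcases hcases k with rfl | rfl | ⟨hk1, hk2⟩
    · exact Or.inl ⟨ha0, rfl⟩
    · exact Or.inr (Or.inl ⟨hb0, rfl⟩)
    · exact Or.inr (Or.inr ⟨hk1, hk2, hmid k hk1 hk2⟩)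
  rcases key with ⟨k0, k1, kb⟩ | ⟨k0, k1, kb⟩ | ⟨k0, k1, kb⟩ | ⟨k0, k1, kb⟩
  · left
    ext k
    rw [Equiv.Perm.one_apply]
    have := hval k
    omega
  · right; left
    ext k
    have := hval k
    rw [starPerm, Equiv.swap_apply_def]
    split_ifs with h1 h2
    · have := congrArg Fin.val h1
      simp only at this ⊢; omega
    · have := congrArg Fin.val h2
      simp only at this ⊢; omega
    · have h1' : k.val ≠ 0 := fun e => h1 (Fin.ext e)
      have h2' : k.val ≠ n - 1 := fun e => h2 (Fin.ext e)
      omega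
  · right; right; left
    intro k
    have := hval k
    split_ifs <;> omega
  · right; right; right
    intro k
    have := hval k
    split_ifs <;> omega

end Perm

/-! ### Integrals of triangular products -/

open scoped ENNReal in
-- The centre `f i` depends only on coordinates of rank smaller than that of `i`. Integrating a
-- coordinate of largest rank first therefore affects a single factor, and translation invariance
-- removes its centre.
theorem lintegral_prod_sub_le {ι : Type*} [Fintype ι] [DecidableEq ι] (rank : ι → ℕ) (k : ι → ℝ → ℝ≥0∞)
    (f : ι → (ι → ℝ) → ℝ) (hk : ∀ i, Measurable (k i)) (hf : ∀ i, Measurable (f i))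
    (hdep : ∀ i j, rank i ≤ rank j → ∀ x t, f i (Function.update x j t) = f i x) :
    ∫⁻ x : ι → ℝ, ∏ i, k i (x i - f i x) ≤ ∏ i, ∫⁻ t, k i t := by
  have hmeas : ∀ s : Finset ι, Measurable fun x : ι → ℝ => ∏ i ∈ s, k i (x i - f i x) :=
    fun s => Finset.measurable_prod _ fun i _ =>
      (hk i).comp ((measurable_pi_apply i).sub (hf i))
  have main : ∀ s : Finset ι, ∀ x,
      (∫⋯∫⁻_s, (fun x : ι → ℝ => ∏ i ∈ s, k i (x i - f i x)) ∂fun _ => volume) x ≤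
        ∏ i ∈ s, ∫⁻ t, k i t := by
    intro s
    refine Finset.induction_on_max_value rank s (fun x => by simp) ?_
    · intro a s ha hmax ih x
      rw [lmarginal_insert' _ (hmeas _) ha]
      have hin : ∀ x : ι → ℝ, ∫⁻ t, ∏ i ∈ insert a s,
          k i (Function.update x a t i - f i (Function.update x a t)) =
          (∏ i ∈ s, k i (x i - f i x)) * ∫⁻ t, k a t := by
        intro x
        have : ∀ t, ∏ i ∈ insert a s,
            k i (Function.update x a t i - f i (Function.update x a t)) =
            (∏ i ∈ s, k i (x i - f i x)) * k a (t - f a x) := by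
          intro t
          rw [Finset.prod_insert ha, mul_comm, hdep a a le_rfl, Function.update_self]
          congr 1
          refine Finset.prod_congr rfl fun i hi => ?_
          rw [hdep i a (hmax i hi), Function.update_of_ne]
          rintro rfl; exact ha hi
        simp_rw [this]
        rw [lintegral_const_mul (f := fun t => k a (t - f a x)) _
            ((hk a).comp (measurable_id.sub_const _)),
          lintegral_sub_right_eq_self (fun t => k a t)]
      simp_rw [hin]
      rw [Finset.prod_insert ha, mul_comm]
      have h2 : (∫⋯∫⁻_s, (fun x : ι → ℝ => (∏ i ∈ s, k i (x i - f i x)) * ∫⁻ t, k a t)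
          ∂fun _ => volume) x =
          (∫⋯∫⁻_s, (fun x : ι → ℝ => ∏ i ∈ s, k i (x i - f i x)) ∂fun _ => volume) x *
            ∫⁻ t, k a t := by
        unfold lmarginal
        rw [lintegral_mul_const]
        exact (hmeas s).comp measurable_updateFinset
      rw [h2]
      gcongr
      exact ih x
  have := main Finset.univ 0
  rw [lmarginal_univ] at this
  exact this

/-- Volume of the interval `|t| ≤ R`. -/
theorem lintegral_indicator_abs_le (R : ℝ) :
    ∫⁻ t : ℝ, Set.indicator {t : ℝ | |t| ≤ R} 1 t = ENNReal.ofReal (2 * R) := by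
  have : {t : ℝ | |t| ≤ R} = Set.Icc (-R) R := by ext t; simp [abs_le]
  rw [this, lintegral_indicator_one measurableSet_Icc, Real.volume_Icc]
  congr 1; ring

/-- Volume of the set `||α t| - 1| ≤ R`. -/
theorem lintegral_indicator_abs_sub_one_le {α : ℝ} (hα : α ≠ 0) (R : ℝ) :
    ∫⁻ t : ℝ, Set.indicator {t : ℝ | |(|α * t| - 1)| ≤ R} 1 t ≤
      ENNReal.ofReal (4 * R / |α|) := by
  have hα' : 0 < |α| := abs_pos.mpr hα
  by_cases hR : R < 0
  · have : {t : ℝ | |(|α * t| - 1)| ≤ R} = ∅ := by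
      ext t
      simp only [Set.mem_ofPred_eq, Set.mem_empty_iff_false, iff_false, not_le]
      exact hR.trans_le (abs_nonneg _)
    rw [this]; simp
  push Not at hR
  have hsub : {t : ℝ | |(|α * t| - 1)| ≤ R} ⊆
      Metric.closedBall (1 / |α|) (R / |α|) ∪ Metric.closedBall (-(1 / |α|)) (R / |α|) := by
    intro t ht
    have ht' : |(|α| * |t| - 1)| ≤ R := by rw [← abs_mul]; exact ht
    have h3 : |(|t| - 1 / |α|)| ≤ R / |α| := by
      have : |(|t| - 1 / |α|)| * |α| = |(|α| * |t| - 1)| := by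
        conv_lhs => rw [← abs_abs α, ← abs_mul, abs_abs]
        rw [sub_mul, one_div_mul_cancel hα'.ne', mul_comm]
      rw [le_div_iff₀ hα', this]
      exact ht'
    rw [Set.mem_union, Metric.mem_closedBall, Metric.mem_closedBall, Real.dist_eq, Real.dist_eq]
    rcases le_total 0 t with h | h
    · left; rwa [abs_of_nonneg h] at h3
    · right
      rw [abs_of_nonpos h] at h3
      rw [← abs_neg]
      convert h3 using 2
      ring
  have hmeas : MeasurableSet {t : ℝ | |(|α * t| - 1)| ≤ R} :=
    (isClosed_le (by fun_prop) continuous_const).measurableSet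
  rw [lintegral_indicator_one hmeas]
  refine (measure_mono hsub).trans ((measure_union_le _ _).trans ?_)
  rw [Real.volume_closedBall, Real.volume_closedBall, ← ENNReal.ofReal_add (by positivity)
    (by positivity)]
  apply le_of_eq
  congr 1; ring

/-- A truncated singular power is integrable. -/
theorem lintegral_indicator_rpow_le {R e : ℝ} (hR : 0 ≤ R) (he : 0 < e) :
    ∫⁻ t : ℝ, Set.indicator {t : ℝ | |t| ≤ R} (fun t => ENNReal.ofReal (|t| ^ (e - 1))) t ≤
      ENNReal.ofReal (2 * R ^ e / e) := by
  have hset : {t : ℝ | |t| ≤ R} ⊆ Set.Icc 0 R ∪ Set.Icc (-R) 0 := by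
    intro t ht
    have := abs_le.mp (show |t| ≤ R from ht)
    rcases le_total 0 t with h | h
    · exact Or.inl ⟨h, this.2⟩
    · exact Or.inr ⟨this.1, h⟩
  have h1 : ∫⁻ t in Set.Icc 0 R, ENNReal.ofReal (|t| ^ (e - 1)) = ENNReal.ofReal (R ^ e / e) := by
    have hint : IntervalIntegrable (fun t : ℝ => t ^ (e - 1)) volume 0 R :=
      intervalIntegral.intervalIntegrable_rpow' (by linarith)
    have heq : ∫ t in (0 : ℝ)..R, t ^ (e - 1) = R ^ e / e := by
      rw [integral_rpow (Or.inl (by linarith))]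
      simp [he.ne']
    rw [← heq, intervalIntegral.integral_of_le hR, ofReal_integral_eq_lintegral_ofReal]
    · rw [restrict_Ioc_eq_restrict_Icc]
      refine setLIntegral_congr_fun measurableSet_Icc fun t ht => ?_
      rw [abs_of_nonneg ht.1]
    · exact (intervalIntegrable_iff_integrableOn_Ioc_of_le hR).mp hint
    · refine (ae_restrict_iff' measurableSet_Ioc).mpr (Filter.Eventually.of_forall fun t ht => ?_)
      exact Real.rpow_nonneg ht.1.le _
  have h2 : ∫⁻ t in Set.Icc (-R) 0, ENNReal.ofReal (|t| ^ (e - 1)) =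
      ENNReal.ofReal (R ^ e / e) := by
    rw [← h1, ← lintegral_indicator measurableSet_Icc, ← lintegral_indicator measurableSet_Icc,
      ← lintegral_neg_eq_self]
    refine lintegral_congr fun t => ?_
    by_cases h : t ∈ Set.Icc 0 R
    · have h' : -t ∈ Set.Icc (-R) 0 := ⟨by linarith [h.2], by linarith [h.1]⟩
      rw [Set.indicator_of_mem h', Set.indicator_of_mem h, abs_neg]
    · have h' : -t ∉ Set.Icc (-R) 0 := fun h' => h ⟨by linarith [h'.2], by linarith [h'.1]⟩
      rw [Set.indicator_of_notMem h', Set.indicator_of_notMem h]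
  have hm : MeasurableSet {t : ℝ | |t| ≤ R} :=
    (isClosed_le (by fun_prop) continuous_const).measurableSet
  rw [lintegral_indicator hm]
  calc _ ≤ ∫⁻ t in Set.Icc 0 R ∪ Set.Icc (-R) 0, ENNReal.ofReal (|t| ^ (e - 1)) :=
        lintegral_mono_set hset
    _ ≤ _ := lintegral_union_le _ _ _
    _ = _ := by
      rw [h1, h2, ← ENNReal.ofReal_add (by positivity) (by positivity)]
      congr 1; ring

/-! ### Matrices close to the identity -/

/-- The determinant is a polynomial in the entries, hence Lipschitz near the identity. -/
theorem exists_abs_det_sub_one_le (n : ℕ) : ∃ C d : ℝ, 0 < C ∧ 0 < d ∧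
    ∀ δ : ℝ, 0 ≤ δ → δ ≤ d → ∀ k : Matrix (Fin n) (Fin n) ℝ,
      (∀ i j, |k i j - (1 : Matrix (Fin n) (Fin n) ℝ) i j| ≤ δ) → |k.det - 1| ≤ C * δ := by
  have hc : ContDiff ℝ 1 fun k : Fin n → Fin n → ℝ => (Matrix.of k).det := by
    simp only [Matrix.det_apply, Matrix.of_apply]
    fun_prop
  obtain ⟨K, t, ht, hL⟩ := hc.contDiffAt.exists_lipschitzOnWith
    (x := (fun i j => (1 : Matrix (Fin n) (Fin n) ℝ) i j))
  obtain ⟨d, hd, hball⟩ := Metric.mem_nhds_iff.mp ht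
  refine ⟨K + 1, d / 2, by positivity, by positivity, fun δ hδ0 hδ k hk => ?_⟩
  have hdist : dist (fun i j => k i j) (fun i j => (1 : Matrix (Fin n) (Fin n) ℝ) i j) ≤ δ := by
    refine (dist_pi_le_iff hδ0).mpr fun i => (dist_pi_le_iff hδ0).mpr fun j => ?_
    rw [Real.dist_eq]; exact hk i j
  have h1 := hL.dist_le_mul (fun i j => k i j) (hball (by
    rw [Metric.mem_ball]; linarith)) _ (mem_of_mem_nhds ht)
  rw [Real.dist_eq] at h1
  have e1 : (Matrix.of fun i j => (1 : Matrix (Fin n) (Fin n) ℝ) i j).det = 1 := Matrix.det_one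
  have e2 : (Matrix.of fun i j => k i j).det = k.det := rfl
  rw [e1, e2] at h1
  calc _ ≤ _ := h1
    _ ≤ K * δ := by gcongr
    _ ≤ _ := by nlinarith [K.2]

/-- With `B = k⁻¹ - 1` and `E = 1 - k` one has `B = B E + E`. At the entry where `|B|` is largest
this reads `|B| ≤ n δ |B| + δ`, and `n δ ≤ 1/2` absorbs the first term. -/
theorem abs_inv_sub_one_le {n : ℕ} {δ : ℝ} (hδ : (n : ℝ) * δ ≤ 1 / 2) (k : G n)
    (hk : ∀ i j, |k.val i j - (1 : Matrix (Fin n) (Fin n) ℝ) i j| ≤ δ) (i j : Fin n) :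
    |k⁻¹.val i j - (1 : Matrix (Fin n) (Fin n) ℝ) i j| ≤ 2 * δ := by
  set B : Matrix (Fin n) (Fin n) ℝ := k⁻¹.val - 1 with hB
  set E : Matrix (Fin n) (Fin n) ℝ := 1 - k.val with hE
  have hmul : B = B * E + E := by
    have : k⁻¹.val * k.val = 1 := by rw [← Units.val_mul]; simp
    rw [hB, hE, sub_mul, mul_sub, this]; simp
  have hEb : ∀ i j, |E i j| ≤ δ := fun i j => by
    rw [hE, Matrix.sub_apply, abs_sub_comm]; exact hk i j
  obtain ⟨p, -, hp⟩ := Finset.exists_max_image (Finset.univ : Finset (Fin n × Fin n))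
    (fun p => |B p.1 p.2|) ⟨(i, j), Finset.mem_univ _⟩
  have h1 : |B p.1 p.2| ≤ n * (|B p.1 p.2| * δ) + δ := by
    conv_lhs => rw [hmul]
    rw [Matrix.add_apply, Matrix.mul_apply]
    refine (abs_add_le _ _).trans (add_le_add ?_ (hEb _ _))
    refine (Finset.abs_sum_le_sum_abs _ _).trans ?_
    have : ∀ l ∈ Finset.univ, |B p.1 l * E l p.2| ≤ |B p.1 p.2| * δ := fun l _ => by
      rw [abs_mul]
      exact mul_le_mul (hp (p.1, l) (Finset.mem_univ _)) (hEb _ _) (abs_nonneg _) (abs_nonneg _)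
    simpa using Finset.sum_le_card_nsmul _ _ _ this
  have h2 : |B i j| ≤ |B p.1 p.2| := hp (i, j) (Finset.mem_univ _)
  have h3 := abs_nonneg (B p.1 p.2)
  have h4 : |B i j| = |k⁻¹.val i j - (1 : Matrix (Fin n) (Fin n) ℝ) i j| := by
    rw [hB, Matrix.sub_apply]
  rw [← h4]
  nlinarith

/-- `∑_{i < j} (j - i - 1) = n (n - 1) (n - 2) / 6`. -/
theorem sum_pos_sub (n : ℕ) : ∑ p : Pos n, ((p.1.2.val : ℝ) - p.1.1.val - 1) =
    (n : ℝ) * ((n : ℝ) - 1) * ((n : ℝ) - 2) / 6 := by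
  have h0 : ∑ p : Pos n, ((p.1.2.val : ℝ) - p.1.1.val - 1) =
      ∑ j ∈ Finset.range n, ∑ i ∈ Finset.range j, ((j : ℝ) - i - 1) := by
    rw [Finset.sum_sigma']
    refine Finset.sum_bij' (fun p _ => ⟨p.1.2.val, p.1.1.val⟩)
      (fun q hq => ⟨(⟨q.2, ?_⟩, ⟨q.1, ?_⟩), ?_⟩) ?_ ?_ ?_ ?_ ?_
    · simp only [Finset.mem_sigma, Finset.mem_range] at hq; omega
    · simp only [Finset.mem_sigma, Finset.mem_range] at hq; omega
    · simp only [Finset.mem_sigma, Finset.mem_range] at hq; exact hq.2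
    · intro p _
      simp only [Finset.mem_sigma, Finset.mem_range]
      exact ⟨p.1.2.2, p.2⟩
    · intro q _; exact Finset.mem_univ _
    · intro p _; rfl
    · intro q _; rfl
    · intro p _; rfl
  have h1 : ∀ j : ℕ, ∑ i ∈ Finset.range j, ((j : ℝ) - i - 1) = (j : ℝ) * (j - 1) / 2 := by
    intro j
    have : ∀ (a : ℝ), ∑ i ∈ Finset.range j, (a - i - 1) = j * a - (j : ℝ) * (j + 1) / 2 := by
      intro a
      induction j with
      | zero => simp
      | succ j ih => rw [Finset.sum_range_succ, ih]; push_cast; ring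
    rw [this]; ring
  rw [h0]
  simp_rw [h1]
  clear h0 h1
  induction n with
  | zero => simp
  | succ n ih => rw [Finset.sum_range_succ, ih]; push_cast; ring

/-! ### Unipotent subgroups -/

/-- Unitriangular matrices with respect to an order of the indices. -/
def unitriangular {n : ℕ} {α : Type*} [LinearOrder α] (b : Fin n → α) (hb : b.Injective) :
    Subgroup (G n) where
  carrier := {g | (∀ i, g.val i i = 1) ∧ ∀ i j, b j < b i → g.val i j = 0}
  one_mem' := by
    refine ⟨fun i => by simp, fun i j h => ?_⟩
    have : i ≠ j := by rintro rfl; exact lt_irrefl _ h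
    simp [this]
  mul_mem' := by
    rintro g h ⟨g1, g2⟩ ⟨h1, h2⟩
    refine ⟨fun i => ?_, fun i j hij => ?_⟩
    · rw [Units.val_mul, Matrix.mul_apply, Finset.sum_eq_single i, g1, h1, one_mul]
      · intro k _ hk
        rcases lt_or_gt_of_ne (fun e => hk (hb e)) with h | h
        · rw [g2 _ _ h, zero_mul]
        · rw [h2 _ _ h, mul_zero]
      · simp
    · rw [Units.val_mul, Matrix.mul_apply]
      refine Finset.sum_eq_zero fun k _ => ?_
      rcases lt_or_ge (b k) (b i) with h | h
      · rw [g2 _ _ h, zero_mul]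
      · rw [h2 _ _ (hij.trans_le h), mul_zero]
  inv_mem' := by
    rintro g ⟨g1, g2⟩
    have htri : ∀ i j, b j < b i → g⁻¹.val i j = 0 := by
      have htri0 : BlockTriangular g.val b := fun i j h => g2 i j h
      have : Invertible g.val := g.invertible
      have h3 := blockTriangular_inv_of_blockTriangular htri0
      rw [← Matrix.coe_units_inv] at h3
      exact fun i j h => h3 h
    refine ⟨fun i => ?_, htri⟩
    have h4 : (g * g⁻¹).val i i = 1 := by simp
    rw [Units.val_mul, Matrix.mul_apply, Finset.sum_eq_single i, g1, one_mul] at h4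
    · exact h4
    · intro k _ hk
      rcases lt_or_gt_of_ne (fun e => hk (hb e)) with h | h
      · rw [g2 _ _ h, zero_mul]
      · rw [htri _ _ h, mul_zero]
    · simp

/-- `N` as a subgroup. -/
def NSub (n : ℕ) : Subgroup (G n) := unitriangular id Function.injective_id

/-- `Nᵀ` as a subgroup. -/
def NTSub (n : ℕ) : Subgroup (G n) :=
  unitriangular OrderDual.toDual OrderDual.toDual.injective

/-- `N_w` as a subgroup. -/
def NwSub {n : ℕ} (w : G n) : Subgroup (G n) :=
  NSub n ⊓ (NTSub n).comap (MulAut.conj w).toMonoidHom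

theorem coe_NwSub {n : ℕ} (w : G n) : (NwSub w : Set (G n)) = Nw w := by
  ext y
  simp only [NwSub, Subgroup.coe_inf, Set.mem_inter_iff, SetLike.mem_coe, Subgroup.mem_comap]
  rfl

theorem unip_mem {n : ℕ} (v : Pos n → ℝ) : unip v ∈ N n := range_unip n ▸ ⟨v, rfl⟩

theorem det_of_mem_N {n : ℕ} {x : G n} (hx : x ∈ N n) : x.val.det = 1 := by
  rw [← range_unip] at hx
  obtain ⟨v, rfl⟩ := hx
  exact det_unipMat v

/-! ### Diagonal matrices -/

theorem diagG_mul_apply {n : ℕ} (d : Fin n → ℝˣ) (g : G n) (i j : Fin n) :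
    (diagG d * g).val i j = d i * g.val i j := by
  rw [Units.val_mul]
  exact Matrix.diagonal_mul _ _ _ _

theorem mul_diagG_inv_apply {n : ℕ} (d : Fin n → ℝˣ) (g : G n) (i j : Fin n) :
    (g * (diagG d)⁻¹).val i j = g.val i j / d j := by
  rw [Units.val_mul]
  have : ((diagG d)⁻¹ : G n).val = Matrix.diagonal fun i => (((d i)⁻¹ : ℝˣ) : ℝ) := rfl
  rw [this, Matrix.mul_diagonal, Units.val_inv_eq_inv_val, div_eq_mul_inv]

theorem central_mul_apply {n : ℕ} (z : ℝˣ) (g : G n) (i j : Fin n) :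
    (central n z * g).val i j = z * g.val i j := diagG_mul_apply _ _ _ _

/-- The sum of the entries next to the diagonal. -/
def superdiag {n : ℕ} (A : Matrix (Fin n) (Fin n) ℝ) : ℝ :=
  ∑ i : Fin n, ∑ j : Fin n, if i.val + 1 = j.val then A i j else 0

theorem superdiag_of_single {n : ℕ} {A : Matrix (Fin n) (Fin n) ℝ} {i j : Fin n}
    (h : ∀ a b, a ≠ b → ¬ (a = i ∧ b = j) → A a b = 0) :
    superdiag A = if i.val + 1 = j.val then A i j else 0 := by
  have hne : ∀ {a b : Fin n}, a.val + 1 = b.val → a ≠ b := by rintro a _ h rfl; omega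
  rw [superdiag, Finset.sum_eq_single i, Finset.sum_eq_single j]
  · intro b _ hb
    split_ifs with h1
    · exact h _ _ (hne h1) fun h => hb h.2
    · rfl
  · simp
  · intro a _ ha
    refine Finset.sum_eq_zero fun b _ => ?_
    split_ifs with h1
    · exact h _ _ (hne h1) fun h => ha h.1
    · rfl
  · simp

theorem psi_eq {n : ℕ} (x : G n) :
    psi x = Complex.exp (2 * Real.pi * Complex.I * (superdiag x.val : ℂ)) := rfl

theorem norm_psi {n : ℕ} (x : G n) : ‖psi x‖ = 1 := by
  rw [psi_eq, Complex.norm_exp]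
  simp

theorem eq_of_forall_exp_eq {a b : ℝ}
    (h : ∀ s : ℝ, Complex.exp (2 * Real.pi * Complex.I * ((s * a : ℝ) : ℂ)) =
      Complex.exp (2 * Real.pi * Complex.I * ((s * b : ℝ) : ℂ))) : a = b := by
  by_contra hab
  have hne : a - b ≠ 0 := sub_ne_zero.mpr hab
  -- This parameter makes the quotient of the two exponentials `exp(π i) = -1`.
  have h1 := h (1 / (2 * (a - b)))
  have h2 : Complex.exp (2 * Real.pi * Complex.I * ((1 / (2 * (a - b)) * a : ℝ) : ℂ) -
      2 * Real.pi * Complex.I * ((1 / (2 * (a - b)) * b : ℝ) : ℂ)) = 1 := by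
    rw [Complex.exp_sub, h1, div_self (Complex.exp_ne_zero _)]
  have h3 : 2 * Real.pi * Complex.I * ((1 / (2 * (a - b)) * a : ℝ) : ℂ) -
      2 * Real.pi * Complex.I * ((1 / (2 * (a - b)) * b : ℝ) : ℂ) = Real.pi * Complex.I := by
    have hne' : (a : ℂ) - b ≠ 0 := by exact_mod_cast hne
    push_cast
    field_simp
  rw [h3, Complex.exp_pi_mul_I] at h2
  norm_num at h2

/-! ### Consequences of admissibility -/

section Weyl

variable {n : ℕ} {σ : Equiv.Perm (Fin n)} {w : G n} {s : Fin n → ℤˣ}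

/-- The diagonal entries of `c*`. -/
def cs (c : Modulus n) (i : Fin n) : ℝˣ := cExt c (n - i.val) / cExt c (n - i.val - 1)

theorem unit_mul_self (a : ℤˣ) : ((a : ℤ) : ℝ) * ((a : ℤ) : ℝ) = 1 := by
  rcases Int.units_eq_one_or a with h | h <;> simp [h]

theorem abs_unit (a : ℤˣ) : |((a : ℤ) : ℝ)| = 1 := by
  rcases Int.units_eq_one_or a with h | h <;> simp [h]

theorem mTilde_mul_cStar (m : Fin (n - 1) → ℕ+) (c : Modulus n) :
    mTilde m * cStar c = diagG fun i => mEntry m i * cs c i := by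
  apply Units.ext
  ext i j
  rw [mTilde, diagG_mul_apply]
  change _ * Matrix.diagonal (fun i => ((cs c i : ℝˣ) : ℝ)) i j =
    Matrix.diagonal (fun i => ((mEntry m i * cs c i : ℝˣ) : ℝ)) i j
  by_cases h : i = j
  · subst h; simp
  · simp [h]

/-- The entries of a monomial matrix of modulus `c`. -/
theorem orbitPoint_apply (hs : ∀ i j, w.val i j = if i = σ j then ((s j : ℤ) : ℝ) else 0)
    (m : Fin (n - 1) → ℕ+) (c : Modulus n) (i j : Fin n) :
    (orbitPoint m c w).val i j =
      if i = σ j then (mEntry m i * cs c i * ((s j : ℤ) : ℝ) / mEntry m j : ℝ) else 0 := by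
  rw [orbitPoint, mTilde_mul_cStar, mTilde, mul_diagG_inv_apply, diagG_mul_apply, hs]
  split_ifs <;> simp

/-- Test admissibility on the root subgroup of `(i, j)`. Since `σ i < σ j`, conjugation by `w` keeps
it in `N` and moves its only entry to `(σ i, σ j)`. The right hand character is not trivial on it,
so `(σ i, σ j)` must be next to the diagonal and the two linear coefficients must agree. -/
theorem admissible_ascent {m : Fin (n - 1) → ℕ+} {c : Modulus n}
    (hs : ∀ i j, w.val i j = if i = σ j then ((s j : ℤ) : ℝ) else 0)
    (h : Admissible m m w c) {i j : Fin n} (hij : i.val + 1 = j.val) (hσ : σ i < σ j) :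
    (σ i).val + 1 = (σ j).val ∧
      (mEntry m (σ i) * cs c (σ i) / (mEntry m (σ j) * cs c (σ j)) *
        (((s i : ℤ) : ℝ) * ((s j : ℤ) : ℝ)) : ℝ) = mEntry m i / mEntry m j := by
  have hlt : i < j := Fin.lt_def.mpr (by omega)
  set d : Fin n → ℝˣ := fun i => mEntry m i * cs c i with hd
  let x : ℝ → G n := fun r => unip fun p => if p.1 = (i, j) then r else 0
  have hx : ∀ r a b, (x r).val a b = if a = b then 1 else if a = i ∧ b = j then r else 0 := by
    intro r a b
    rw [show (x r).val a b = unipMat (fun p : Pos n => if p.1 = (i, j) then r else 0) a b from rfl]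
    rcases lt_trichotomy a b with hab | hab | hab
    · simp [unipMat, hab, hab.ne, Prod.ext_iff]
    · subst hab; simp [unipMat]
    · have : ¬ (a = i ∧ b = j) := by rintro ⟨rfl, rfl⟩; exact absurd hlt (not_lt.mpr hab.le)
      simp [unipMat, not_lt.mpr hab.le, hab.ne', this]
  have hconj : ∀ r a b, (w * x r * w⁻¹).val (σ a) (σ b) =
      ((s a : ℤ) : ℝ) * (x r).val a b * ((s b : ℤ) : ℝ) := fun r => Represents.conj_apply hs (x r)
  have hmem : ∀ r, w * x r * w⁻¹ ∈ N n := by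
    intro r
    refine ⟨fun a => ?_, fun a b hab => ?_⟩
    · obtain ⟨a, rfl⟩ := σ.surjective a
      rw [hconj, hx, if_pos rfl, mul_one, unit_mul_self]
    · obtain ⟨a, rfl⟩ := σ.surjective a
      obtain ⟨b, rfl⟩ := σ.surjective b
      have h1 : a ≠ b := by rintro rfl; exact lt_irrefl _ hab
      have h2 : ¬ (a = i ∧ b = j) := by
        rintro ⟨rfl, rfl⟩; exact absurd hσ (not_lt.mpr hab.le)
      rw [hconj, hx, if_neg h1, if_neg h2, mul_zero, zero_mul]
  have hL : ∀ r, superdiag (mTilde m * cStar c * w * x r * w⁻¹ * (cStar c)⁻¹ * (mTilde m)⁻¹).val =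
      r * (if (σ i).val + 1 = (σ j).val then
        (d (σ i) / d (σ j) * (((s i : ℤ) : ℝ) * ((s j : ℤ) : ℝ)) : ℝ) else 0) := by
    intro r
    have e : mTilde m * cStar c * w * x r * w⁻¹ * (cStar c)⁻¹ * (mTilde m)⁻¹ =
        diagG d * (w * x r * w⁻¹) * (diagG d)⁻¹ := by
      rw [hd, ← mTilde_mul_cStar]; group
    rw [e, superdiag_of_single (i := σ i) (j := σ j)]
    · by_cases hc : (σ i).val + 1 = (σ j).val
      · rw [if_pos hc, if_pos hc, mul_diagG_inv_apply, diagG_mul_apply, hconj, hx, if_neg hlt.ne,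
          if_pos ⟨rfl, rfl⟩]
        ring
      · rw [if_neg hc, if_neg hc, mul_zero]
    · intro a b hab hab'
      obtain ⟨a, rfl⟩ := σ.surjective a
      obtain ⟨b, rfl⟩ := σ.surjective b
      rw [mul_diagG_inv_apply, diagG_mul_apply, hconj, hx, if_neg (fun h => hab (by rw [h])),
        if_neg (fun h => hab' ⟨by rw [h.1], by rw [h.2]⟩)]
      simp
  have hR : ∀ r, superdiag (mTilde m * x r * (mTilde m)⁻¹).val =
      r * (mEntry m i / mEntry m j : ℝ) := by
    intro r
    rw [superdiag_of_single (i := i) (j := j), mTilde]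
    · rw [mul_diagG_inv_apply, diagG_mul_apply, hx, if_pos hij, if_neg hlt.ne,
        if_pos ⟨rfl, rfl⟩]
      ring
    · intro a b hab hab'
      rw [mTilde, mul_diagG_inv_apply, diagG_mul_apply, hx, if_neg hab, if_neg hab']
      simp
  have key : (if (σ i).val + 1 = (σ j).val then
      (d (σ i) / d (σ j) * (((s i : ℤ) : ℝ) * ((s j : ℤ) : ℝ)) : ℝ) else 0) =
      (mEntry m i / mEntry m j : ℝ) := eq_of_forall_exp_eq fun r => by
    rw [← hL, ← hR]
    exact h (x r) (unip_mem _) (hmem r)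
  by_cases hc : (σ i).val + 1 = (σ j).val
  · refine ⟨hc, ?_⟩
    rw [if_pos hc] at key
    rw [← key, hd]
    simp
  · rw [if_neg hc] at key
    exact absurd key.symm (div_ne_zero (mEntry m i).ne_zero (mEntry m j).ne_zero)

theorem Admissible.unitAscents {m : Fin (n - 1) → ℕ+} {c : Modulus n}
    (hs : ∀ i j, w.val i j = if i = σ j then ((s j : ℤ) : ℝ) else 0)
    (h : Admissible m m w c) : UnitAscents σ := fun _ _ hij hσ => (admissible_ascent hs h hij hσ).1

theorem mEntry_mVec (hn : 2 ≤ n) (m : ℕ+) (i : Fin n) :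
    (mEntry (mVec n m) i : ℝ) = if i.val + 1 < n then ((m : ℕ) : ℝ) else 1 := by
  have hfac : ∀ j : Fin (n - 1), (if j.val + i.val + 1 < n then
      Units.mk0 (((mVec n m j : ℕ+) : ℕ) : ℝ) (Nat.cast_ne_zero.mpr (mVec n m j).ne_zero) else 1) =
      if j.val = 0 ∧ i.val + 1 < n then
        Units.mk0 ((m : ℕ) : ℝ) (Nat.cast_ne_zero.mpr m.ne_zero) else 1 := by
    intro j
    by_cases hj : j.val = 0
    · simp [mVec, hj]
    · simp [mVec, hj]
  rw [mEntry, Finset.prod_congr rfl fun j _ => hfac j, Finset.prod_eq_single ⟨0, by omega⟩]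
  · split_ifs with h1 h2 h2
    · rfl
    · exact absurd h1.2 h2
    · exact absurd ⟨rfl, h2⟩ h1
    · rfl
  · intro j _ hj
    rw [if_neg]
    rintro ⟨h, -⟩
    exact hj (Fin.ext h)
  · simp

theorem cExt_zero (c : Modulus n) : cExt c 0 = 1 := by simp [cExt]

theorem cExt_self (c : Modulus n) : cExt c n = 1 := by simp [cExt]

theorem exists_cExt_eq_int (c : Modulus n) (k : ℕ) :
    ∃ a : ℤ, a ≠ 0 ∧ (cExt c k : ℝ) = a := by
  unfold cExt
  split_ifs with h
  · exact ⟨_, (c ⟨k - 1, by omega⟩).2, rfl⟩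
  · exact ⟨1, one_ne_zero, by simp⟩

theorem one_le_abs_cExt (c : Modulus n) (k : ℕ) : 1 ≤ |(cExt c k : ℝ)| := by
  obtain ⟨a, ha, h⟩ := exists_cExt_eq_int c k
  rw [h]
  exact_mod_cast Int.one_le_abs ha

/-- The product telescopes. It says that the last `d` diagonal entries of `c*` multiply to `c_d`;
this is how the moduli appear as minors. -/
theorem prod_cExt (c : Modulus n) (d : ℕ) :
    ∏ i ∈ Finset.range d, (cExt c (d - i) / cExt c (d - i - 1)) = cExt c d := by
  rw [← Finset.prod_range_reflect]
  have : ∀ i ∈ Finset.range d, cExt c (d - (d - 1 - i)) / cExt c (d - (d - 1 - i) - 1) =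
      cExt c (i + 1) / cExt c i := by
    intro i hi
    rw [Finset.mem_range] at hi
    rw [show d - (d - 1 - i) = i + 1 by omega]; rfl
  rw [Finset.prod_congr rfl this, Finset.prod_range_div, cExt_zero, div_one]

theorem abs_det_of_represents
    (hs : ∀ i j, w.val i j = if i = σ j then ((s j : ℤ) : ℝ) else 0) : |w.val.det| = 1 := by
  have h : w.valᵀ * w.val = 1 := by
    ext i j
    rw [Matrix.mul_apply]
    simp only [Matrix.transpose_apply, hs, Matrix.one_apply]
    by_cases hij : i = j
    · subst hij; simp [unit_mul_self]
    · simp [hij, Ne.symm hij]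
  have := congrArg Matrix.det h
  rw [Matrix.det_mul, Matrix.det_transpose, Matrix.det_one] at this
  rcases mul_self_eq_one_iff.mp this with h | h <;> simp [h]

theorem abs_det_orbitPoint
    (hs : ∀ i j, w.val i j = if i = σ j then ((s j : ℤ) : ℝ) else 0)
    (m : Fin (n - 1) → ℕ+) (c : Modulus n) : |(orbitPoint m c w).val.det| = 1 := by
  have hc : (cStar c).val.det = 1 := by
    have h1 : (cStar c).val = Matrix.diagonal fun i => ((cs c i : ℝˣ) : ℝ) := rfl
    have h2 : ∏ i, cs c i = 1 := by
      rw [← cExt_self c, ← prod_cExt c n, ← Fin.prod_univ_eq_prod_range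
        (fun i => cExt c (n - i) / cExt c (n - i - 1)) n]
      rfl
    rw [h1, Matrix.det_diagonal, ← Units.coe_prod, h2, Units.val_one]
  have hm : (mTilde m).val.det * ((mTilde m)⁻¹ : G n).val.det = 1 := by
    rw [← Matrix.det_mul, ← Units.val_mul, mul_inv_cancel, Units.val_one, Matrix.det_one]
  rw [orbitPoint, Units.val_mul, Units.val_mul, Units.val_mul, Matrix.det_mul, Matrix.det_mul,
    Matrix.det_mul, hc, mul_one, mul_right_comm, hm, one_mul, abs_det_of_represents hs]

end Weyl

/-! ### The neighbourhoods `K(X, τ)^♯` -/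

/-- The entry bounds that define `K(X, τ)^♯`. -/
def NearOne {n : ℕ} (X τ : ℝ) (h : G n) : Prop :=
  ∀ i j, |h.val i j - (1 : Matrix (Fin n) (Fin n) ℝ) i j| ≤ τ * X ^ ((j.val : ℤ) - i.val - 1)

theorem exists_conj_of_mem_KSharp {n : ℕ} {X τ : ℝ} (hX : 0 < X) {h : G n}
    (hh : h ∈ KSharp n X τ) : ∃ k ∈ K n X τ, ∃ d : Fin n → ℝˣ,
      (∀ i, (d i : ℝ) = (X ^ ((i.val : ℤ) + 1 - n))⁻¹) ∧ h = diagG d * k * (diagG d)⁻¹ := by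
  obtain ⟨k, hk, he⟩ := hh
  have hne : ∀ i : Fin n, X ^ ((i.val : ℤ) + 1 - n) ≠ 0 := fun i => (zpow_pos hX _).ne'
  refine ⟨k, hk, fun i => Units.mk0 _ (inv_ne_zero (hne i)), fun i => rfl, ?_⟩
  have h1 : ((diagG fun i => Units.mk0 _ (inv_ne_zero (hne i)) : G n)⁻¹).val = aX n X := by
    change Matrix.diagonal _ = Matrix.diagonal _
    congr 1
    funext i
    simp
  apply Units.ext
  rw [he, Units.val_mul, Units.val_mul, h1, ← h1, ← Matrix.coe_units_inv, inv_inv, h1]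

theorem conj_apply_eq {n : ℕ} {X : ℝ} (hX : 0 < X) {d : Fin n → ℝˣ}
    (hd : ∀ i, (d i : ℝ) = (X ^ ((i.val : ℤ) + 1 - n))⁻¹) (k : G n) (i j : Fin n) :
    (diagG d * k * (diagG d)⁻¹).val i j = X ^ ((j.val : ℤ) - i.val) * k.val i j := by
  rw [mul_diagG_inv_apply, diagG_mul_apply, hd, hd, div_inv_eq_mul, mul_right_comm]
  congr 1
  rw [← _root_.zpow_neg, ← zpow_add₀ hX.ne']
  congr 1; ring

theorem nearOne_conj {n : ℕ} {X δ : ℝ} (hX : 0 < X) {d : Fin n → ℝˣ}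
    (hd : ∀ i, (d i : ℝ) = (X ^ ((i.val : ℤ) + 1 - n))⁻¹) {k : G n}
    (hk : ∀ i j, |k.val i j - (1 : Matrix (Fin n) (Fin n) ℝ) i j| ≤ δ / X) :
    NearOne X δ (diagG d * k * (diagG d)⁻¹) := by
  intro i j
  rw [conj_apply_eq hX hd]
  have h1 : (1 : Matrix (Fin n) (Fin n) ℝ) i j =
      X ^ ((j.val : ℤ) - i.val) * (1 : Matrix (Fin n) (Fin n) ℝ) i j := by
    by_cases h : i = j
    · subst h; simp
    · simp [h]
  rw [h1, ← mul_sub, abs_mul, abs_of_pos (zpow_pos hX _)]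
  calc _ ≤ X ^ ((j.val : ℤ) - i.val) * (δ / X) := by
        gcongr
        exact hk i j
    _ = _ := by
        rw [zpow_sub_one₀ hX.ne']
        ring

theorem NearOne.of_mem_KSharp {n : ℕ} {X τ : ℝ} (hX : 0 < X) {h : G n}
    (hh : h ∈ KSharp n X τ) : NearOne X τ h := by
  obtain ⟨k, hk, d, hd, rfl⟩ := exists_conj_of_mem_KSharp hX hh
  exact nearOne_conj hX hd fun i j => (hk i j).le

theorem NearOne.inv_of_mem_KSharp {n : ℕ} {X τ : ℝ} (hX : 0 < X) {h : G n}
    (hh : h ∈ KSharp n X τ) (hn : (n : ℝ) * (τ / X) ≤ 1 / 2) : NearOne X (2 * τ) h⁻¹ := by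
  obtain ⟨k, hk, d, hd, rfl⟩ := exists_conj_of_mem_KSharp hX hh
  have : (diagG d * k * (diagG d)⁻¹)⁻¹ = diagG d * k⁻¹ * (diagG d)⁻¹ := by group
  rw [this]
  refine nearOne_conj hX hd fun i j => ?_
  rw [mul_div_assoc]
  exact abs_inv_sub_one_le hn k (fun i j => (hk i j).le) i j

theorem NearOne.diag {n : ℕ} {X τ : ℝ} {h : G n} (hh : NearOne X τ h) (i : Fin n) :
    |h.val i i - 1| ≤ τ / X := by
  have := hh i i
  rw [Matrix.one_apply_eq] at this
  simpa [div_eq_mul_inv] using this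

theorem NearOne.offDiag {n : ℕ} {X τ : ℝ} {h : G n} (hh : NearOne X τ h) {i j : Fin n}
    (hij : i ≠ j) : |h.val i j| ≤ τ * X ^ ((j.val : ℤ) - i.val - 1) := by
  have := hh i j
  rwa [Matrix.one_apply_ne hij, sub_zero] at this

theorem det_central_mul {n : ℕ} (z : ℝˣ) (h : G n) :
    (central n z * h).val.det = (z : ℝ) ^ n * h.val.det := by
  have : (central n z).val = Matrix.diagonal fun _ => (z : ℝ) := rfl
  rw [Units.val_mul, Matrix.det_mul, this, Matrix.det_diagonal]
  simp

/-- The scalar in a decomposition of an element of determinant `±1` is close to `±1`. -/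
theorem exists_abs_scalar_sub_one_le (n : ℕ) (hn : 1 ≤ n) : ∃ C d : ℝ, 0 < C ∧ 0 < d ∧
    ∀ X τ : ℝ, 1 ≤ X → 0 < τ → τ ≤ d → ∀ (z : ℝˣ) (h : G n), h ∈ KSharp n X τ →
      |(central n z * h).val.det| = 1 → |(|(z : ℝ)| - 1)| ≤ C * (τ / X) := by
  obtain ⟨C, d, hC, hd, H⟩ := exists_abs_det_sub_one_le n
  refine ⟨2 * C, min d (1 / (2 * C)), by positivity, by positivity, ?_⟩
  intro X τ hX hτ hτd z h hh hdet
  have hX0 : 0 < X := by linarith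
  have hτX : τ / X ≤ τ := div_le_self hτ.le hX
  obtain ⟨k, hk, e, he, rfl⟩ := exists_conj_of_mem_KSharp hX0 hh
  have hdk : (diagG e * k * (diagG e)⁻¹).val.det = k.val.det := by
    have h1 : (diagG e).val.det * ((diagG e)⁻¹ : G n).val.det = 1 := by
      rw [← Matrix.det_mul, ← Units.val_mul, mul_inv_cancel, Units.val_one, Matrix.det_one]
    rw [Units.val_mul, Units.val_mul, Matrix.det_mul, Matrix.det_mul, mul_right_comm, h1, one_mul]
  have h1 := H (τ / X) (by positivity) (hτX.trans (hτd.trans (min_le_left _ _))) k.val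
    fun i j => (hk i j).le
  have h2 : C * (τ / X) ≤ 1 / 2 := by
    have : τ / X ≤ 1 / (2 * C) := hτX.trans (hτd.trans (min_le_right _ _))
    calc C * (τ / X) ≤ C * (1 / (2 * C)) := by gcongr
      _ = 1 / 2 := by field_simp
  -- Conjugation by a diagonal matrix does not change the determinant, so the condition becomes
  -- `|z|^n |det k| = 1` with `det k` close to `1`.
  rw [det_central_mul, hdk, abs_mul, abs_pow] at hdet
  set D := |k.val.det|
  have h3 : |D - 1| ≤ C * (τ / X) := by
    have := abs_abs_sub_abs_le_abs_sub k.val.det 1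
    rw [abs_one] at this
    exact this.trans h1
  have h4 : |(|(z : ℝ)| ^ n - 1)| ≤ 2 * C * (τ / X) := by
    have h5 := abs_le.mp h3
    have hD : 1 / 2 ≤ D := by linarith
    have h6 : |(|(z : ℝ)| ^ n - 1)| * D ≤ C * (τ / X) := by
      have h7 : (|(z : ℝ)| ^ n - 1) * D = 1 - D := by rw [sub_mul, hdet, one_mul]
      have h8 := congrArg abs h7
      rw [abs_mul, abs_of_pos (show 0 < D by linarith)] at h8
      rw [h8, abs_sub_comm]
      exact h3
    nlinarith [abs_nonneg (|(z : ℝ)| ^ n - 1)]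
  -- For `Z ≥ 0` and `n ≥ 1` the number `Z` is at least as close to `1` as `Z^n` is.
  refine le_trans ?_ h4
  have hz := abs_nonneg (z : ℝ)
  generalize |(z : ℝ)| = Z at hz ⊢
  clear * - hz hn
  obtain ⟨p, rfl⟩ : ∃ p, n = p + 1 := ⟨n - 1, by omega⟩
  rcases le_total 1 Z with h | h
  · have := one_le_pow₀ (n := p) h
    have h7 : Z ≤ Z ^ (p + 1) := by rw [pow_succ]; nlinarith
    rw [abs_of_nonneg (by linarith), abs_of_nonneg (by linarith)]
    linarith
  · have := pow_le_one₀ (n := p) hz h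
    have h7 : Z ^ (p + 1) ≤ Z := by rw [pow_succ]; nlinarith
    rw [abs_of_nonpos (by linarith), abs_of_nonpos (by linarith)]
    linarith

/-! ### Bottom left minors -/

section Minors

variable {n : ℕ}

/-- The last `d` indices. -/
def lastIdx {d : ℕ} (hd : d ≤ n) (i : Fin d) : Fin n := ⟨n - d + i.val, by omega⟩

/-- The last `d` rows of `x g y` involve only the last `d` rows of `g`, its first `d` columns only
the first `d` columns of `g`, and the corresponding blocks of `x` and `y` are unitriangular. -/
theorem det_lastIdx_castLE {d : ℕ} (hd : d ≤ n) {x y : G n} (hx : x ∈ N n) (hy : y ∈ N n)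
    (g : G n) : ((x * (g * y)).val.submatrix (lastIdx hd) (Fin.castLE hd)).det =
      (g.val.submatrix (lastIdx hd) (Fin.castLE hd)).det := by
  have h1 : (x * (g * y)).val.submatrix (lastIdx hd) (Fin.castLE hd) =
      x.val.submatrix (lastIdx hd) (lastIdx hd) *
        ((g.val.submatrix (lastIdx hd) (Fin.castLE hd)) *
          y.val.submatrix (Fin.castLE hd) (Fin.castLE hd)) := by
    ext i j
    rw [Matrix.submatrix_apply, Units.val_mul, Units.val_mul, Matrix.mul_apply, Matrix.mul_apply]
    have hinj : Function.Injective (lastIdx hd) := fun a b h => by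
      have := congrArg Fin.val h
      simp only [lastIdx] at this
      exact Fin.ext (by omega)
    rw [← Finset.sum_subset (Finset.subset_univ (Finset.univ.image (lastIdx hd))),
      Finset.sum_image (fun a _ b _ h => hinj h)]
    · refine Finset.sum_congr rfl fun k _ => ?_
      rw [Matrix.submatrix_apply]
      congr 1
      rw [Matrix.mul_apply, Matrix.mul_apply]
      rw [← Finset.sum_subset (Finset.subset_univ (Finset.univ.image (Fin.castLE hd))),
        Finset.sum_image (fun a _ b _ h => Fin.castLE_injective hd h)]
      · rfl
      · intro l _ hl
        rw [hy.2, mul_zero]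
        by_contra hcon
        apply hl
        rw [Finset.mem_image]
        have h3 : l.val ≤ (Fin.castLE hd j).val := not_lt.mp hcon
        rw [Fin.val_castLE] at h3
        exact ⟨⟨l.val, by omega⟩, Finset.mem_univ _, Fin.ext rfl⟩
    · intro l _ hl
      rw [hx.2, zero_mul]
      by_contra hcon
      apply hl
      rw [Finset.mem_image]
      have h3 : (lastIdx hd i).val ≤ l.val := not_lt.mp hcon
      simp only [lastIdx] at h3
      exact ⟨⟨l.val - (n - d), by omega⟩, Finset.mem_univ _, Fin.ext (by simp [lastIdx]; omega)⟩
  rw [h1, Matrix.det_mul, Matrix.det_mul]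
  have hx' : (x.val.submatrix (lastIdx hd) (lastIdx hd)).det = 1 := by
    rw [Matrix.det_of_isUpperTriangular]
    · simp [hx.1]
    · intro i j hij
      refine hx.2 _ _ (Fin.lt_def.mpr ?_)
      have : j.val < i.val := hij
      simp only [lastIdx]; omega
  have hy' : (y.val.submatrix (Fin.castLE hd) (Fin.castLE hd)).det = 1 := by
    rw [Matrix.det_of_isUpperTriangular]
    · simp [hy.1]
    · intro i j hij
      exact hy.2 _ _ (Fin.lt_def.mpr (show j.val < i.val from hij))
  rw [hx', hy', one_mul, mul_one]

/-- The lower bound for the bottom left minors of `m̃ c* w m̃⁻¹`. -/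
theorem inv_le_abs_det_orbitPoint {σ : Equiv.Perm (Fin n)} {w : G n} {s : Fin n → ℤˣ}
    (hs : ∀ i j, w.val i j = if i = σ j then ((s j : ℤ) : ℝ) else 0) (m : ℕ+) (c : Modulus n)
    {d : ℕ} (hd : d < n) (hd1 : 1 ≤ d) (hσ : ∀ a : Fin n, a.val < d → n ≤ (σ a).val + d) :
    ((m : ℕ) : ℝ)⁻¹ ≤
      |((orbitPoint (mVec n m) c w).val.submatrix (lastIdx hd.le) (Fin.castLE hd.le)).det| := by
  set μ := mEntry (mVec n m) with hμ
  have hn2 : 2 ≤ n := by omega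
  have hm0 : (0 : ℝ) < ((m : ℕ) : ℝ) := by exact_mod_cast m.pos
  set W : Matrix (Fin d) (Fin d) ℝ := w.val.submatrix (lastIdx hd.le) (Fin.castLE hd.le) with hW
  -- By `hσ` the nonzero entries of the first `d` columns of `w` lie in the last `d` rows, so `W` is
  -- a signed permutation matrix.
  have hWdet : |W.det| = 1 := by
    have h : Wᵀ * W = 1 := by
      ext i j
      rw [Matrix.mul_apply]
      have hkey : ∀ b : Fin d, ∃ k : Fin d, lastIdx hd.le k = σ (Fin.castLE hd.le b) := by
        intro b
        have := hσ (Fin.castLE hd.le b) b.2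
        have h2 := (σ (Fin.castLE hd.le b)).2
        exact ⟨⟨(σ (Fin.castLE hd.le b)).val - (n - d), by omega⟩, Fin.ext (by
          simp [lastIdx]; omega)⟩
      obtain ⟨k, hk⟩ := hkey i
      have hinj : ∀ a : Fin d, lastIdx hd.le a = lastIdx hd.le k ↔ a = k := by
        intro a
        refine ⟨fun h => ?_, fun h => by rw [h]⟩
        have := congrArg Fin.val h
        simp only [lastIdx] at this
        exact Fin.ext (by omega)
      rw [Finset.sum_eq_single k]
      · simp only [Matrix.transpose_apply, hW, Matrix.submatrix_apply, hs, hk, if_true]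
        by_cases hij : i = j
        · subst hij; simp [unit_mul_self]
        · have : σ (Fin.castLE hd.le i) ≠ σ (Fin.castLE hd.le j) := fun h =>
            hij (Fin.castLE_injective hd.le (σ.injective h))
          simp [this, hij]
      · intro a _ ha
        simp only [Matrix.transpose_apply, hW, Matrix.submatrix_apply, hs]
        rw [if_neg, zero_mul]
        rw [← hk, hinj]; exact ha
      · simp
    have := congrArg Matrix.det h
    rw [Matrix.det_mul, Matrix.det_transpose, Matrix.det_one] at this
    rcases mul_self_eq_one_iff.mp this with h | h <;> simp [h]
  have hfac : (orbitPoint (mVec n m) c w).val.submatrix (lastIdx hd.le) (Fin.castLE hd.le) =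
      Matrix.of fun i j => ((μ (lastIdx hd.le i) : ℝ) * cs c (lastIdx hd.le i)) *
        (Matrix.of fun i j => ((μ (Fin.castLE hd.le j) : ℝ))⁻¹ * W i j) i j := by
    ext i j
    simp only [Matrix.submatrix_apply, Matrix.of_apply, orbitPoint_apply hs, hW, hs, ← hμ]
    split_ifs
    · rw [div_eq_mul_inv]; ring
    · simp
  rw [hfac, Matrix.det_mul_column, Matrix.det_mul_row, abs_mul, abs_mul, hWdet, mul_one,
    Finset.prod_mul_distrib, abs_mul]
  have h1 : ∏ i : Fin d, (cs c (lastIdx hd.le i) : ℝ) = cExt c d := by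
    rw [← prod_cExt c d, ← Fin.prod_univ_eq_prod_range (fun i => cExt c (d - i) / cExt c (d - i - 1)),
      Units.coe_prod]
    refine Finset.prod_congr rfl fun i _ => ?_
    rw [cs]
    have : n - (lastIdx hd.le i).val = d - i.val := by
      have := i.2
      simp only [lastIdx]; omega
    rw [this]
  have h2 : ∏ i : Fin d, (μ (Fin.castLE hd.le i) : ℝ)⁻¹ = (((m : ℕ) : ℝ) ^ d)⁻¹ := by
    rw [Finset.prod_congr rfl fun i _ => show (μ (Fin.castLE hd.le i) : ℝ)⁻¹ = ((m : ℕ) : ℝ)⁻¹ by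
      rw [hμ, mEntry_mVec hn2, if_pos]
      rw [Fin.val_castLE]; have := i.2; omega]
    simp
  -- The last row carries the entry `1` of `m̃`, while the first `d < n` columns all carry `m`. The
  -- quotient of the two products is thus `1/m`, for every `d`.
  have h3 : ∏ i : Fin d, (μ (lastIdx hd.le i) : ℝ) = ((m : ℕ) : ℝ) ^ (d - 1) := by
    obtain ⟨e, rfl⟩ : ∃ e, d = e + 1 := ⟨d - 1, by omega⟩
    rw [Fin.prod_univ_castSucc]
    rw [Finset.prod_congr rfl fun i _ => show (μ (lastIdx hd.le i.castSucc) : ℝ) = ((m : ℕ) : ℝ) by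
      rw [hμ, mEntry_mVec hn2, if_pos]
      simp only [lastIdx, Fin.val_castSucc]; have := i.2; omega]
    rw [hμ, mEntry_mVec hn2, if_neg]
    · simp
    · simp only [lastIdx, Fin.val_last]; omega
  rw [h1, h2, h3, abs_of_pos (pow_pos hm0 _), abs_of_pos (inv_pos.mpr (pow_pos hm0 _))]
  have h4 := one_le_abs_cExt c d
  calc ((m : ℕ) : ℝ)⁻¹ = ((m : ℕ) : ℝ) ^ (d - 1) * 1 * (((m : ℕ) : ℝ) ^ d)⁻¹ := by
        obtain ⟨e, rfl⟩ : ∃ e, d = e + 1 := ⟨d - 1, by omega⟩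
        rw [Nat.add_sub_cancel, pow_succ]
        field_simp
    _ ≤ _ := by gcongr

/-- The upper bound for the bottom left minors on `K(X, τ)^♯`. -/
theorem abs_det_KSharp_le {X τ : ℝ} (hX : 1 ≤ X) (hτ : 0 < τ) (hτ1 : τ ≤ 1) {h : G n}
    (hh : h ∈ KSharp n X τ) {d : ℕ} (hd : d + 2 ≤ n) (hd2 : 2 ≤ d) :
    |(h.val.submatrix (lastIdx (show d ≤ n by omega)) (Fin.castLE (show d ≤ n by omega))).det| ≤
      (n.factorial * 2 ^ n) * τ ^ 2 * (X ^ (n + 2))⁻¹ := by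
  have hX0 : 0 < X := by linarith
  have hdn : d ≤ n := by omega
  obtain ⟨k, hk, e, he, rfl⟩ := exists_conj_of_mem_KSharp hX0 hh
  -- Since `n - d ≥ 2`, the first two columns of the block contain no diagonal entry of `k`, so each
  -- of them contributes a factor `τ/X`.
  let v : Fin d → ℝ := fun j => if j.val < 2 then τ / X else 1
  have hv0 : ∀ j, 0 < v j := fun j => by simp only [v]; split_ifs <;> positivity
  set A : Matrix (Fin d) (Fin d) ℝ := Matrix.of fun i j =>
    (v j)⁻¹ * k.val (lastIdx hdn i) (Fin.castLE hdn j) with hA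
  have hAb : ∀ i j, |A i j| ≤ 2 := by
    intro i j
    simp only [hA, Matrix.of_apply, v]
    have h1 := (hk (lastIdx hdn i) (Fin.castLE hdn j)).le
    have hle : τ / X ≤ 1 := (div_le_self hτ.le hX).trans hτ1
    have hpos : 0 < τ / X := by positivity
    split_ifs with hj
    · rw [Matrix.one_apply_ne, sub_zero] at h1
      · rw [abs_mul, abs_of_pos (inv_pos.mpr hpos)]
        calc (τ / X)⁻¹ * _ ≤ (τ / X)⁻¹ * (τ / X) := by gcongr
          _ = 1 := inv_mul_cancel₀ hpos.ne'
          _ ≤ 2 := by norm_num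
      · intro h
        have := congrArg Fin.val h
        simp only [lastIdx, Fin.val_castLE] at this
        omega
    · rw [inv_one, one_mul]
      have h2 : |(1 : Matrix (Fin n) (Fin n) ℝ) (lastIdx hdn i) (Fin.castLE hdn j)| ≤ 1 := by
        rw [Matrix.one_apply]; split_ifs <;> simp
      have h3 := abs_add_le (k.val (lastIdx hdn i) (Fin.castLE hdn j) -
        (1 : Matrix (Fin n) (Fin n) ℝ) (lastIdx hdn i) (Fin.castLE hdn j))
        ((1 : Matrix (Fin n) (Fin n) ℝ) (lastIdx hdn i) (Fin.castLE hdn j))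
      rw [sub_add_cancel] at h3
      linarith
  have hdetA : |A.det| ≤ n.factorial * 2 ^ n := by
    have h1 := Matrix.det_le (abv := (AbsoluteValue.abs : AbsoluteValue ℝ ℝ)) hAb
    rw [Fintype.card_fin, nsmul_eq_mul] at h1
    refine (show |A.det| ≤ _ from h1).trans ?_
    have : (d.factorial : ℝ) ≤ n.factorial := by exact_mod_cast Nat.factorial_le hdn
    have h2 : (2 : ℝ) ^ d ≤ 2 ^ n := pow_le_pow_right₀ (by norm_num) hdn
    gcongr
  have hfac : (diagG e * k * (diagG e)⁻¹).val.submatrix (lastIdx hdn) (Fin.castLE hdn) =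
      Matrix.of fun i j => X ^ (-((n : ℤ) - d + i.val)) *
        (Matrix.of fun i j : Fin d => (X ^ (j.val : ℤ) * v j) * A i j) i j := by
    ext i j
    simp only [Matrix.submatrix_apply, Matrix.of_apply, conj_apply_eq hX0 he, hA]
    have h1 : ((Fin.castLE hdn j).val : ℤ) - (lastIdx hdn i).val =
        -((n : ℤ) - d + i.val) + j.val := by
      simp only [lastIdx, Fin.val_castLE]
      push_cast [Nat.cast_sub hdn]
      ring
    rw [h1, zpow_add₀ hX0.ne']
    have := (hv0 j).ne'
    field_simp
  rw [hfac, Matrix.det_mul_column, Matrix.det_mul_row, Finset.prod_mul_distrib, ← mul_assoc,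
    ← mul_assoc, ← Finset.prod_mul_distrib, abs_mul, abs_mul]
  have hvprod : ∏ j, v j = (τ / X) ^ 2 := by
    obtain ⟨f, rfl⟩ : ∃ f, d = f + 2 := ⟨d - 2, by omega⟩
    rw [Fin.prod_univ_succ, Fin.prod_univ_succ]
    simp [v, sq]
  have hXprod : ∏ i : Fin d, X ^ (-((n : ℤ) - d + i.val)) * X ^ (i.val : ℤ) =
      X ^ (-(((n : ℤ) - d) * d)) := by
    have : ∀ i : Fin d, X ^ (-((n : ℤ) - d + i.val)) * X ^ (i.val : ℤ) = X ^ (-((n : ℤ) - d)) := by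
      intro i
      rw [← zpow_add₀ hX0.ne']; congr 1; ring
    rw [Finset.prod_congr rfl fun i _ => this i]
    simp only [Finset.prod_const, Finset.card_univ, Fintype.card_fin]
    rw [← zpow_natCast, ← _root_.zpow_mul]; congr 1; ring
  rw [hXprod, hvprod, abs_of_pos (zpow_pos hX0 _), abs_of_nonneg (sq_nonneg _)]
  -- From `(d-2)(n-d-2) ≥ 0` follows `d(n-d) ≥ 2n-4 ≥ n`.
  have hexp : X ^ (-(((n : ℤ) - d) * d)) ≤ X ^ (-(n : ℤ)) := by
    apply zpow_le_zpow_right₀ hX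
    have h1 : (0 : ℤ) ≤ (n : ℤ) - d - 2 := by omega
    have h2 : (0 : ℤ) ≤ (d : ℤ) - 2 := by omega
    nlinarith [mul_nonneg h1 h2]
  calc _ ≤ X ^ (-(n : ℤ)) * (τ / X) ^ 2 * (n.factorial * 2 ^ n) := by gcongr
    _ = _ := by
      rw [_root_.zpow_neg, zpow_natCast, pow_add]
      field_simp

end Minors

/-! ### Bruhat cells that meet the support -/

section Support

variable {n : ℕ} {σ : Equiv.Perm (Fin n)}

theorem mul_monomial_mul_apply {g : G n} {γ : Fin n → ℝ}
    (hg : ∀ i j, g.val i j = if i = σ j then γ j else 0) (x y : G n) (i j : Fin n) :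
    (x * (g * y)).val i j = ∑ k, x.val i (σ k) * (γ k * y.val k j) := by
  rw [Units.val_mul, Units.val_mul, Matrix.mul_apply, ← Equiv.sum_comp σ]
  refine Finset.sum_congr rfl fun k _ => ?_
  congr 1
  rw [Matrix.mul_apply, Finset.sum_eq_single k]
  · rw [hg, if_pos rfl]
  · intro l _ hl
    rw [hg, if_neg (fun h => hl (σ.injective h).symm), zero_mul]
  · simp

/-- The matrix `z h` has small entries away from the diagonal. -/
theorem NearOne.scaled_offDiag {X τ : ℝ} {h : G n} (hh : NearOne X τ h)
    {z : ℝˣ} (hz : |(z : ℝ)| ≤ 2) {i j : Fin n} (hij : i ≠ j) :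
    |(central n z * h).val i j| ≤ 2 * τ * X ^ ((j.val : ℤ) - i.val - 1) := by
  rw [central_mul_apply, abs_mul, mul_assoc]
  exact mul_le_mul hz (hh.offDiag hij) (abs_nonneg _) (by norm_num)

/-- If the first column and the last row of `z h` are those of `p α⁻¹ q`, with
`α e_i = p_i q_i` and `α f = p_2 q_1`, then `e_1 e_2` is small. -/
theorem abs_mul_le_of_rank_one {α e₁ e₂ f p₁ p₂ q₁ q₂ P F Q : ℝ} (hα : α ≠ 0)
    (h₁ : α * e₁ = p₁ * q₁) (h₂ : α * e₂ = p₂ * q₂) (hf : α * f = p₂ * q₁)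
    (hp : |p₁| ≤ P) (hF : |f| ≤ F) (hq : |q₂| ≤ Q) : |α| * |e₁ * e₂| ≤ F * P * Q := by
  have h : α * (e₁ * e₂) = f * p₁ * q₂ := by
    apply mul_left_cancel₀ hα
    calc α * (α * (e₁ * e₂)) = (α * e₁) * (α * e₂) := by ring
      _ = (α * f) * p₁ * q₂ := by rw [h₁, h₂, hf]; ring
      _ = _ := by ring
  rw [← abs_mul, h, abs_mul, abs_mul]
  have hF0 := (abs_nonneg _).trans hF
  have hP0 := (abs_nonneg _).trans hp
  gcongr

/-- On and below the diagonal the product is `x_{i,L} γ_0 y_{0,j}`, with `L` the last index.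
Multiplied by the bottom left entry `γ_0`, each such entry is the product of its first-column and
last-row neighbours. For two middle diagonal entries this writes `γ_0 e_1 e_2` as a product of three
entries below the diagonal, whose sizes multiply to `O(τ³ X^(-n-2))`. This is incompatible with the
lower bound for `γ_0` and with diagonal entries of size at least `1/4`. -/
theorem rotation_disjoint (hn : 3 < n) {X τ : ℝ} (hX : 1 ≤ X) (hτ : 0 < τ) (hτ1 : τ ≤ 1 / 10)
    (hσ : ∀ i : Fin n, (σ i).val = if i.val = 0 then n - 1 else i.val - 1)
    {g : G n} {γ : Fin n → ℝ} (hg : ∀ i j, g.val i j = if i = σ j then γ j else 0)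
    (hγ : (X ^ (n + 2))⁻¹ ≤ |γ ⟨0, by omega⟩|) {x y h : G n} (hx : x ∈ N n) (hy : y ∈ N n)
    {z : ℝˣ} (hz : |(z : ℝ)| ≤ 2) (hz' : 1 / 2 ≤ |(z : ℝ)|) (hh : NearOne X τ h)
    (heq : x * (g * y) = central n z * h) : False := by
  have hX0 : 0 < X := by linarith
  obtain ⟨a0, ha0⟩ : ∃ a : Fin n, a.val = 0 := ⟨⟨0, by omega⟩, rfl⟩
  obtain ⟨a1, ha1⟩ : ∃ a : Fin n, a.val = 1 := ⟨⟨1, by omega⟩, rfl⟩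
  obtain ⟨a2, ha2⟩ : ∃ a : Fin n, a.val = 2 := ⟨⟨2, by omega⟩, rfl⟩
  obtain ⟨aL, haL⟩ : ∃ a : Fin n, a.val = n - 1 := ⟨⟨n - 1, by omega⟩, rfl⟩
  rw [show (⟨0, by omega⟩ : Fin n) = a0 from Fin.ext ha0.symm] at hγ
  have hσ0 : σ a0 = aL := Fin.ext (by rw [hσ, if_pos ha0, haL])
  have hE : ∀ i j : Fin n, j ≤ i →
      (central n z * h).val i j = x.val i aL * (γ a0 * y.val a0 j) := by
    intro i j hji
    rw [← heq, mul_monomial_mul_apply hg, Finset.sum_eq_single a0, hσ0]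
    -- For `k ≠ 0` the rotation sends `k` to `k - 1`. A nonzero summand would need `i ≤ k - 1` and
    -- `k ≤ j`, which is impossible for `j ≤ i`.
    · intro k _ hk
      have hk0 : k.val ≠ 0 := fun e => hk (Fin.ext (by omega))
      have hσk := hσ k
      rw [if_neg hk0] at hσk
      by_cases h1 : σ k < i
      · rw [hx.2 _ _ h1, zero_mul]
      · have h2 : j < k := by
          have h3 : i.val ≤ (σ k).val := not_lt.mp h1
          have h4 : j.val ≤ i.val := hji
          exact Fin.lt_def.mpr (by omega)
        rw [hy.2 _ _ h2, mul_zero, mul_zero]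
    · simp
  have hα : (central n z * h).val aL a0 = γ a0 := by
    rw [hE _ _ (Fin.le_def.mpr (by omega)), hx.1, hy.1]; ring
  have hp : ∀ i, (central n z * h).val i a0 = x.val i aL * γ a0 := by
    intro i
    rw [hE _ _ (Fin.le_def.mpr (by omega)), hy.1]; ring
  have hq : ∀ j, (central n z * h).val aL j = γ a0 * y.val a0 j := by
    intro j
    rw [hE _ _ (Fin.le_def.mpr (by have := j.2; omega)), hx.1]; ring
  have hγ0 : γ a0 ≠ 0 := by
    have : 0 < (X ^ (n + 2))⁻¹ := by positivity
    exact abs_pos.mp (this.trans_le hγ)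
  have hne : ∀ {a b : Fin n}, a.val ≠ b.val → a ≠ b := fun h e => h (congrArg Fin.val e)
  have key := abs_mul_le_of_rank_one hγ0
    (e₁ := (central n z * h).val a1 a1) (e₂ := (central n z * h).val a2 a2)
    (f := (central n z * h).val a2 a1) (p₁ := (central n z * h).val a1 a0)
    (p₂ := (central n z * h).val a2 a0) (q₁ := (central n z * h).val aL a1)
    (q₂ := (central n z * h).val aL a2)
    (by rw [hp, hq, hE _ _ le_rfl]; ring) (by rw [hp, hq, hE _ _ le_rfl]; ring)
    (by rw [hp, hq, hE _ _ (Fin.le_def.mpr (by omega))]; ring)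
    (hh.scaled_offDiag hz (hne (by omega))) (hh.scaled_offDiag hz (hne (by omega)))
    (hh.scaled_offDiag hz (hne (by omega)))
  have hexp : X ^ ((a1.val : ℤ) - a2.val - 1) * X ^ ((a0.val : ℤ) - a1.val - 1) *
      X ^ ((a2.val : ℤ) - aL.val - 1) = (X ^ (n + 2))⁻¹ := by
    rw [← zpow_add₀ hX0.ne', ← zpow_add₀ hX0.ne', ← zpow_natCast, ← _root_.zpow_neg]
    congr 1
    rw [ha0, ha1, ha2, haL]
    push_cast [Nat.cast_sub (show 1 ≤ n by omega)]
    ring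
  have hdiag : ∀ i, 1 / 4 ≤ |(central n z * h).val i i| := by
    intro i
    rw [central_mul_apply, abs_mul]
    have h1 := hh.diag i
    have h2 : τ / X ≤ τ := div_le_self hτ.le hX
    have h3 : 1 / 2 ≤ |h.val i i| := by
      have := abs_le.mp h1
      rw [abs_of_nonneg] <;> linarith
    nlinarith
  have h1 : (1 / 16 : ℝ) ≤ |(central n z * h).val a1 a1 * (central n z * h).val a2 a2| := by
    rw [abs_mul]
    nlinarith [hdiag a1, hdiag a2]
  have h2 : (X ^ (n + 2))⁻¹ * (1 / 16) ≤ 8 * τ ^ 3 * (X ^ (n + 2))⁻¹ := by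
    calc _ ≤ _ := mul_le_mul hγ h1 (by norm_num) (abs_nonneg _)
      _ ≤ _ := key
      _ = 8 * τ ^ 3 * (X ^ ((a1.val : ℤ) - a2.val - 1) * X ^ ((a0.val : ℤ) - a1.val - 1) *
      X ^ ((a2.val : ℤ) - aL.val - 1)) := by ring
      _ = _ := by rw [hexp]
  have h3 : 0 < (X ^ (n + 2))⁻¹ := by positivity
  have h4 : (1 / 16 : ℝ) ≤ 8 * τ ^ 3 := by nlinarith
  have h5 : τ ^ 3 ≤ (1 / 10) ^ 3 := pow_le_pow_left₀ hτ.le hτ1 3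
  norm_num at h5
  linarith

theorem cs_zero (hn : 0 < n) (c : Modulus n) : (cs c ⟨0, hn⟩ : ℝ) = ((cExt c (n - 1) : ℝˣ) : ℝ)⁻¹ := by
  rw [cs]
  simp [cExt_self]

theorem cs_last (hn : 0 < n) (c : Modulus n) :
    (cs c ⟨n - 1, by omega⟩ : ℝ) = cExt c 1 := by
  rw [cs]
  simp only
  rw [show n - (n - 1) = 1 by omega]
  simp [cExt_zero]

/-- Only the cells of `1` and of `w_*` meet the support of the test function. -/
theorem exists_eq_one_or_star_of_support (n : ℕ) (hn : 3 < n) : ∃ τ₀ : ℝ, 0 < τ₀ ∧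
    ∀ X τ : ℝ, 1 ≤ X → 0 < τ → τ < τ₀ → ∀ m : ℕ+, ((m : ℕ) : ℝ) ≤ X ^ (n + 2) →
    ∀ (σ : Equiv.Perm (Fin n)) (w : G n), Represents σ w → ∀ c : Modulus n,
    Admissible (mVec n m) (mVec n m) w c → ∀ x ∈ N n, ∀ y ∈ N n, ∀ (z : ℝˣ), ∀ h ∈ KSharp n X τ,
      x * (orbitPoint (mVec n m) c w * y) = central n z * h →
      σ = 1 ∨ σ = starPerm n (by omega) := by
  obtain ⟨C, d, hC, hd, hscal⟩ := exists_abs_scalar_sub_one_le n (by omega)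
  set D : ℝ := 2 ^ n * (n.factorial * 2 ^ n) with hD
  have hD0 : 1 ≤ D := by
    have h1 : (1 : ℝ) ≤ 2 ^ n := one_le_pow₀ (by norm_num)
    have h2 : (1 : ℝ) ≤ n.factorial := by exact_mod_cast n.factorial_pos
    nlinarith [mul_le_mul h2 h1 zero_le_one (by linarith)]
  -- The bound `1/(2C)` keeps `|z|` between `1/2` and `2`, `1/(2n)` allows passing to `h⁻¹`, `1/20`
  -- lets the rotation argument run with `2τ ≤ 1/10` for the inverse, and `1/(2D)` rules out `1 ≤ D
  -- τ²`.
  refine ⟨min d (min (1 / (2 * C)) (min (1 / (2 * n)) (min (1 / 20) (1 / (2 * D))))), ?_, ?_⟩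
  · have : (0 : ℝ) < n := by exact_mod_cast (by omega : 0 < n)
    positivity
  intro X τ hX hτ hτ0 m hm σ w hw c hadm x hx y hy z h hh heq
  obtain ⟨s, hs⟩ := hw
  simp only [lt_min_iff] at hτ0
  obtain ⟨hτd, hτC, hτn, hτ20, hτD⟩ := hτ0
  have hX0 : 0 < X := by linarith
  have hn0 : (0 : ℝ) < n := by exact_mod_cast (by omega : 0 < n)
  have hm0 : (0 : ℝ) < ((m : ℕ) : ℝ) := by exact_mod_cast m.pos
  have hτX : τ / X ≤ τ := div_le_self hτ.le hX
  have hdet : |(central n z * h).val.det| = 1 := by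
    rw [← heq, Units.val_mul, Units.val_mul, Matrix.det_mul, Matrix.det_mul, det_of_mem_N hx,
      det_of_mem_N hy, one_mul, mul_one, abs_det_orbitPoint hs]
  have hzb := hscal X τ hX hτ hτd.le z h hh hdet
  have hzb' : |(|(z : ℝ)| - 1)| ≤ 1 / 2 := by
    refine hzb.trans ?_
    calc C * (τ / X) ≤ C * (1 / (2 * C)) := mul_le_mul_of_nonneg_left (by linarith) hC.le
      _ = 1 / 2 := by field_simp
  have hz1 : |(z : ℝ)| ≤ 2 := by have := (abs_le.mp hzb').2; linarith
  have hz2 : 1 / 2 ≤ |(z : ℝ)| := by have := (abs_le.mp hzb').1; linarith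
  have hnτ : (n : ℝ) * (τ / X) ≤ 1 / 2 := by
    calc (n : ℝ) * (τ / X) ≤ n * (1 / (2 * n)) := mul_le_mul_of_nonneg_left (by linarith) hn0.le
      _ = 1 / 2 := by field_simp
  have hua := hadm.unitAscents hs
  have hminv : (X ^ (n + 2))⁻¹ ≤ ((m : ℕ) : ℝ)⁻¹ := inv_anti₀ hm0 hm
  have hdesc : ∀ i j : Fin n, i.val + 1 = j.val → 1 ≤ i.val → i.val + 2 < n → σ i < σ j := by
    intro i j hij hi1 hi2
    by_contra hcon
    have hne : σ i ≠ σ j := fun e => by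
      have := congrArg Fin.val (σ.injective e); omega
    have hlt : σ j < σ i := lt_of_le_of_ne (not_lt.mp hcon) hne.symm
    -- A descent after `d = j` places, counted from `i + 1 = j`, gives a minor of size at least `1/m
    -- ≥ X^(-n-2)`; it is also a minor of `z h`, hence at most `D τ² X^(-n-2)`.
    have h1 := inv_le_abs_det_orbitPoint hs m c (d := j.val) j.2 (by omega) (fun a ha =>
      hua.le_of_descent hij hlt (Fin.le_def.mpr (by omega)))
    have h2 := abs_det_KSharp_le hX hτ (by linarith) hh (d := j.val) (by omega) (by omega)
    have h3 := det_lastIdx_castLE j.2.le hx hy (orbitPoint (mVec n m) c w)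
    rw [heq] at h3
    have h4 : (central n z * h).val.submatrix (lastIdx j.2.le) (Fin.castLE j.2.le) =
        (z : ℝ) • h.val.submatrix (lastIdx j.2.le) (Fin.castLE j.2.le) := by
      ext a b
      rw [Matrix.submatrix_apply, central_mul_apply]; rfl
    rw [← h3, h4, Matrix.det_smul, abs_mul, abs_pow, Fintype.card_fin] at h1
    have h5 : |(z : ℝ)| ^ j.val ≤ 2 ^ n :=
      (pow_le_pow_left₀ (abs_nonneg _) hz1 _).trans (pow_le_pow_right₀ (by norm_num) j.2.le)
    have h6 : (X ^ (n + 2))⁻¹ ≤ D * τ ^ 2 * (X ^ (n + 2))⁻¹ := by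
      calc _ ≤ _ := hminv
        _ ≤ _ := h1
        _ ≤ 2 ^ n * ((n.factorial * 2 ^ n) * τ ^ 2 * (X ^ (n + 2))⁻¹) := by gcongr
        _ = _ := by rw [hD]; ring
    have h7 : 0 < (X ^ (n + 2))⁻¹ := by positivity
    have h8 : 1 ≤ D * τ ^ 2 := by nlinarith
    have h9 : D * τ < 1 / 2 := by
      calc D * τ < D * (1 / (2 * D)) := by gcongr
        _ = 1 / 2 := by field_simp
    nlinarith
  set γ : Fin n → ℝ := fun j => (mEntry (mVec n m) (σ j) * cs c (σ j) * ((s j : ℤ) : ℝ) /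
    mEntry (mVec n m) j : ℝ) with hγ
  have hg : ∀ i j, (orbitPoint (mVec n m) c w).val i j = if i = σ j then γ j else 0 := by
    intro i j
    rw [orbitPoint_apply hs]
    split_ifs with hi
    · rw [hγ, hi]
    · rfl
  rcases hua.classify hn hdesc with h1 | h1 | h1 | h1
  · exact Or.inl h1
  · exact Or.inr h1
  · exfalso
    refine rotation_disjoint hn hX hτ (by linarith) h1 hg ?_ hx hy hz1 hz2
      (NearOne.of_mem_KSharp hX0 hh) heq
    have hσ0 : σ ⟨0, by omega⟩ = ⟨n - 1, by omega⟩ := Fin.ext (by rw [h1]; simp)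
    simp only [hγ]
    rw [hσ0, mEntry_mVec (by omega), mEntry_mVec (by omega), if_neg (by simp; omega),
      if_pos (by simp; omega), cs_last (by omega), one_mul, abs_div, abs_mul, abs_unit, mul_one,
      abs_of_pos hm0]
    refine hminv.trans ?_
    rw [← one_div]
    exact div_le_div_of_nonneg_right (one_le_abs_cExt c 1) hm0.le
  · exfalso
    -- The second rotation is the inverse of the first, so the previous argument is applied to `y⁻¹
    -- g⁻¹ x⁻¹ = z⁻¹ h⁻¹`. The bottom left entry of `g⁻¹` has size `|c_{n-1}|/m`.
    have hσs : ∀ i : Fin n, (σ.symm i).val = if i.val = 0 then n - 1 else i.val - 1 := by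
      intro i
      obtain ⟨k, rfl⟩ := σ.surjective i
      have := h1 k
      have := k.2
      rw [Equiv.symm_apply_apply]
      split_ifs at * <;> omega
    have hγne : ∀ j, γ j ≠ 0 := by
      intro j
      have h2 : ((s j : ℤ) : ℝ) ≠ 0 := Int.cast_ne_zero.mpr (s j).ne_zero
      simp only [hγ]
      exact div_ne_zero (mul_ne_zero (mul_ne_zero (Units.ne_zero _) (Units.ne_zero _)) h2)
        (Units.ne_zero _)
    have hginv : ∀ i j, ((orbitPoint (mVec n m) c w)⁻¹).val i j =
        if i = σ.symm j then (γ (σ.symm j))⁻¹ else 0 := by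
      have : ((orbitPoint (mVec n m) c w)⁻¹).val =
          Matrix.of fun i j => if i = σ.symm j then (γ (σ.symm j))⁻¹ else 0 := by
        rw [Matrix.coe_units_inv]
        apply Matrix.inv_eq_left_inv
        ext i j
        rw [Matrix.mul_apply, Finset.sum_eq_single (σ j)]
        · rw [hg, if_pos rfl, Matrix.of_apply, Equiv.symm_apply_apply, Matrix.one_apply]
          split_ifs
          · exact inv_mul_cancel₀ (hγne j)
          · simp
        · intro k _ hk
          rw [hg, if_neg hk, mul_zero]
        · simp
      intro i j
      rw [this, Matrix.of_apply]
    have heq' : y⁻¹ * ((orbitPoint (mVec n m) c w)⁻¹ * x⁻¹) = central n z⁻¹ * h⁻¹ := by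
      have h2 : y⁻¹ * ((orbitPoint (mVec n m) c w)⁻¹ * x⁻¹) =
          (x * (orbitPoint (mVec n m) c w * y))⁻¹ := by group
      have h3 : central n z⁻¹ * (central n z) = 1 := by
        apply Units.ext
        ext i j
        rw [central_mul_apply]
        have : (central n z).val i j = z * (1 : G n).val i j := by
          rw [← central_mul_apply, mul_one]
        rw [this, ← mul_assoc]
        simp
      have h4 : central n z * h = h * central n z := by
        apply Units.ext
        ext i j
        rw [central_mul_apply, Units.val_mul]
        have : (central n z).val = Matrix.diagonal fun _ => (z : ℝ) := rfl
        rw [this, Matrix.mul_diagonal, mul_comm]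
      rw [h2, heq, h4, _root_.mul_inv_rev, eq_inv_of_mul_eq_one_left h3]
    have hzinv : |((z⁻¹ : ℝˣ) : ℝ)| = |(z : ℝ)|⁻¹ := by
      rw [Units.val_inv_eq_inv_val, abs_inv]
    refine rotation_disjoint hn hX (show 0 < 2 * τ by positivity) (by linarith) hσs hginv ?_
      ((NSub n).inv_mem hy) ((NSub n).inv_mem hx) (z := z⁻¹) ?_ ?_
      (NearOne.inv_of_mem_KSharp hX0 hh hnτ) heq'
    · have hσ0 : σ.symm ⟨0, by omega⟩ = ⟨n - 1, by omega⟩ := Fin.ext (by rw [hσs]; simp)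
      have hσL : σ ⟨n - 1, by omega⟩ = ⟨0, by omega⟩ := by rw [← hσ0, Equiv.apply_symm_apply]
      rw [hσ0]
      simp only [hγ]
      rw [hσL, mEntry_mVec (by omega), mEntry_mVec (by omega), if_pos (by simp; omega),
        if_neg (by simp; omega), cs_zero (by omega), div_one, abs_inv, abs_mul, abs_mul, abs_unit,
        mul_one, abs_inv, mul_inv, inv_inv, abs_of_pos hm0]
      refine hminv.trans ?_
      exact le_mul_of_one_le_right (inv_pos.mpr hm0).le (one_le_abs_cExt c (n - 1))
    · rw [hzinv]
      have := inv_anti₀ (by norm_num : (0 : ℝ) < 1 / 2) hz2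
      norm_num at this ⊢
      exact this
    · rw [hzinv]
      have := inv_anti₀ (by linarith : (0 : ℝ) < |(z : ℝ)|) hz1
      norm_num at this ⊢
      exact this

end Support

/-! ### The support in the cell of `w_*` -/

section Star

variable {n : ℕ}

/-- The signs of `w_*`. -/
def starSign (n : ℕ) (j : Fin n) : ℤˣ := if j.val = n - 1 then -1 else 1

theorem IsWeylSystem.star_apply {hn : 0 < n} {rep : Equiv.Perm (Fin n) → G n}
    (h : IsWeylSystem hn rep) (i j : Fin n) : (rep (starPerm n hn)).val i j =
      if i = starPerm n hn j then ((starSign n j : ℤ) : ℝ) else 0 := by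
  rw [h.star, starSign]
  split_ifs <;> simp

theorem starPerm_zero (hn : 0 < n) : starPerm n hn ⟨0, hn⟩ = ⟨n - 1, by omega⟩ :=
  Equiv.swap_apply_left _ _

theorem starPerm_last (hn : 0 < n) : starPerm n hn ⟨n - 1, by omega⟩ = ⟨0, hn⟩ :=
  Equiv.swap_apply_right _ _

theorem starPerm_mid (hn : 0 < n) {j : Fin n} (h0 : 0 < j.val) (h1 : j.val < n - 1) :
    starPerm n hn j = j :=
  Equiv.swap_apply_of_ne_of_ne (fun e => by rw [e] at h0; exact lt_irrefl _ h0)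
    (fun e => by rw [e] at h1; exact lt_irrefl _ h1)

/-- The middle entries of `c*` agree if `c` is admissible for `w_*`. -/
theorem cs_mid (hn : 3 ≤ n) {m : ℕ+} {c : Modulus n} {w : G n}
    (hs : ∀ i j, w.val i j = if i = starPerm n (by omega) j then ((starSign n j : ℤ) : ℝ) else 0)
    (h : Admissible (mVec n m) (mVec n m) w c) {j : Fin n} (h0 : 0 < j.val) (h1 : j.val < n - 1) :
    (cs c j : ℝ) = cs c ⟨1, by omega⟩ := by
  have step : ∀ d : ℕ, ∀ j : Fin n, j.val = d + 1 → j.val < n - 1 →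
      (cs c j : ℝ) = cs c ⟨1, by omega⟩ := by
    intro d
    induction d with
    | zero => intro j hj _; rw [show j = ⟨1, by omega⟩ from Fin.ext hj]
    | succ d ih =>
      intro j hj hjn
      obtain ⟨i, hi⟩ : ∃ i : Fin n, i.val = d + 1 := ⟨⟨d + 1, by omega⟩, rfl⟩
      rw [← ih i hi (by omega)]
      have hi' := starPerm_mid (n := n) (by omega) (j := i) (by omega) (by omega)
      have hj' := starPerm_mid (n := n) (by omega) (j := j) (by omega) (by omega)
      have key := (admissible_ascent hs h (i := i) (j := j) (by omega) (by
        rw [hi', hj']; exact Fin.lt_def.mpr (by omega))).2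
      rw [hi', hj', mEntry_mVec (by omega), mEntry_mVec (by omega), if_pos (by omega),
        if_pos (by omega), starSign, starSign, if_neg (by omega), if_neg (by omega)] at key
      have hm0 : (((m : ℕ) : ℝ)) ≠ 0 := by exact_mod_cast m.ne_zero
      have hj0 : (cs c j : ℝ) ≠ 0 := Units.ne_zero _
      simp only [Units.val_one, Int.cast_one, mul_one] at key
      rw [div_self hm0, div_eq_one_iff_eq (mul_ne_zero hm0 hj0)] at key
      exact (mul_left_cancel₀ hm0 key).symm
  exact step (j.val - 1) j (by omega) h1

/-- The moduli admissible for `w_*` are geometric progressions. -/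
theorem cExt_star (hn : 3 ≤ n) {m : ℕ+} {c : Modulus n} {w : G n}
    (hs : ∀ i j, w.val i j = if i = starPerm n (by omega) j then ((starSign n j : ℤ) : ℝ) else 0)
    (h : Admissible (mVec n m) (mVec n m) w c) (k : ℕ) (hk : k + 1 < n) :
    (cExt c (k + 1) : ℝ) = (cs c ⟨1, by omega⟩ : ℝ) ^ k * cExt c 1 := by
  induction k with
  | zero => simp
  | succ k ih =>
    have h1 := cs_mid hn hs h (j := ⟨n - (k + 2), by omega⟩) (by simp; omega) (by simp; omega)
    rw [cs, Units.val_div_eq_div_val] at h1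
    simp only [show n - (n - (k + 2)) = k + 1 + 1 by omega, Nat.add_sub_cancel] at h1
    rw [div_eq_iff (Units.ne_zero _), ih (by omega)] at h1
    rw [h1]; ring

/-- The region that contains the support of the test function in the cell of `w_*`. -/
structure StarBox (hn : 0 < n) (X τ C α r : ℝ) (x y : Matrix (Fin n) (Fin n) ℝ) : Prop where
  right : |(|α * y ⟨0, hn⟩ ⟨n - 1, by omega⟩| - 1)| ≤ C * (τ / X)
  left : |(|α * x ⟨0, hn⟩ ⟨n - 1, by omega⟩| - 1)| ≤ C * (τ / X)
  row : ∀ j : Fin n, 0 < j.val → j.val < n - 1 → |α * y ⟨0, hn⟩ j| ≤ 2 * τ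
  col : ∀ i : Fin n, 0 < i.val → i.val < n - 1 → |α * x i ⟨n - 1, by omega⟩| ≤ 2 * τ
  hyperbola : ∀ i : Fin n, 0 < i.val → i.val < n - 1 →
    |α * x i ⟨n - 1, by omega⟩ * y ⟨0, hn⟩ i| ≤ C * (τ / X)
  inner : ∀ i j : Fin n, i < j → j.val < n - 1 →
    |x i j + r * α * x i ⟨n - 1, by omega⟩ * y ⟨0, hn⟩ j| ≤
      2 * τ * X ^ ((j.val : ℤ) - i.val - 1)
  last : ∀ i : Fin n, 0 < i.val → i.val < n - 1 →
    |(∑ k : Fin n, if 0 < k.val ∧ k.val < n - 1 then x i k * y k ⟨n - 1, by omega⟩ else 0) +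
      r * α * x i ⟨n - 1, by omega⟩ * y ⟨0, hn⟩ ⟨n - 1, by omega⟩| ≤
      2 * τ * X ^ ((n : ℤ) - 1 - i.val - 1)

theorem sum_split_ends (hn : 2 ≤ n) (f : Fin n → ℝ) : ∑ k, f k =
    f ⟨0, by omega⟩ + f ⟨n - 1, by omega⟩ +
      ∑ k : Fin n, if 0 < k.val ∧ k.val < n - 1 then f k else 0 := by
  have h1 : ∀ k : Fin n, f k = ((if k = ⟨0, by omega⟩ then f k else 0) +
      (if k = ⟨n - 1, by omega⟩ then f k else 0)) +
        if 0 < k.val ∧ k.val < n - 1 then f k else 0 := by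
    intro k
    have hk := k.2
    simp only [Fin.ext_iff]
    split_ifs <;> first | omega | simp
  rw [Finset.sum_congr rfl fun k _ => h1 k, Finset.sum_add_distrib, Finset.sum_add_distrib]
  simp

/-- A geometric progression of three nonzero integers with ratio close to `±1` is constant up to
signs. -/
theorem abs_ratio_eq_one {r : ℝ} {a b c : ℤ} (hb : (b : ℝ) = r * a) (hc : (c : ℝ) = r ^ 2 * a)
    (h : |(a : ℝ)| * (|r| - 1) ^ 2 < 1) (ha : a ≠ 0) : |r| = 1 := by
  have h1 : ((|a| + |c| - 2 * |b| : ℤ) : ℝ) = |(a : ℝ)| * (|r| - 1) ^ 2 := by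
    push_cast
    rw [hb, hc, abs_mul, abs_mul, abs_pow]; ring
  have h2 : |a| + |c| - 2 * |b| = 0 := by
    have h3 : (0 : ℝ) ≤ ((|a| + |c| - 2 * |b| : ℤ) : ℝ) := by rw [h1]; positivity
    have h4 : ((|a| + |c| - 2 * |b| : ℤ) : ℝ) < 1 := by rw [h1]; exact h
    have h5 : 0 ≤ |a| + |c| - 2 * |b| := by exact_mod_cast h3
    have h6 : |a| + |c| - 2 * |b| < 1 := by exact_mod_cast h4
    omega
  rw [h2, Int.cast_zero] at h1
  have ha' : |(a : ℝ)| ≠ 0 := abs_ne_zero.mpr (Int.cast_ne_zero.mpr ha)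
  have h3 := (mul_eq_zero.mp h1.symm).resolve_left ha'
  have h4 : |r| - 1 = 0 := by simpa using h3
  linarith

/-- The smaller of `|e₁|` and `|e₂|` has square at most `|e₁ e₂|`, and both numbers are within `2δ`
of `z - r`. A bound for the product therefore bounds `(z - r)²`. -/
theorem mul_sq_sub_le {c z r e₁ e₂ δ τ : ℝ} (hc : 0 ≤ c) (h₁ : |(z - r) - e₁| ≤ 2 * δ)
    (h₂ : |(z - r) - e₂| ≤ 2 * δ) (key : c * |e₁ * e₂| ≤ 8 * τ ^ 3)
    (hδ : c * δ ^ 2 ≤ 2 * τ ^ 3) : c * (z - r) ^ 2 ≤ 32 * τ ^ 3 := by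
  have h3 : ∀ f : ℝ, |(z - r) - f| ≤ 2 * δ → |f| ^ 2 ≤ |e₁ * e₂| →
      (z - r) ^ 2 ≤ 2 * |e₁ * e₂| + 8 * δ ^ 2 := by
    intro f hf hfe
    have h4 : ((z - r) - f) ^ 2 ≤ (2 * δ) ^ 2 := by
      rw [← sq_abs]
      exact pow_le_pow_left₀ (abs_nonneg _) hf 2
    rw [sq_abs] at hfe
    nlinarith [sq_nonneg ((z - r) - f - f)]
  have h5 : (z - r) ^ 2 ≤ 2 * |e₁ * e₂| + 8 * δ ^ 2 := by
    rcases le_total |e₁| |e₂| with hle | hle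
    · refine h3 e₁ h₁ ?_
      rw [abs_mul, sq]; gcongr
    · refine h3 e₂ h₂ ?_
      rw [abs_mul, sq]; gcongr
  calc c * (z - r) ^ 2 ≤ c * (2 * |e₁ * e₂| + 8 * δ ^ 2) := by gcongr
    _ = 2 * (c * |e₁ * e₂|) + 8 * (c * δ ^ 2) := by ring
    _ ≤ 2 * (8 * τ ^ 3) + 8 * (2 * τ ^ 3) := by gcongr
    _ = _ := by ring

theorem mul_sq_abs_sub_one_lt {c z r δ τ C : ℝ} (hc : 0 ≤ c) (hτ : 0 ≤ τ) (hτ10 : τ ≤ 1 / 10)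
    (hC : C ^ 2 * τ ≤ 1 / 8) (hz : |(|z| - 1)| ≤ C * δ) (h : c * (z - r) ^ 2 ≤ 32 * τ ^ 3)
    (hδ : c * δ ^ 2 ≤ 2 * τ ^ 3) : c * (|r| - 1) ^ 2 < 1 := by
  have h1 : (|r| - 1) ^ 2 ≤ 2 * (z - r) ^ 2 + 2 * (C * δ) ^ 2 := by
    have h2 : (|z| - |r|) ^ 2 ≤ (z - r) ^ 2 := by
      rw [← sq_abs (|z| - |r|), ← sq_abs (z - r)]
      exact pow_le_pow_left₀ (abs_nonneg _) (abs_abs_sub_abs_le_abs_sub _ _) 2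
    have h3 : (|z| - 1) ^ 2 ≤ (C * δ) ^ 2 := by
      rw [← sq_abs]
      exact pow_le_pow_left₀ (abs_nonneg _) hz 2
    nlinarith [sq_nonneg ((|z| - |r|) + (|z| - 1))]
  have h5 : τ ^ 2 ≤ (1 / 10) ^ 2 := pow_le_pow_left₀ hτ hτ10 2
  have h6 : τ ^ 3 ≤ (1 / 10) ^ 3 := pow_le_pow_left₀ hτ hτ10 3
  calc c * (|r| - 1) ^ 2
      ≤ c * (2 * (z - r) ^ 2 + 2 * (C * δ) ^ 2) := by gcongr
    _ = 2 * (c * (z - r) ^ 2) + 2 * C ^ 2 * (c * δ ^ 2) := by ring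
    _ ≤ 2 * (32 * τ ^ 3) + 2 * C ^ 2 * (2 * τ ^ 3) := by gcongr
    _ = 64 * τ ^ 3 + 4 * (C ^ 2 * τ) * τ ^ 2 := by ring
    _ ≤ 64 * (1 / 10) ^ 3 + 4 * (1 / 8) * (1 / 10) ^ 2 := by gcongr
    _ < 1 := by norm_num

/-- Since `|z - r| < 1` and `r = ±1`, the numbers `z` and `r` have the same sign, and the distance
of absolute values is the distance itself. -/
theorem abs_sub_le_of_abs_eq_one {z r B : ℝ} (hr : |r| = 1) (hz : |(|z| - 1)| ≤ B)
    (h : (z - r) ^ 2 < 1) : |z - r| ≤ B := by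
  have h2 : |z - r| < 1 := by
    rw [← sq_abs] at h
    nlinarith [abs_nonneg (z - r)]
  have h3 := abs_lt.mp h2
  rcases abs_eq (zero_le_one' ℝ) |>.mp hr with h | h
  · rw [h] at h3 ⊢
    rwa [abs_of_pos (show 0 < z by linarith)] at hz
  · rw [h] at h3 ⊢
    rw [abs_of_neg (show z < 0 by linarith)] at hz
    rw [← abs_neg]
    convert hz using 2
    ring

set_option maxHeartbeats 600000 in
-- For `w_*` the entries of `x g y` can be read off: the last row is `α y_{0j}` (for `j < n-1`, and
-- also in the corner), the first column is `α x_{iL}`, and a middle diagonal entry exceeds `r` by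
-- `α x_{iL} y_{0i}`, where `α = c_1/m` is the bottom left entry. The bounds on `K^♯` first give
-- `|r| = 1`; then `z` is near `r`, and the same bounds become the conditions of the region.
theorem starBox_of_support (n : ℕ) (hn : 3 < n) : ∃ τ₀ C : ℝ, 0 < τ₀ ∧ 0 < C ∧
    ∀ X τ : ℝ, 1 ≤ X → 0 < τ → τ < τ₀ → ∀ m : ℕ+, ((m : ℕ) : ℝ) ≤ X ^ (n + 2) →
    ∀ w : G n, (∀ i j, w.val i j =
      if i = starPerm n (by omega) j then ((starSign n j : ℤ) : ℝ) else 0) →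
    ∀ c : Modulus n, Admissible (mVec n m) (mVec n m) w c →
    ∀ x ∈ N n, ∀ y ∈ N n, (∀ k j : Fin n, 0 < k.val → k < j → j.val < n - 1 → y.val k j = 0) →
    ∀ (z : ℝˣ), ∀ h ∈ KSharp n X τ,
      x * (orbitPoint (mVec n m) c w * y) = central n z * h →
      |(cs c ⟨1, by omega⟩ : ℝ)| = 1 ∧ |(cExt c 1 : ℝ)| ≤ 2 * τ * X ^ 2 ∧
      |(cExt c 1 : ℝ) / ((m : ℕ) : ℝ)| * X ≤ 2 * τ ∧
      StarBox (by omega : 0 < n) X τ C (cExt c 1 / ((m : ℕ) : ℝ)) (cs c ⟨1, by omega⟩)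
        x.val y.val := by
  obtain ⟨C, d, hC, hd, hscal⟩ := exists_abs_scalar_sub_one_le n (by omega)
  refine ⟨min d (min (1 / (2 * C)) (min (1 / 10) (1 / (8 * C ^ 2)))), C + 2, by positivity,
    by positivity, ?_⟩
  intro X τ hX hτ hτ0 m hm w hs c hadm x hx y hy hyk z h hh heq
  simp only [lt_min_iff] at hτ0
  obtain ⟨hτd, hτC, hτ10, hτC2⟩ := hτ0
  have hX0 : 0 < X := by linarith
  have hm0 : (0 : ℝ) < ((m : ℕ) : ℝ) := by exact_mod_cast m.pos
  have hτX : τ / X ≤ τ := div_le_self hτ.le hX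
  have hτX0 : 0 < τ / X := by positivity
  have hdet : |(central n z * h).val.det| = 1 := by
    rw [← heq, Units.val_mul, Units.val_mul, Matrix.det_mul, Matrix.det_mul, det_of_mem_N hx,
      det_of_mem_N hy, one_mul, mul_one, abs_det_orbitPoint hs]
  have hzb := hscal X τ hX hτ hτd.le z h hh hdet
  have hzb' : |(|(z : ℝ)| - 1)| ≤ 1 / 2 := by
    refine hzb.trans ?_
    calc C * (τ / X) ≤ C * (1 / (2 * C)) := mul_le_mul_of_nonneg_left (by linarith) hC.le
      _ = 1 / 2 := by field_simp
  have hz1 : |(z : ℝ)| ≤ 2 := by have := (abs_le.mp hzb').2; linarith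
  have hnear := NearOne.of_mem_KSharp hX0 hh
  set r : ℝ := ((cs c ⟨1, by omega⟩ : ℝˣ) : ℝ) with hr
  set c₁ : ℝ := ((cExt c 1 : ℝˣ) : ℝ) with hc₁
  set α : ℝ := c₁ / ((m : ℕ) : ℝ) with hα
  set γ : Fin n → ℝ := fun j => (mEntry (mVec n m) (starPerm n (by omega) j) *
    cs c (starPerm n (by omega) j) * ((starSign n j : ℤ) : ℝ) / mEntry (mVec n m) j : ℝ) with hγ
  have hg : ∀ i j, (orbitPoint (mVec n m) c w).val i j =
      if i = starPerm n (by omega) j then γ j else 0 := by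
    intro i j
    rw [orbitPoint_apply hs]
    split_ifs with hi
    · rw [hγ, hi]
    · rfl
  obtain ⟨a0, ha0⟩ : ∃ a : Fin n, a = ⟨0, by omega⟩ := ⟨_, rfl⟩
  obtain ⟨aL, haL⟩ : ∃ a : Fin n, a = ⟨n - 1, by omega⟩ := ⟨_, rfl⟩
  have hv0 : a0.val = 0 := by rw [ha0]
  have hvL : aL.val = n - 1 := by rw [haL]
  have hσ0 : starPerm n (by omega) a0 = aL := by rw [ha0, haL, starPerm_zero]
  have hσL : starPerm n (by omega) aL = a0 := by rw [ha0, haL, starPerm_last]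
  have hγ0 : γ a0 = α := by
    simp only [hγ]
    rw [hσ0, mEntry_mVec (by omega), mEntry_mVec (by omega), if_neg (by omega), if_pos (by omega),
      haL, cs_last (by omega), starSign, if_neg (by omega)]
    simp [hα, hc₁]
  have hγmid : ∀ j : Fin n, 0 < j.val → j.val < n - 1 → γ j = r := by
    intro j h0 h1
    simp only [hγ]
    rw [starPerm_mid (by omega) h0 h1, cs_mid (by omega) hs hadm h0 h1, starSign,
      if_neg (by omega), Units.val_one, Int.cast_one, mul_one,
      mul_div_cancel_left₀ _ (Units.ne_zero _)]
  have hE : ∀ i j : Fin n, (central n z * h).val i j =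
      x.val i aL * (α * y.val a0 j) + x.val i a0 * (γ aL * y.val aL j) +
        ∑ k : Fin n, if 0 < k.val ∧ k.val < n - 1 then r * (x.val i k * y.val k j) else 0 := by
    intro i j
    rw [← heq, mul_monomial_mul_apply hg, sum_split_ends (by omega), ← ha0, ← haL, hσ0, hσL, hγ0]
    congr 1
    refine Finset.sum_congr rfl fun k _ => ?_
    split_ifs with hk
    · rw [starPerm_mid (by omega) hk.1 hk.2, hγmid k hk.1 hk.2]; ring
    · rfl
  -- Here `y` is the identity in the middle block and its last row vanishes before the corner, so
  -- only the terms `k = 0` and `k = j` survive.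
  have hE1 : ∀ i j : Fin n, j.val < n - 1 → (central n z * h).val i j =
      x.val i aL * (α * y.val a0 j) + if 0 < j.val then r * x.val i j else 0 := by
    intro i j hj
    rw [hE, hy.2 aL j (Fin.lt_def.mpr (by omega)), mul_zero, mul_zero, add_zero]
    congr 1
    rw [Finset.sum_eq_single j]
    · by_cases h0 : 0 < j.val
      · rw [if_pos ⟨h0, hj⟩, if_pos h0, hy.1, mul_one]
      · rw [if_neg (fun h => h0 h.1), if_neg h0]
    · intro k _ hk
      split_ifs with h
      · rcases lt_or_gt_of_ne hk with h1 | h1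
        · rw [hyk k j h.1 h1 hj]; ring
        · rw [hy.2 k j h1]; ring
      · rfl
    · simp
  have hEα : (central n z * h).val aL a0 = α := by
    rw [hE1 _ _ (by omega), if_neg (by omega), hx.1, hy.1]; ring
  have hErow : ∀ j : Fin n, 0 < j.val → j.val < n - 1 →
      (central n z * h).val aL j = α * y.val a0 j := by
    intro j h0 h1
    rw [hE1 _ _ h1, if_pos h0, hx.1, hx.2 aL j (Fin.lt_def.mpr (by omega))]; ring
  have hEcol : ∀ i : Fin n, (central n z * h).val i a0 = α * x.val i aL := by
    intro i
    rw [hE1 _ _ (by omega), if_neg (by omega), hy.1]; ring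
  have hElast : (central n z * h).val aL aL = α * y.val a0 aL := by
    rw [hE, hx.1, hx.2 aL a0 (Fin.lt_def.mpr (by omega)), Finset.sum_eq_zero]
    · ring
    · intro k _
      split_ifs with h
      · rw [hx.2 aL k (Fin.lt_def.mpr (by omega))]; ring
      · rfl
  have hne : ∀ {a b : Fin n}, a.val ≠ b.val → a ≠ b := fun h e => h (congrArg Fin.val e)
  -- The bottom left entry `α` is at most `2τ X^(-n)`, so `m ≤ X^(n+2)` yields `|c_1| = m |α| ≤ 2τ
  -- X²`.
  have hm2 : ((m : ℕ) : ℝ) * X⁻¹ ^ n ≤ X ^ 2 := by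
    calc ((m : ℕ) : ℝ) * X⁻¹ ^ n ≤ X ^ (n + 2) * X⁻¹ ^ n := by gcongr
      _ = X ^ 2 := by
        rw [pow_add, mul_right_comm, ← mul_pow, mul_inv_cancel₀ hX0.ne', one_pow, one_mul]
  have hαm : |α| = |c₁| / ((m : ℕ) : ℝ) := by rw [hα, abs_div, abs_of_pos hm0]
  have hα1 : |α| ≤ 2 * τ * X⁻¹ ^ n := by
    rw [← hEα]
    refine (hnear.scaled_offDiag hz1 (hne (by omega))).trans (le_of_eq ?_)
    rw [inv_pow, ← zpow_natCast, ← _root_.zpow_neg]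
    congr 2
    rw [hv0, hvL]; push_cast [Nat.cast_sub (show 1 ≤ n by omega)]; ring
  have hc1 : |c₁| ≤ 2 * τ * X ^ 2 := by
    have h1 : |c₁| = ((m : ℕ) : ℝ) * |α| := by rw [hαm]; field_simp
    rw [h1]
    calc ((m : ℕ) : ℝ) * |α| ≤ ((m : ℕ) : ℝ) * (2 * τ * X⁻¹ ^ n) := by gcongr
      _ = 2 * τ * (((m : ℕ) : ℝ) * X⁻¹ ^ n) := by ring
      _ ≤ _ := by gcongr
  have hαX : |α| * X ≤ 2 * τ := by
    have h1 : X⁻¹ ^ n * X ≤ 1 := by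
      obtain ⟨p, rfl⟩ : ∃ p, n = p + 1 := ⟨n - 1, by omega⟩
      rw [pow_succ, mul_assoc, inv_mul_cancel₀ hX0.ne', mul_one]
      exact pow_le_one₀ (inv_nonneg.mpr hX0.le) (inv_le_one_of_one_le₀ hX)
    calc |α| * X ≤ 2 * τ * X⁻¹ ^ n * X := by gcongr
      _ = 2 * τ * (X⁻¹ ^ n * X) := by ring
      _ ≤ 2 * τ * 1 := by gcongr
      _ = _ := mul_one _
  have hc1pos : 1 ≤ |c₁| := one_le_abs_cExt c 1
  have hα0 : α ≠ 0 := by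
    rw [← abs_pos, hαm]; positivity
  have hdiag : ∀ i, |(central n z * h).val i i - z| ≤ 2 * (τ / X) := by
    intro i
    rw [central_mul_apply, ← mul_sub_one, abs_mul]
    exact mul_le_mul hz1 (hnear.diag i) (abs_nonneg _) (by norm_num)
  have hdiag' : ∀ i, |(|(central n z * h).val i i| - 1)| ≤ (C + 2) * (τ / X) := by
    intro i
    have h1 := (abs_abs_sub_abs_le_abs_sub ((central n z * h).val i i) z).trans (hdiag i)
    have h2 := abs_add_le (|(central n z * h).val i i| - |(z : ℝ)|) (|(z : ℝ)| - 1)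
    rw [sub_add_sub_cancel] at h2
    linarith
  have hEmid : ∀ i : Fin n, 0 < i.val → i.val < n - 1 →
      (central n z * h).val i i - r = α * x.val i aL * y.val a0 i := by
    intro i h0 h1
    rw [hE1 _ _ h1, if_pos h0, hx.1]; ring
  obtain ⟨a1, ha1⟩ : ∃ a : Fin n, a.val = 1 := ⟨⟨1, by omega⟩, rfl⟩
  obtain ⟨a2, ha2⟩ : ∃ a : Fin n, a.val = 2 := ⟨⟨2, by omega⟩, rfl⟩
  set e₁ := (central n z * h).val a1 a1 - r with he₁
  set e₂ := (central n z * h).val a2 a2 - r with he₂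
  -- The rank one identity at the indices `1` and `2`, as for the rotations: the three entries
  -- multiply to `X^(-n-2)`, which the factor `m` in `|c₁| = m |α|` just compensates.
  have key : |c₁| * |e₁ * e₂| ≤ 8 * τ ^ 3 := by
    have h1 := abs_mul_le_of_rank_one hα0 (e₁ := e₁) (e₂ := e₂)
      (f := (central n z * h).val a2 a1) (p₁ := (central n z * h).val a1 a0)
      (p₂ := (central n z * h).val a2 a0) (q₁ := (central n z * h).val aL a1)
      (q₂ := (central n z * h).val aL a2)
      (by rw [hEcol, hErow _ (by omega) (by omega), he₁, hEmid _ (by omega) (by omega)]; ring)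
      (by rw [hEcol, hErow _ (by omega) (by omega), he₂, hEmid _ (by omega) (by omega)]; ring)
      (by
        rw [hEcol, hErow _ (by omega) (by omega), hE1 _ _ (by omega), if_pos (by omega),
          hx.2 a2 a1 (Fin.lt_def.mpr (by omega))]
        ring)
      (hnear.scaled_offDiag hz1 (hne (by omega))) (hnear.scaled_offDiag hz1 (hne (by omega)))
      (hnear.scaled_offDiag hz1 (hne (by omega)))
    have hexp : X ^ ((a1.val : ℤ) - a2.val - 1) * X ^ ((a0.val : ℤ) - a1.val - 1) *
        X ^ ((a2.val : ℤ) - aL.val - 1) = (X ^ (n + 2))⁻¹ := by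
      rw [← zpow_add₀ hX0.ne', ← zpow_add₀ hX0.ne', ← zpow_natCast, ← _root_.zpow_neg]
      congr 1
      rw [hv0, ha1, ha2, hvL]
      push_cast [Nat.cast_sub (show 1 ≤ n by omega)]
      ring
    have h2 : |α| * |e₁ * e₂| ≤ 8 * τ ^ 3 * (X ^ (n + 2))⁻¹ := by
      rw [← hexp]; refine h1.trans (le_of_eq (by ring))
    have h3 : |c₁| = ((m : ℕ) : ℝ) * |α| := by rw [hαm]; field_simp
    calc |c₁| * |e₁ * e₂| = ((m : ℕ) : ℝ) * (|α| * |e₁ * e₂|) := by rw [h3]; ring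
      _ ≤ ((m : ℕ) : ℝ) * (8 * τ ^ 3 * (X ^ (n + 2))⁻¹) := by gcongr
      _ ≤ X ^ (n + 2) * (8 * τ ^ 3 * (X ^ (n + 2))⁻¹) := by gcongr
      _ = 8 * τ ^ 3 := by field_simp
  have hδ : |c₁| * (τ / X) ^ 2 ≤ 2 * τ ^ 3 := by
    calc |c₁| * (τ / X) ^ 2 ≤ 2 * τ * X ^ 2 * (τ / X) ^ 2 := by gcongr
      _ = 2 * τ ^ 3 := by field_simp
  have hτ3 : τ ^ 3 ≤ 1 / 1000 := by
    have := pow_le_pow_left₀ hτ.le hτ10.le 3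
    norm_num at this ⊢
    exact this
  have hesq : |c₁| * ((z : ℝ) - r) ^ 2 ≤ 32 * τ ^ 3 := by
    have h1 : |((z : ℝ) - r) - e₁| ≤ 2 * (τ / X) := by
      have := hdiag a1
      rw [abs_sub_comm] at this
      rw [he₁]; convert this using 2; ring
    have h2 : |((z : ℝ) - r) - e₂| ≤ 2 * (τ / X) := by
      have := hdiag a2
      rw [abs_sub_comm] at this
      rw [he₂]; convert this using 2; ring
    exact mul_sq_sub_le (abs_nonneg _) h1 h2 key hδ
  have hr1 : |r| = 1 := by
    -- The integers `c_1, c_2, c_3` are available because `n > 3`; they are in geometric progression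
    -- with ratio `r`.
    obtain ⟨a, ha, hae⟩ := exists_cExt_eq_int c 1
    obtain ⟨b, -, hbe⟩ := exists_cExt_eq_int c 2
    obtain ⟨e, -, hee⟩ := exists_cExt_eq_int c 3
    have hb := cExt_star (by omega) hs hadm 1 (by omega)
    have he := cExt_star (by omega) hs hadm 2 (by omega)
    refine abs_ratio_eq_one (a := a) (b := b) (c := e) ?_ ?_ ?_ ha
    · rw [← hbe, ← hae, hb, pow_one]
    · rw [← hee, ← hae, he]
    · rw [← hae, ← hc₁]
      have h4 : C ^ 2 * τ ≤ 1 / 8 := by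
        calc C ^ 2 * τ ≤ C ^ 2 * (1 / (8 * C ^ 2)) :=
              mul_le_mul_of_nonneg_left hτC2.le (sq_nonneg _)
          _ = 1 / 8 := by field_simp
      exact mul_sq_abs_sub_one_lt (abs_nonneg _) hτ.le hτ10.le h4 hzb hesq hδ
  have hzr : |(z : ℝ) - r| ≤ C * (τ / X) := by
    have h1 : ((z : ℝ) - r) ^ 2 < 1 := by
      have : ((z : ℝ) - r) ^ 2 ≤ |c₁| * ((z : ℝ) - r) ^ 2 :=
        le_mul_of_one_le_left (sq_nonneg _) hc1pos
      linarith
    exact abs_sub_le_of_abs_eq_one hr1 hzb h1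
  have hrr : r * r = 1 := by
    rcases abs_eq (zero_le_one' ℝ) |>.mp hr1 with h | h <;> rw [h] <;> norm_num
  refine ⟨hr1, hc1, hαX, ⟨?_, ?_, ?_, ?_, ?_, ?_, ?_⟩⟩
  · rw [← ha0, ← haL, ← hElast]; exact hdiag' aL
  · rw [← ha0, ← haL, ← hEcol]; exact hdiag' a0
  · intro j h0 h1
    rw [← ha0, ← hErow j h0 h1]
    refine (hnear.scaled_offDiag hz1 (hne (by omega))).trans ?_
    refine mul_le_of_le_one_right (by positivity) ?_
    exact zpow_le_one_of_nonpos₀ hX (by omega)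
  · intro i h0 h1
    rw [← haL, ← hEcol]
    refine (hnear.scaled_offDiag hz1 (hne (by omega))).trans ?_
    refine mul_le_of_le_one_right (by positivity) ?_
    exact zpow_le_one_of_nonpos₀ hX (by omega)
  · intro i h0 h1
    rw [← ha0, ← haL, ← hEmid i h0 h1]
    have h2 := abs_add_le ((central n z * h).val i i - z) ((z : ℝ) - r)
    rw [sub_add_sub_cancel] at h2
    have h3 := hdiag i
    linarith
  · intro i j hij hj
    rw [← ha0, ← haL]
    have h1 := hnear.scaled_offDiag hz1 hij.ne
    have hij' : i.val < j.val := hij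
    rw [hE1 _ _ hj, if_pos (by omega)] at h1
    have h2 : x.val i j + r * α * x.val i aL * y.val a0 j =
        r * (x.val i aL * (α * y.val a0 j) + r * x.val i j) := by
      linear_combination (-x.val i j) * hrr
    rw [h2, abs_mul, hr1, one_mul]
    exact h1
  · intro i h0 h1
    rw [← ha0, ← haL]
    have h2 := hnear.scaled_offDiag hz1 (show i ≠ aL from hne (by omega))
    rw [hE, hx.2 i a0 (Fin.lt_def.mpr (by omega)), zero_mul, add_zero] at h2
    have h3 : (∑ k : Fin n, if 0 < k.val ∧ k.val < n - 1 then r * (x.val i k * y.val k aL) else 0) =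
        r * ∑ k : Fin n, if 0 < k.val ∧ k.val < n - 1 then x.val i k * y.val k aL else 0 := by
      rw [Finset.mul_sum]
      refine Finset.sum_congr rfl fun k _ => ?_
      split_ifs <;> simp
    rw [h3] at h2
    set S := ∑ k : Fin n, if 0 < k.val ∧ k.val < n - 1 then x.val i k * y.val k aL else 0
    have h4 : S + r * α * x.val i aL * y.val a0 aL =
        r * (x.val i aL * (α * y.val a0 aL) + r * S) := by
      linear_combination (-S) * hrr
    rw [h4, abs_mul, hr1, one_mul]
    refine h2.trans (le_of_eq ?_)
    congr 2
    rw [hvL]; push_cast [Nat.cast_sub (show 1 ≤ n by omega)]; ring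

end Star

/-! ### The volume of the support in the cell of `w_*` -/

section Volume

open scoped ENNReal

variable {n : ℕ}

/-- The extended power is infinite at `0`, where the real one takes a default value. This changes
the integrand only on a null set, and the infinite value keeps the weights valid where a coordinate
vanishes. -/
theorem lintegral_indicator_enn_rpow_le {R e : ℝ} (hR : 0 ≤ R) (he : 0 < e) :
    ∫⁻ t : ℝ, Set.indicator {t : ℝ | |t| ≤ R} (fun t => ENNReal.ofReal |t| ^ (e - 1)) t ≤
      ENNReal.ofReal (2 * R ^ e / e) := by
  refine le_trans (le_of_eq (lintegral_congr_ae ?_)) (lintegral_indicator_rpow_le hR he)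
  have h0 : ∀ᵐ t : ℝ, t ≠ 0 := by
    rw [ae_iff]
    simp
  filter_upwards [h0] with t ht
  by_cases h : t ∈ {t : ℝ | |t| ≤ R}
  · rw [Set.indicator_of_mem h, Set.indicator_of_mem h, ENNReal.ofReal_rpow_of_pos (abs_pos.mpr ht)]
  · rw [Set.indicator_of_notMem h, Set.indicator_of_notMem h]

theorem prod_Pos {M : Type*} [CommMonoid M] (g : Fin n → Fin n → M) :
    ∏ p : Pos n, g p.1.1 p.1.2 = ∏ i, ∏ j, if i < j then g i j else 1 := by
  rw [← Fintype.prod_prod_type', ← Finset.prod_filter]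
  exact (Finset.prod_subtype (Finset.univ.filter fun p : Fin n × Fin n => p.1 < p.2)
    (p := fun p : Fin n × Fin n => p.1 < p.2) (by simp) (fun p => g p.1 p.2)).symm

theorem prod_Inv {M : Type*} [CommMonoid M] (σ : Equiv.Perm (Fin n)) (g : Fin n → Fin n → M) :
    ∏ q : Inv σ, g q.1.1.1 q.1.1.2 = ∏ i, ∏ j, if i < j then (if σ j < σ i then g i j else 1) else 1 := by
  rw [← prod_Pos (fun i j => if σ j < σ i then g i j else 1), ← Finset.prod_filter]
  exact (Finset.prod_subtype (Finset.univ.filter fun p : Pos n => σ p.1.2 < σ p.1.1)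
    (p := fun p : Pos n => σ p.1.2 < σ p.1.1) (by simp) (fun p => g p.1.1 p.1.2)).symm

theorem starPerm_lt_iff (hn : 0 < n) {i j : Fin n} (hij : i < j) :
    starPerm n hn j < starPerm n hn i ↔ i.val = 0 ∨ j.val = n - 1 := by
  have hij' : i.val < j.val := hij
  have hj := j.2
  rcases Nat.eq_zero_or_pos i.val with hi | hi
  · rw [show i = ⟨0, hn⟩ from Fin.ext hi, starPerm_zero]
    refine iff_of_true ?_ (Or.inl rfl)
    by_cases hjl : j.val = n - 1
    · rw [show j = ⟨n - 1, by omega⟩ from Fin.ext hjl, starPerm_last]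
      exact Fin.lt_def.mpr (by simp; omega)
    · rw [starPerm_mid hn (by omega) (by omega)]
      exact Fin.lt_def.mpr (by simp; omega)
  · rw [starPerm_mid hn hi (by omega)]
    by_cases hjl : j.val = n - 1
    · rw [show j = ⟨n - 1, by omega⟩ from Fin.ext hjl, starPerm_last]
      exact iff_of_true (Fin.lt_def.mpr (by simpa using hi)) (Or.inr rfl)
    · rw [starPerm_mid hn (by omega) (by omega)]
      refine iff_of_false (not_lt.mpr hij.le) ?_
      omega

/-- The matrix of the element of `N_w` with given coordinates. -/
def unipWMat (σ : Equiv.Perm (Fin n)) (v : Inv σ → ℝ) : Matrix (Fin n) (Fin n) ℝ :=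
  unipMat fun p => if h : σ p.1.2 < σ p.1.1 then v ⟨p, h⟩ else 0

theorem unipW_val (σ : Equiv.Perm (Fin n)) (v : Inv σ → ℝ) : (unipW σ v).val = unipWMat σ v := rfl

theorem unipMat_of_lt (v : Pos n → ℝ) {i j : Fin n} (h : i < j) :
    unipMat v i j = v ⟨(i, j), h⟩ := by simp [unipMat, h]

theorem unipMat_self (v : Pos n → ℝ) (i : Fin n) : unipMat v i i = 1 := by simp [unipMat]

theorem unipMat_of_gt (v : Pos n → ℝ) {i j : Fin n} (h : j < i) : unipMat v i j = 0 := by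
  simp [unipMat, not_lt.mpr h.le, h.ne']

theorem unipWMat_of_lt {σ : Equiv.Perm (Fin n)} (v : Inv σ → ℝ) {i j : Fin n} (h : i < j)
    (h' : σ j < σ i) : unipWMat σ v i j = v ⟨⟨(i, j), h⟩, h'⟩ := by
  rw [unipWMat, unipMat_of_lt _ h, dif_pos h']

theorem continuous_unipMat : Continuous (unipMat (n := n)) := by
  refine continuous_matrix fun i j => ?_
  simp only [unipMat, Matrix.of_apply]
  split_ifs <;> fun_prop

theorem continuous_unipWMat (σ : Equiv.Perm (Fin n)) : Continuous (unipWMat σ) := by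
  refine continuous_unipMat.comp (continuous_pi fun p => ?_)
  split_ifs <;> fun_prop

theorem unipMat_update (x : Pos n → ℝ) (p : Pos n) (t : ℝ) {i j : Fin n} (h : p.1 ≠ (i, j)) :
    unipMat (Function.update x p t) i j = unipMat x i j := by
  simp only [unipMat, Matrix.of_apply]
  split_ifs with hij
  · rw [Function.update_of_ne]
    rintro rfl; exact h rfl
  · rfl
  · rfl

theorem unipWMat_update {σ : Equiv.Perm (Fin n)} (x : Inv σ → ℝ) (p : Inv σ) (t : ℝ)
    {i j : Fin n} (h : p.1.1 ≠ (i, j)) :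
    unipWMat σ (Function.update x p t) i j = unipWMat σ x i j := by
  simp only [unipWMat, unipMat, Matrix.of_apply]
  split_ifs with hij hσ
  · rw [Function.update_of_ne]
    rintro rfl; exact h rfl
  · rfl
  · rfl
  · rfl

/-- Weights for the coordinates of `N`: indices `i`, `j`, value `t`. -/
def weightN (n : ℕ) (X τ C α e : ℝ) (i j : Fin n) : ℝ → ℝ≥0∞ :=
  if j.val = n - 1 then
    if i.val = 0 then Set.indicator {t : ℝ | |(|α * t| - 1)| ≤ C * (τ / X)} 1
    else fun t => ENNReal.ofReal (C * (τ / X) / |α|) ^ (1 - e) *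
      Set.indicator {t : ℝ | |t| ≤ 2 * τ / |α|} (fun t => ENNReal.ofReal |t| ^ (e - 1)) t
  else Set.indicator {t : ℝ | |t| ≤ 2 * τ * X ^ ((j.val : ℤ) - i.val - 1)} 1

/-- Weights for the coordinates of `N_w`. -/
def weightNw (n : ℕ) (X τ C α e : ℝ) (i j : Fin n) : ℝ → ℝ≥0∞ :=
  if i.val = 0 then
    if j.val = n - 1 then Set.indicator {t : ℝ | |(|α * t| - 1)| ≤ C * (τ / X)} 1
    else Set.indicator {t : ℝ | |t| ≤ 2 * τ / |α|} (fun t => ENNReal.ofReal |t| ^ (e - 1))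
  else Set.indicator {t : ℝ | |t| ≤ 2 * τ * X ^ ((n : ℤ) - 1 - i.val - 1)} 1

theorem measurable_weightN (X τ C α e : ℝ) (i j : Fin n) :
    Measurable (weightN n X τ C α e i j) := by
  have h1 : MeasurableSet {t : ℝ | |(|α * t| - 1)| ≤ C * (τ / X)} :=
    (isClosed_le (by fun_prop) continuous_const).measurableSet
  have h2 : ∀ R : ℝ, MeasurableSet {t : ℝ | |t| ≤ R} := fun R =>
    (isClosed_le (by fun_prop) continuous_const).measurableSet
  unfold weightN
  split_ifs
  · exact measurable_one.indicator h1
  · refine Measurable.const_mul (Measurable.indicator ?_ (h2 _)) _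
    fun_prop
  · exact measurable_one.indicator (h2 _)

theorem measurable_weightNw (X τ C α e : ℝ) (i j : Fin n) :
    Measurable (weightNw n X τ C α e i j) := by
  have h1 : MeasurableSet {t : ℝ | |(|α * t| - 1)| ≤ C * (τ / X)} :=
    (isClosed_le (by fun_prop) continuous_const).measurableSet
  have h2 : ∀ R : ℝ, MeasurableSet {t : ℝ | |t| ≤ R} := fun R =>
    (isClosed_le (by fun_prop) continuous_const).measurableSet
  unfold weightNw
  split_ifs
  · exact measurable_one.indicator h1
  · refine Measurable.indicator ?_ (h2 _)
    fun_prop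
  · exact measurable_one.indicator (h2 _)

/-- Centre of the range of the coordinate `(i, j)` of `N`. -/
def centreN (hn : 0 < n) (α r : ℝ) (i j : Fin n) (A B : Matrix (Fin n) (Fin n) ℝ) : ℝ :=
  if j.val = n - 1 then 0 else -(r * α * A i ⟨n - 1, by omega⟩ * B ⟨0, hn⟩ j)

/-- Centre of the range of the coordinate `(i, j)` of `N_w`. -/
def centreNw (hn : 0 < n) (α r : ℝ) (i : Fin n) (A B : Matrix (Fin n) (Fin n) ℝ) : ℝ :=
  if i.val = 0 then 0 else
    -((∑ k : Fin n, if i.val < k.val ∧ k.val < n - 1 then A i k * B k ⟨n - 1, by omega⟩ else 0) +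
      r * α * A i ⟨n - 1, by omega⟩ * B ⟨0, hn⟩ ⟨n - 1, by omega⟩)

/-- On the box, the product of all weights is at least one. -/
theorem StarBox.one_le_prod (hn : 2 ≤ n) {X τ C α r e : ℝ} (hX : 0 < X) (hτ : 0 < τ) (hC : 0 < C)
    (hα : α ≠ 0) (he1 : e < 1) {u : Pos n → ℝ} {v : Inv (starPerm n (by omega)) → ℝ}
    (h : StarBox (by omega : 0 < n) X τ C α r (unipMat u) (unipWMat _ v)) :
    1 ≤ (∏ p : Pos n, weightN n X τ C α e p.1.1 p.1.2
        (unipMat u p.1.1 p.1.2 -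
          centreN (by omega) α r p.1.1 p.1.2 (unipMat u) (unipWMat _ v))) *
      ∏ q : Inv (starPerm n (by omega)), weightNw n X τ C α e q.1.1.1 q.1.1.2
        (unipWMat _ v q.1.1.1 q.1.1.2 -
          centreNw (by omega) α r q.1.1.1 (unipMat u) (unipWMat _ v)) := by
  have hα' : 0 < |α| := abs_pos.mpr hα
  set A := unipMat u with hA
  set B := unipWMat (starPerm n (by omega)) v with hB
  obtain ⟨a0, ha0⟩ : ∃ a : Fin n, a = ⟨0, by omega⟩ := ⟨_, rfl⟩
  obtain ⟨aL, haL⟩ : ∃ a : Fin n, a = ⟨n - 1, by omega⟩ := ⟨_, rfl⟩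
  have hv0 : a0.val = 0 := by rw [ha0]
  have hvL : aL.val = n - 1 := by rw [haL]
  set H := ENNReal.ofReal (C * (τ / X) / |α|) ^ (1 - e) with hH
  let mid : Fin n → Prop := fun i => 0 < i.val ∧ i.val < n - 1
  -- On the box all indicators equal `1`, so only the singular powers of the middle entries in the
  -- last column remain, each with its factor `H`.
  have e1 : ∏ p : Pos n, weightN n X τ C α e p.1.1 p.1.2
        (A p.1.1 p.1.2 - centreN (by omega) α r p.1.1 p.1.2 A B) =
      ∏ i : Fin n, if 0 < i.val ∧ i.val < n - 1 then
        H * ENNReal.ofReal |A i aL| ^ (e - 1) else 1 := by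
    rw [prod_Pos (fun i j => weightN n X τ C α e i j (A i j - centreN (by omega) α r i j A B))]
    refine Finset.prod_congr rfl fun i _ => ?_
    rw [Finset.prod_eq_single aL]
    · by_cases hi : i < aL
      · have hi' : i.val < aL.val := hi
        rw [if_pos hi, weightN, if_pos hvL, centreN, if_pos hvL, sub_zero]
        by_cases hi0 : i.val = 0
        · rw [if_pos hi0, if_neg (by omega), show i = a0 from Fin.ext (by omega),
            Set.indicator_of_mem, Pi.one_apply]
          rw [ha0, haL]; exact h.left
        · rw [if_neg hi0, if_pos (by omega), Set.indicator_of_mem]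
          have := h.col i (by omega) (by omega)
          rw [← haL, abs_mul] at this
          rw [Set.mem_ofPred_eq, le_div_iff₀ hα', mul_comm]
          exact this
      · have : ¬ i.val < aL.val := hi
        rw [if_neg hi, if_neg (by omega)]
    · intro j _ hj
      have hj' : j.val ≠ n - 1 := fun h => hj (Fin.ext (by omega))
      split_ifs with hij
      · rw [weightN, if_neg hj', centreN, if_neg hj', sub_neg_eq_add, Set.indicator_of_mem,
          Pi.one_apply]
        exact h.inner i j hij (by have := j.2; omega)
      · rfl
    · simp
  have e2 : ∏ q : Inv (starPerm n (by omega)), weightNw n X τ C α e q.1.1.1 q.1.1.2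
        (B q.1.1.1 q.1.1.2 - centreNw (by omega) α r q.1.1.1 A B) =
      ∏ i : Fin n, if 0 < i.val ∧ i.val < n - 1 then ENNReal.ofReal |B a0 i| ^ (e - 1) else 1 := by
    rw [prod_Inv _ (fun i j => weightNw n X τ C α e i j (B i j - centreNw (by omega) α r i A B)),
      Finset.prod_comm]
    refine Finset.prod_congr rfl fun j _ => ?_
    rw [Finset.prod_eq_single a0]
    · by_cases hj : a0 < j
      · have hj' : a0.val < j.val := hj
        have hjn := j.2
        rw [if_pos hj, if_pos ((starPerm_lt_iff (by omega) hj).mpr (Or.inl hv0)), weightNw,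
          if_pos hv0, centreNw, if_pos hv0, sub_zero]
        by_cases hjL : j.val = n - 1
        · rw [if_pos hjL, if_neg (by omega), show j = aL from Fin.ext (by omega),
            Set.indicator_of_mem, Pi.one_apply]
          rw [ha0, haL]; exact h.right
        · rw [if_neg hjL, if_pos (by omega), Set.indicator_of_mem]
          have := h.row j (by omega) (by omega)
          rw [← ha0, abs_mul] at this
          rw [Set.mem_ofPred_eq, le_div_iff₀ hα', mul_comm]
          exact this
      · have : ¬ a0.val < j.val := hj
        rw [if_neg hj, if_neg (by omega)]
    · intro i _ hi
      have hi' : i.val ≠ 0 := fun h => hi (Fin.ext (by omega))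
      split_ifs with hij hσ
      · have hij' : i.val < j.val := hij
        have hjn := j.2
        have hjL : j = aL := Fin.ext (by
          rcases (starPerm_lt_iff (by omega) hij).mp hσ with h | h <;> omega)
        subst hjL
        rw [weightNw, if_neg hi', centreNw, if_neg hi', sub_neg_eq_add, Set.indicator_of_mem,
          Pi.one_apply]
        have h1 := h.last i (by omega) (by omega)
        rw [← ha0, ← haL] at h1
        rw [Set.mem_ofPred_eq, ← ha0, ← haL]
        convert h1 using 2
        rw [← add_assoc]
        congr 1
        -- The summand `k = i` is the coordinate itself, since `A` has `1` on the diagonal; the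
        -- others belong to the centre.
        have hsplit : ∀ k : Fin n, (if 0 < k.val ∧ k.val < n - 1 then A i k * B k j else 0) =
            (if k = i then B i j else 0) +
              if i.val < k.val ∧ k.val < n - 1 then A i k * B k j else 0 := by
          intro k
          rcases lt_trichotomy i.val k.val with hk | hk | hk
          · have hki : k ≠ i := fun e => by rw [e] at hk; exact lt_irrefl _ hk
            by_cases hk1 : k.val < n - 1
            · rw [if_pos ⟨by omega, hk1⟩, if_neg hki, if_pos ⟨hk, hk1⟩, zero_add]
            · rw [if_neg (fun h => hk1 h.2), if_neg hki, if_neg (fun h => hk1 h.2), zero_add]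
          · have hki : k = i := Fin.ext hk.symm
            subst hki
            rw [if_pos (by omega), if_pos rfl, if_neg (by omega), hA, unipMat_self]; ring
          · have hki : k ≠ i := fun e => by rw [e] at hk; exact lt_irrefl _ hk
            rw [if_neg hki, if_neg (show ¬ (i.val < k.val ∧ k.val < n - 1) by omega), hA,
              unipMat_of_gt u (Fin.lt_def.mpr hk)]
            simp
        rw [Finset.sum_congr rfl fun k _ => hsplit k, Finset.sum_add_distrib]
        simp
      · rfl
      · rfl
    · simp
  rw [e1, e2, ← Finset.prod_mul_distrib]
  refine Finset.one_le_prod' fun i _ => ?_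
  split_ifs with hi
  · have h1 := h.hyperbola i hi.1 hi.2
    rw [← ha0, ← haL, mul_assoc, abs_mul] at h1
    have h2 : |A i aL * B a0 i| ≤ C * (τ / X) / |α| := by
      rw [le_div_iff₀ hα', mul_comm]; exact h1
    have hpos : 0 < C * (τ / X) / |α| := by positivity
    -- If a coordinate vanishes, its weight is infinite. Otherwise the hyperbolic bound `|ab| ≤ R`,
    -- with `R = C(τ/X)/|α|`, gives `1 ≤ R^(1-e) |a|^(e-1) |b|^(e-1)`, which separates the two
    -- variables.
    by_cases hA0 : A i aL = 0
    · have hz : ENNReal.ofReal |A i aL| ^ (e - 1) = ⊤ := by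
        rw [hA0, abs_zero, ENNReal.ofReal_zero, ENNReal.zero_rpow_of_neg (by linarith)]
      have hH0 : H ≠ 0 := by
        rw [hH]
        simp only [ne_eq, ENNReal.rpow_eq_zero_iff, not_or, not_and]
        refine ⟨fun h => absurd h (by simpa using hpos), fun h => absurd h ENNReal.ofReal_ne_top⟩
      have hB0 : ENNReal.ofReal |B a0 i| ^ (e - 1) ≠ 0 := by
        simp only [ne_eq, ENNReal.rpow_eq_zero_iff, not_or, not_and]
        refine ⟨fun _ => by linarith, fun h => absurd h ENNReal.ofReal_ne_top⟩
      rw [hz, ENNReal.mul_top hH0, ENNReal.top_mul hB0]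
      exact le_top
    by_cases hB0 : B a0 i = 0
    · have hz : ENNReal.ofReal |B a0 i| ^ (e - 1) = ⊤ := by
        rw [hB0, abs_zero, ENNReal.ofReal_zero, ENNReal.zero_rpow_of_neg (by linarith)]
      have hH0 : H ≠ 0 := by
        rw [hH]
        simp only [ne_eq, ENNReal.rpow_eq_zero_iff, not_or, not_and]
        refine ⟨fun h => absurd h (by simpa using hpos), fun h => absurd h ENNReal.ofReal_ne_top⟩
      have hA0' : ENNReal.ofReal |A i aL| ^ (e - 1) ≠ 0 := by
        simp only [ne_eq, ENNReal.rpow_eq_zero_iff, not_or, not_and]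
        refine ⟨fun _ => by linarith, fun h => absurd h ENNReal.ofReal_ne_top⟩
      rw [hz, ENNReal.mul_top (mul_ne_zero hH0 hA0')]
      exact le_top
    · have hA' := abs_pos.mpr hA0
      have hB' := abs_pos.mpr hB0
      rw [hH, ENNReal.ofReal_rpow_of_pos hpos, ENNReal.ofReal_rpow_of_pos hA',
        ENNReal.ofReal_rpow_of_pos hB', ← ENNReal.ofReal_mul (by positivity),
        ← ENNReal.ofReal_mul (by positivity), ← ENNReal.ofReal_one]
      apply ENNReal.ofReal_le_ofReal
      rw [mul_assoc, ← Real.mul_rpow hA'.le hB'.le, ← abs_mul, show e - 1 = -(1 - e) by ring,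
        Real.rpow_neg (abs_nonneg _), ← div_eq_mul_inv, one_le_div (by positivity)]
      exact Real.rpow_le_rpow (abs_nonneg _) h2 (by linarith)
  · rw [one_mul]

end Volume

/-! ### Integration of the weights and the resulting volume bound -/

section Volume

open scoped ENNReal

variable {n : ℕ}

/-- The integral of the product of the weights factors. -/
theorem lintegral_weights_le (hn : 2 ≤ n) (X τ C α r e : ℝ) :
    ∫⁻ w : (Pos n → ℝ) × (Inv (starPerm n (by omega)) → ℝ),
      (∏ p : Pos n, weightN n X τ C α e p.1.1 p.1.2
        (unipMat w.1 p.1.1 p.1.2 -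
          centreN (by omega) α r p.1.1 p.1.2 (unipMat w.1) (unipWMat _ w.2))) *
      ∏ q : Inv (starPerm n (by omega)), weightNw n X τ C α e q.1.1.1 q.1.1.2
        (unipWMat _ w.2 q.1.1.1 q.1.1.2 -
          centreNw (by omega) α r q.1.1.1 (unipMat w.1) (unipWMat _ w.2)) ≤
    (∏ p : Pos n, ∫⁻ t, weightN n X τ C α e p.1.1 p.1.2 t) *
      ∏ q : Inv (starPerm n (by omega : 0 < n)), ∫⁻ t, weightNw n X τ C α e q.1.1.1 q.1.1.2 t := by
  set σ := starPerm n (by omega : 0 < n) with hσ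
  have hmp := volume_measurePreserving_sumPiEquivProdPi
    (fun _ : Pos n ⊕ Inv σ => ℝ)
  rw [← hmp.lintegral_comp_emb (MeasurableEquiv.measurableEmbedding _)]
  -- Rank `0` for the last column of `x` and the first row of `y`, whose centres are `0`; rank `1`
  -- for the other entries of `x`. The entries `y_{i,L}` come last, with rank decreasing in `i`,
  -- because their centres involve `y_{k,L}` with `k > i`.
  let rank : Pos n ⊕ Inv σ → ℕ := Sum.elim (fun p => if p.1.2.val = n - 1 then 0 else 1)
    (fun q => if q.1.1.1.val = 0 then 0 else 2 + (n - q.1.1.1.val))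
  let k : Pos n ⊕ Inv σ → ℝ → ℝ≥0∞ := Sum.elim
    (fun p => weightN n X τ C α e p.1.1 p.1.2) (fun q => weightNw n X τ C α e q.1.1.1 q.1.1.2)
  let A : (Pos n ⊕ Inv σ → ℝ) → Matrix (Fin n) (Fin n) ℝ := fun x => unipMat fun p => x (Sum.inl p)
  let B : (Pos n ⊕ Inv σ → ℝ) → Matrix (Fin n) (Fin n) ℝ :=
    fun x => unipWMat σ fun q => x (Sum.inr q)
  let f : Pos n ⊕ Inv σ → (Pos n ⊕ Inv σ → ℝ) → ℝ := Sum.elim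
    (fun p x => centreN (by omega) α r p.1.1 p.1.2 (A x) (B x))
    (fun q x => centreNw (by omega) α r q.1.1.1 (A x) (B x))
  have hAc : ∀ i j, Continuous fun x => A x i j := fun i j =>
    (continuous_unipMat.comp (by fun_prop : Continuous fun (x : Pos n ⊕ Inv σ → ℝ) (p : Pos n) =>
      x (Sum.inl p))).matrix_elem i j
  have hBc : ∀ i j, Continuous fun x => B x i j := fun i j =>
    ((continuous_unipWMat σ).comp (by fun_prop : Continuous fun (x : Pos n ⊕ Inv σ → ℝ)
      (p : Inv σ) => x (Sum.inr p))).matrix_elem i j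
  have hA : ∀ x c t i j, (∀ p : Pos n, p.1 = (i, j) → c ≠ Sum.inl p) →
      A (Function.update x c t) i j = A x i j := by
    intro x c t i j hc
    rcases c with p | q
    · have : (fun p' => Function.update x (Sum.inl p) t (Sum.inl p')) =
          Function.update (fun p' => x (Sum.inl p')) p t := by
        funext p'
        simp [Function.update_apply]
      simp only [A, this]
      exact unipMat_update _ _ _ fun h => hc p h rfl
    · simp [A]
  have hB : ∀ x c t i j, (∀ q : Inv σ, q.1.1 = (i, j) → c ≠ Sum.inr q) →
      B (Function.update x c t) i j = B x i j := by
    intro x c t i j hc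
    rcases c with p | q
    · simp [B]
    · have : (fun q' => Function.update x (Sum.inr q) t (Sum.inr q')) =
          Function.update (fun q' => x (Sum.inr q')) q t := by
        funext p'
        simp [Function.update_apply]
      simp only [B, this]
      exact unipWMat_update _ _ _ fun h => hc q h rfl
  have main := lintegral_prod_sub_le rank k f ?_ ?_ ?_
  · rw [Fintype.prod_sum_type] at main
    refine le_trans (le_of_eq ?_) main
    refine lintegral_congr fun x => ?_
    rw [Fintype.prod_sum_type]
    congr 1
    · refine Finset.prod_congr rfl fun p _ => ?_
      rw [unipMat_of_lt _ p.2]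
      rfl
    · refine Finset.prod_congr rfl fun q _ => ?_
      rw [unipWMat_of_lt _ q.1.2 q.2]
      rfl
  · rintro (p | q)
    · exact measurable_weightN _ _ _ _ _ _ _
    · exact measurable_weightNw _ _ _ _ _ _ _
  · rintro (p | q)
    · simp only [f, Sum.elim_inl, centreN]
      split_ifs
      · fun_prop
      · exact (((hAc _ _).const_mul _).mul (hBc _ _)).neg.measurable
    · simp only [f, Sum.elim_inr, centreNw]
      split_ifs
      · fun_prop
      · refine Continuous.measurable (Continuous.neg (Continuous.add ?_ ?_))
        · refine continuous_finsetSum _ fun k _ => ?_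
          split_ifs
          · exact (hAc _ _).mul (hBc _ _)
          · fun_prop
        · exact ((hAc _ _).const_mul _).mul (hBc _ _)
  · rintro (p | q) c hc x t
    · simp only [f, Sum.elim_inl, centreN]
      split_ifs with h
      · rfl
      · simp only [rank, Sum.elim_inl, h, if_false] at hc
        rw [hA, hB]
        · rintro q hq rfl
          simp [hq] at hc
        · rintro p hp rfl
          simp [hp] at hc
    · simp only [f, Sum.elim_inr, centreNw]
      split_ifs with h
      · rfl
      · simp only [rank, Sum.elim_inr, h, if_false] at hc
        congr 2
        · refine Finset.sum_congr rfl fun l _ => ?_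
          split_ifs with hl
          · rw [hA, hB]
            · rintro q' hq rfl
              have : q'.1.1.1.val = l.val := by rw [hq]
              simp only [Sum.elim_inr, this] at hc
              have := l.2
              split_ifs at hc <;> omega
            · rintro p' hp rfl
              simp only [Sum.elim_inl] at hc
              split_ifs at hc <;> omega
          · rfl
        · rw [hA, hB]
          · rintro q' hq rfl
            simp [hq] at hc
          · rintro p hp rfl
            simp [hp] at hc

/-- The volume of the region that contains the support, up to the loss `X^{e}`. -/
theorem exists_lintegral_starBox_le (hn : 3 < n) {τ C e : ℝ} (hτ : 0 < τ) (hτ1 : τ ≤ 1 / 2)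
    (hC : 0 < C) (he : 0 < e) :
    ∃ K : ℝ, 0 < K ∧ ∀ X α r : ℝ, 1 ≤ X → (X ^ (n + 2))⁻¹ ≤ |α| → |α| * X ≤ 2 * τ →
      ∫⁻ w : (Pos n → ℝ) × (Inv (starPerm n (by omega)) → ℝ),
        Set.indicator {w : (Pos n → ℝ) × (Inv (starPerm n (by omega : 0 < n)) → ℝ) |
          StarBox (by omega : 0 < n) X τ C α r (unipMat w.1) (unipWMat _ w.2)} 1 w ≤
        ENNReal.ofReal (K * X ^ ((n : ℝ) * (n - 1) * (n - 2) / 6 + e) * (|α| * X)⁻¹ ^ n *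
          (X ^ (n - 2))⁻¹) := by
  set N : ℕ := Fintype.card (Pos n) with hN
  have hN0 : 0 < N := Fintype.card_pos_iff.mpr
    ⟨⟨(⟨0, by omega⟩, ⟨1, by omega⟩), Fin.lt_def.mpr (by simp)⟩⟩
  -- Each of the `N` positions is allowed a loss `T = X^(e'(n+2))`, although only the singular
  -- powers need it. The total loss is then at most `X^e`.
  set e' : ℝ := min (1 / 2) (e / (N * (n + 2))) with he'
  have he'0 : 0 < e' := by positivity
  have he'1 : e' < 1 := (min_le_left _ _).trans_lt (by norm_num)
  have he'N : e' * (n + 2) * N ≤ e := by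
    calc e' * (n + 2) * N ≤ e / (N * (n + 2)) * (n + 2) * N := by
          gcongr; exact min_le_right _ _
      _ = e := by field_simp
  set K₀ : ℝ := 1 + (4 * C * τ) ^ 2 + (8 * τ / e') * (C * τ + 1) + 4 * τ with hK₀
  have hK₀1 : 1 ≤ K₀ := by
    have : 0 ≤ (8 * τ / e') * (C * τ + 1) := by positivity
    nlinarith [sq_nonneg (4 * C * τ)]
  refine ⟨K₀ ^ N, by positivity, fun X α r hX hα hαX => ?_⟩
  have hX0 : 0 < X := by linarith
  have hα0 : 0 < |α| := lt_of_lt_of_le (by positivity) hα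
  have hαne : α ≠ 0 := abs_pos.mp hα0
  set b : ℝ := (|α| * X)⁻¹ with hb
  have hb1 : 1 ≤ b := by
    rw [hb]
    exact (one_le_inv₀ (by positivity)).mpr (by linarith)
  have hR0 : 0 ≤ 2 * τ / |α| := by positivity
  set T : ℝ := X ^ (e' * (n + 2)) with hT
  have hT1 : 1 ≤ T := Real.one_le_rpow hX (by positivity)
  have hRT : (2 * τ / |α|) ^ e' ≤ T := by
    have h1 : 2 * τ / |α| ≤ X ^ ((n : ℝ) + 2) := by
      have h2 : |α|⁻¹ ≤ X ^ (n + 2) := by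
        rw [← inv_inv (X ^ (n + 2))]
        exact inv_anti₀ (by positivity) hα
      have h3 : X ^ ((n : ℝ) + 2) = X ^ (n + 2) := by
        rw [← Real.rpow_natCast]; push_cast; rfl
      rw [h3, div_eq_mul_inv]
      calc 2 * τ * |α|⁻¹ ≤ 1 * X ^ (n + 2) := by gcongr; linarith
        _ = _ := one_mul _
    calc (2 * τ / |α|) ^ e' ≤ (X ^ ((n : ℝ) + 2)) ^ e' := by gcongr
      _ = T := by rw [← Real.rpow_mul hX0.le, mul_comm]
  have hpow : ∫⁻ t : ℝ, Set.indicator {t : ℝ | |t| ≤ 2 * τ / |α|}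
      (fun t => ENNReal.ofReal |t| ^ (e' - 1)) t ≤ ENNReal.ofReal (2 * T / e') := by
    refine (lintegral_indicator_enn_rpow_le hR0 he'0).trans (ENNReal.ofReal_le_ofReal ?_)
    gcongr
  have hend : ∫⁻ t : ℝ, Set.indicator {t : ℝ | |(|α * t| - 1)| ≤ C * (τ / X)} 1 t ≤
      ENNReal.ofReal (4 * C * τ * b) := by
    refine (lintegral_indicator_abs_sub_one_le hαne _).trans (le_of_eq ?_)
    congr 1
    rw [hb]; field_simp
  -- The exponent `1 - e'` is replaced by `1`, after the base has been enlarged to be at least `1`;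
  -- this uses `b ≥ 1`.
  have hHyp : ENNReal.ofReal (C * (τ / X) / |α|) ^ (1 - e') ≤
      ENNReal.ofReal ((C * τ + 1) * b) := by
    have hpos : 0 < C * (τ / X) / |α| := by positivity
    rw [ENNReal.ofReal_rpow_of_pos hpos]
    apply ENNReal.ofReal_le_ofReal
    have h1 : C * (τ / X) / |α| ≤ (C * τ + 1) * b := by
      have : C * (τ / X) / |α| = C * τ * b := by rw [hb]; field_simp
      rw [this]; nlinarith
    have h2 : 1 ≤ (C * τ + 1) * b := by
      have : 0 < C * τ := by positivity
      nlinarith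
    calc _ ≤ ((C * τ + 1) * b) ^ (1 - e') := Real.rpow_le_rpow hpos.le h1 (by linarith)
      _ ≤ ((C * τ + 1) * b) ^ (1 : ℝ) := Real.rpow_le_rpow_of_exponent_le h2 (by linarith)
      _ = _ := Real.rpow_one _
  -- The bound for the `N` and `N_w` weights at one position together. Every position yields
  -- `X^(j-i-1)`, except that the corner has no such factor, and each position of the last column
  -- yields `b`, the corner twice.
  let val : Fin n → Fin n → ℝ := fun i j => (K₀ * T) * X ^ ((j.val : ℝ) - i.val - 1) *
    (if j.val = n - 1 then b else 1) *
    (if i.val = 0 ∧ j.val = n - 1 then b * (X ^ (n - 2))⁻¹ else 1)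
  have hvalpos : ∀ i j, 0 ≤ val i j := by
    intro i j
    simp only [val]
    have : 0 ≤ b := by linarith
    split_ifs <;> positivity
  have hpair : ∀ i j : Fin n, i < j → (∫⁻ t, weightN n X τ C α e' i j t) *
      (if starPerm n (by omega : 0 < n) j < starPerm n (by omega) i then
        ∫⁻ t, weightNw n X τ C α e' i j t else 1) ≤ ENNReal.ofReal (val i j) := by
    intro i j hij
    have hij' : i.val < j.val := hij
    have hjn := j.2
    have hk1 : 4 * τ ≤ K₀ := by
      have : 0 ≤ (8 * τ / e') * (C * τ + 1) := by positivity
      rw [hK₀]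
      nlinarith [sq_nonneg (4 * C * τ)]
    have hk2 : (8 * τ / e') * (C * τ + 1) ≤ K₀ := by
      rw [hK₀]
      nlinarith [sq_nonneg (4 * C * τ)]
    have hk3 : (4 * C * τ) ^ 2 ≤ K₀ := by
      have : 0 ≤ (8 * τ / e') * (C * τ + 1) := by positivity
      rw [hK₀]
      linarith
    have hk4 : 8 * τ / e' ≤ K₀ := by
      refine le_trans ?_ hk2
      have h1 : 0 ≤ 8 * τ / e' := by positivity
      have h2 : 0 < C * τ := by positivity
      nlinarith
    have hbox : ∫⁻ t : ℝ, Set.indicator {t : ℝ | |t| ≤ 2 * τ * X ^ ((j.val : ℤ) - i.val - 1)} 1 t ≤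
        ENNReal.ofReal (4 * τ * X ^ ((j.val : ℝ) - i.val - 1)) := by
      rw [lintegral_indicator_abs_le]
      apply le_of_eq
      congr 1
      rw [← Real.rpow_intCast]
      push_cast
      ring
    have hXpos : 0 < X ^ ((j.val : ℝ) - i.val - 1) := Real.rpow_pos_of_pos hX0 _
    by_cases hjL : j.val = n - 1
    · rw [if_pos ((starPerm_lt_iff (by omega) hij).mpr (Or.inr hjL))]
      by_cases hi0 : i.val = 0
      · simp only [weightN, weightNw, hjL, hi0, if_true, val, and_self]
        refine (mul_le_mul' hend hend).trans ?_
        rw [← ENNReal.ofReal_mul (by positivity)]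
        apply ENNReal.ofReal_le_ofReal
        have h1 : X ^ (((n - 1 : ℕ) : ℝ) - ((0 : ℕ) : ℝ) - 1) = X ^ (n - 2) := by
          rw [← Real.rpow_natCast]
          congr 1
          rw [Nat.cast_sub (by omega), Nat.cast_sub (by omega)]
          push_cast; ring
        rw [h1]
        calc 4 * C * τ * b * (4 * C * τ * b) = (4 * C * τ) ^ 2 * 1 * b * b := by ring
          _ ≤ K₀ * T * b * b := by gcongr
          _ = _ := by field_simp
      · simp only [weightN, weightNw, hjL, hi0, if_true, if_false, val, false_and, mul_one]
        rw [lintegral_const_mul' _ _ (ne_of_lt (lt_of_le_of_lt hHyp ENNReal.ofReal_lt_top))]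
        have hlast : ∫⁻ t : ℝ, Set.indicator
            {t : ℝ | |t| ≤ 2 * τ * X ^ ((n : ℤ) - 1 - i.val - 1)} 1 t ≤
            ENNReal.ofReal (4 * τ * X ^ ((j.val : ℝ) - i.val - 1)) := by
          refine le_trans (le_of_eq ?_) hbox
          rw [hjL, Nat.cast_sub (by omega)]
          rfl
        refine (mul_le_mul' (mul_le_mul' hHyp hpow) hlast).trans ?_
        rw [← ENNReal.ofReal_mul (by positivity), ← ENNReal.ofReal_mul (by positivity), ← hjL]
        apply ENNReal.ofReal_le_ofReal
        calc _ = (8 * τ / e') * (C * τ + 1) * T * X ^ ((j.val : ℝ) - i.val - 1) * b := by ring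
          _ ≤ _ := by gcongr
    · by_cases hi0 : i.val = 0
      · rw [if_pos ((starPerm_lt_iff (by omega) hij).mpr (Or.inl hi0))]
        simp only [weightN, weightNw, hjL, if_false, val, and_false, mul_one]
        rw [if_pos hi0]
        refine (mul_le_mul' hbox hpow).trans ?_
        rw [← ENNReal.ofReal_mul (by positivity)]
        apply ENNReal.ofReal_le_ofReal
        calc _ = (8 * τ / e') * T * X ^ ((j.val : ℝ) - i.val - 1) := by ring
          _ ≤ _ := by gcongr
      · rw [if_neg (fun h => by
          rcases (starPerm_lt_iff (by omega) hij).mp h with h | h <;> contradiction), mul_one]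
        simp only [weightN, hjL, if_false, val, and_false, mul_one]
        refine hbox.trans (ENNReal.ofReal_le_ofReal ?_)
        calc _ ≤ K₀ * 1 * X ^ ((j.val : ℝ) - i.val - 1) := by rw [mul_one]; gcongr
          _ ≤ _ := by gcongr
  refine le_trans (lintegral_mono (g := fun w => _) fun w => Set.indicator_apply_le (fun hw =>
    StarBox.one_le_prod (by omega) hX0 hτ hC hαne he'1 hw)) ?_
  calc _ ≤ ∫⁻ w : (Pos n → ℝ) × (Inv (starPerm n (by omega)) → ℝ),
      (∏ p : Pos n, weightN n X τ C α e' p.1.1 p.1.2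
        (unipMat w.1 p.1.1 p.1.2 -
          centreN (by omega) α r p.1.1 p.1.2 (unipMat w.1) (unipWMat _ w.2))) *
      ∏ q : Inv (starPerm n (by omega)), weightNw n X τ C α e' q.1.1.1 q.1.1.2
        (unipWMat _ w.2 q.1.1.1 q.1.1.2 -
          centreNw (by omega) α r q.1.1.1 (unipMat w.1) (unipWMat _ w.2)) := by
        exact le_rfl
    _ ≤ _ := lintegral_weights_le (by omega) X τ C α r e'
    _ ≤ ∏ p : Pos n, ENNReal.ofReal (val p.1.1 p.1.2) := by
        rw [prod_Pos (fun i j => ∫⁻ t, weightN n X τ C α e' i j t),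
          prod_Inv _ (fun i j => ∫⁻ t, weightNw n X τ C α e' i j t),
          prod_Pos (fun i j => ENNReal.ofReal (val i j)), ← Finset.prod_mul_distrib]
        refine Finset.prod_le_prod' fun i _ => ?_
        rw [← Finset.prod_mul_distrib]
        refine Finset.prod_le_prod' fun j _ => ?_
        split_ifs with h1 h2
        · have := hpair i j h1; rwa [if_pos h2] at this
        · have := hpair i j h1; rwa [if_neg h2] at this
        · rw [one_mul]
    _ = ENNReal.ofReal (∏ p : Pos n, val p.1.1 p.1.2) :=
        (ENNReal.ofReal_prod_of_nonneg fun p _ => hvalpos _ _).symm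
    _ ≤ _ := by
        apply ENNReal.ofReal_le_ofReal
        simp only [val]
        rw [Finset.prod_mul_distrib, Finset.prod_mul_distrib, Finset.prod_mul_distrib,
          Finset.prod_const, Finset.card_univ, ← hN]
        have p1 : ∏ p : Pos n, X ^ ((p.1.2.val : ℝ) - p.1.1.val - 1) =
            X ^ ((n : ℝ) * (n - 1) * (n - 2) / 6) := by
          rw [← sum_pos_sub, Real.rpow_sum_of_pos hX0]
        -- The last column has `n - 1` positions above the diagonal; with the second factor `b` at
        -- the corner the exponent becomes `n`.
        have p2 : ∏ p : Pos n, (if p.1.2.val = n - 1 then b else 1) = b ^ (n - 1) := by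
          rw [prod_Pos (fun _ j => if j.val = n - 1 then b else 1), Finset.prod_comm,
            Finset.prod_eq_single ⟨n - 1, by omega⟩]
          · simp only [if_true]
            rw [← Finset.prod_filter, Finset.prod_const, Finset.filter_gt_eq_Iio, Fin.card_Iio]
          · intro j _ hj
            refine Finset.prod_eq_one fun i _ => ?_
            rw [if_neg (fun h => hj (Fin.ext h))]
            simp
          · simp
        have p3 : ∏ p : Pos n, (if p.1.1.val = 0 ∧ p.1.2.val = n - 1 then
            b * (X ^ (n - 2))⁻¹ else 1) = b * (X ^ (n - 2))⁻¹ := by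
          rw [Finset.prod_eq_single ⟨(⟨0, by omega⟩, ⟨n - 1, by omega⟩), Fin.lt_def.mpr (by
            simp; omega)⟩]
          · simp
          · intro p _ hp
            rw [if_neg]
            rintro ⟨h1, h2⟩
            exact hp (Subtype.ext (Prod.ext (Fin.ext h1) (Fin.ext h2)))
          · simp
        rw [p1, p2, p3, mul_pow]
        have p4 : T ^ N ≤ X ^ e := by
          rw [hT, ← Real.rpow_natCast, ← Real.rpow_mul hX0.le]
          exact Real.rpow_le_rpow_of_exponent_le hX he'N
        rw [Real.rpow_add hX0]
        calc _ ≤ K₀ ^ N * X ^ e * X ^ ((n : ℝ) * (n - 1) * (n - 2) / 6) * b ^ (n - 1) *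
              (b * (X ^ (n - 2))⁻¹) := by
              have : 0 ≤ b := by linarith
              gcongr
          _ = K₀ ^ N * (X ^ ((n : ℝ) * (n - 1) * (n - 2) / 6) * X ^ e) * (b ^ (n - 1) * b) *
              (X ^ (n - 2))⁻¹ := by ring
          _ = _ := by rw [← pow_succ, show n - 1 + 1 = n by omega]

end Volume

/-! ### Test functions and orbital integrals -/

section TestFunction

open scoped ENNReal

variable {n : ℕ} {F : G n → ℂ}

section

attribute [local instance] Matrix.normedAddCommGroup Matrix.normedSpace

open Classical in
-- Smoothness is formulated in the matrix entries, so continuity of the matrix alone suffices and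
-- nothing has to be checked for the inverse.
theorem IsSmooth.continuous_comp (hF : IsSmooth F) {Y : Type*} [TopologicalSpace Y] {φ : Y → G n}
    (hφ : Continuous fun y => (φ y).val) : Continuous fun y => F (φ y) := by
  have h1 : ContinuousOn (fun A : Matrix (Fin n) (Fin n) ℝ =>
      if h : A.det ≠ 0 then F (Matrix.GeneralLinearGroup.mkOfDetNeZero A h) else 0)
      {A | A.det ≠ 0} := ContDiffOn.continuousOn hF
  have hdet : ∀ g : G n, g.val.det ≠ 0 := fun g => (Matrix.isUnit_iff_isUnit_det _).mp g.isUnit |>.ne_zero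
  have h2 := h1.comp_continuous hφ fun y => hdet (φ y)
  convert h2 using 2 with y
  rw [Function.comp_apply, dif_pos (hdet (φ y))]
  congr 1
  exact Units.ext rfl

end

theorem IsSmooth.continuous (hF : IsSmooth F) : Continuous F :=
  hF.continuous_comp (φ := id) Units.continuous_val

/-- The real supremum is meaningful only for a bounded function. In the case of `Z \ G`, invariance
under the centre reduces boundedness to the compact set `C`. -/
theorem IsTestFunction.norm_le (hF : IsTestFunction F) (g : G n) : ‖F g‖ ≤ supNorm F := by
  have hcont := hF.1.continuous
  refine le_ciSup (f := fun g => ‖F g‖) ?_ g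
  rcases hF.2 with h | ⟨hz, C, hC, hsupp⟩
  · obtain ⟨B, hB⟩ := h.exists_bound_of_continuous hcont
    exact ⟨B, by rintro _ ⟨g, rfl⟩; exact hB g⟩
  · obtain ⟨B, hB⟩ := hC.exists_bound_of_continuousOn hcont.continuousOn
    refine ⟨max B 0, ?_⟩
    rintro _ ⟨g, rfl⟩
    by_cases h : F g = 0
    · simp [h]
    · obtain ⟨z, k, hk, rfl⟩ := hsupp g h
      simp only [hz]
      exact (hB k hk).trans (le_max_left _ _)

theorem supNorm_nonneg (hF : IsTestFunction F) : 0 ≤ supNorm F :=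
  (norm_nonneg _).trans (hF.norm_le 1)

theorem continuous_orbital_integrand (hF : IsSmooth F) (σ : Equiv.Perm (Fin n)) (g : G n) :
    Continuous fun p : (Pos n → ℝ) × (Inv σ → ℝ) => F (unip p.1 * (g * unipW σ p.2)) := by
  refine hF.continuous_comp ?_
  have h1 : Continuous fun p : (Pos n → ℝ) × (Inv σ → ℝ) =>
      unipMat p.1 * (g.val * unipWMat σ p.2) :=
    (continuous_unipMat.comp continuous_fst).matrix_mul
      (continuous_const.matrix_mul ((continuous_unipWMat σ).comp continuous_snd))
  exact h1

/-- The set `S` need not be measurable: only monotonicity of the integral and extraction of a finite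
constant are used. -/
theorem lintegral_integrand_le (hF : IsTestFunction F) (σ : Equiv.Perm (Fin n)) (g : G n)
    {S : Set ((Pos n → ℝ) × (Inv σ → ℝ))}
    (hS : ∀ p, F (unip p.1 * (g * unipW σ p.2)) ≠ 0 → p ∈ S) :
    ∫⁻ p : (Pos n → ℝ) × (Inv σ → ℝ), ‖F (unip p.1 * (g * unipW σ p.2))‖ₑ ≤
      ENNReal.ofReal (supNorm F) * ∫⁻ p, S.indicator (fun _ => (1 : ℝ≥0∞)) p := by
  rw [← lintegral_const_mul' _ _ ENNReal.ofReal_ne_top]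
  refine lintegral_mono fun p => ?_
  by_cases h : F (unip p.1 * (g * unipW σ p.2)) = 0
  · simp [h]
  · rw [Set.indicator_of_mem (hS p h), mul_one, ← ofReal_norm]
    exact ENNReal.ofReal_le_ofReal (hF.norm_le _)

theorem orbitalConverges_of_support (hF : IsTestFunction F) (σ : Equiv.Perm (Fin n)) (g : G n)
    {S : Set ((Pos n → ℝ) × (Inv σ → ℝ))}
    (hS : ∀ p, F (unip p.1 * (g * unipW σ p.2)) ≠ 0 → p ∈ S)
    (hvol : ∫⁻ p, S.indicator (fun _ => (1 : ℝ≥0∞)) p < ⊤) : OrbitalConverges σ F g := by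
  refine ⟨(continuous_orbital_integrand hF.1 σ g).aestronglyMeasurable, ?_⟩
  exact (lintegral_integrand_le hF σ g hS).trans_lt (ENNReal.mul_lt_top ENNReal.ofReal_lt_top hvol)

theorem enorm_mul_conj_psi (a : ℂ) (x : G n) : ‖a * (starRingEnd ℂ) (psi x)‖ₑ = ‖a‖ₑ := by
  rw [enorm_mul, ← ofReal_norm ((starRingEnd ℂ) (psi x)), RCLike.norm_conj, norm_psi,
    ENNReal.ofReal_one, mul_one]

theorem norm_orbital_le (hF : IsTestFunction F) (σ : Equiv.Perm (Fin n)) (g : G n)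
    {S : Set ((Pos n → ℝ) × (Inv σ → ℝ))}
    (hS : ∀ p, F (unip p.1 * (g * unipW σ p.2)) ≠ 0 → p ∈ S) {V : ℝ} (hV : 0 ≤ V)
    (hvol : ∫⁻ p, S.indicator (fun _ => (1 : ℝ≥0∞)) p ≤ ENNReal.ofReal V) :
    ‖orbital σ F g‖ ≤ supNorm F * V := by
  have h1 : ‖orbital σ F g‖ₑ ≤
      ∫⁻ p : (Pos n → ℝ) × (Inv σ → ℝ), ‖F (unip p.1 * (g * unipW σ p.2))‖ₑ := by
    have hm := (continuous_orbital_integrand hF.1 σ g).enorm.measurable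
    rw [Measure.volume_eq_prod, lintegral_prod_symm _ hm.aemeasurable]
    refine (enorm_integral_le_lintegral_enorm _).trans (lintegral_mono fun v => ?_)
    rw [enorm_mul_conj_psi]
    refine (enorm_integral_le_lintegral_enorm _).trans (lintegral_mono fun u => ?_)
    rw [enorm_mul_conj_psi]
  have h2 := h1.trans ((lintegral_integrand_le hF σ g hS).trans (mul_le_mul_right hvol _))
  rw [← ENNReal.ofReal_mul (supNorm_nonneg hF), ← ofReal_norm] at h2
  exact (ENNReal.ofReal_le_ofReal_iff (mul_nonneg (supNorm_nonneg hF) hV)).mp h2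

theorem orbital_eq_zero (σ : Equiv.Perm (Fin n)) (g : G n)
    (h : ∀ u v, F (unip u * (g * unipW σ v)) = 0) : orbital σ F g = 0 := by
  simp [orbital, whittaker, h]

end TestFunction

/-! ### The cell of the identity -/

section Identity

variable {n : ℕ}

instance : IsEmpty (Inv (1 : Equiv.Perm (Fin n))) :=
  ⟨fun q => lt_asymm q.1.2 q.2⟩

open scoped ENNReal in
theorem lintegral_box_one (X τ : ℝ) (hX : 0 < X) (hτ : 0 < τ) :
    ∫⁻ w : (Pos n → ℝ) × (Inv (1 : Equiv.Perm (Fin n)) → ℝ),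
      Set.indicator {w : (Pos n → ℝ) × (Inv (1 : Equiv.Perm (Fin n)) → ℝ) |
        ∀ p : Pos n, |w.1 p| ≤ 2 * τ * X ^ ((p.1.2.val : ℤ) - p.1.1.val - 1)} 1 w ≤
      ENNReal.ofReal ((4 * τ) ^ Fintype.card (Pos n) * X ^ ((n : ℝ) * (n - 1) * (n - 2) / 6)) := by
  set B : Set (Pos n → ℝ) :=
    Set.pi Set.univ fun p => Set.Icc (-(2 * τ * X ^ ((p.1.2.val : ℤ) - p.1.1.val - 1)))
      (2 * τ * X ^ ((p.1.2.val : ℤ) - p.1.1.val - 1)) with hB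
  have hset : {w : (Pos n → ℝ) × (Inv (1 : Equiv.Perm (Fin n)) → ℝ) |
        ∀ p : Pos n, |w.1 p| ≤ 2 * τ * X ^ ((p.1.2.val : ℤ) - p.1.1.val - 1)} =
      B ×ˢ Set.univ := by
    ext w
    rw [Set.mem_prod, hB, Set.mem_univ_pi]
    simp only [Set.mem_univ, and_true, Set.mem_Icc, ← abs_le]
    rfl
  have hBm : MeasurableSet B := MeasurableSet.univ_pi fun _ => measurableSet_Icc
  rw [hset, lintegral_indicator_one (hBm.prod MeasurableSet.univ), Measure.volume_eq_prod,
    Measure.prod_prod, hB, volume_pi, Measure.pi_pi, volume_pi, Measure.pi_univ]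
  simp only [Real.volume_Icc, Finset.univ_eq_empty, Finset.prod_empty, mul_one]
  rw [← ENNReal.ofReal_prod_of_nonneg fun p _ => by
    have : 0 < X ^ ((p.1.2.val : ℤ) - p.1.1.val - 1) := zpow_pos hX _
    nlinarith]
  apply ENNReal.ofReal_le_ofReal
  apply le_of_eq
  have h1 : ∀ p : Pos n, 2 * τ * X ^ ((p.1.2.val : ℤ) - p.1.1.val - 1) -
      -(2 * τ * X ^ ((p.1.2.val : ℤ) - p.1.1.val - 1)) =
      (4 * τ) * X ^ ((p.1.2.val : ℝ) - p.1.1.val - 1) := by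
    intro p
    rw [← Real.rpow_intCast]
    push_cast
    ring
  rw [Finset.prod_congr rfl fun p _ => h1 p, Finset.prod_mul_distrib, Finset.prod_const,
    Finset.card_univ, ← sum_pos_sub, Real.rpow_sum_of_pos hX]

theorem one_represents : ∀ i j : Fin n, (1 : G n).val i j =
    if i = (1 : Equiv.Perm (Fin n)) j then (((1 : ℤˣ) : ℤ) : ℝ) else 0 := by
  intro i j
  simp [Matrix.one_apply]

/-- Here `N_w` is trivial and the product is `u` times a diagonal matrix. The quotient of an entry
by the diagonal entry of its column depends neither on `z` nor on the modulus, and that diagonal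
entry of `h` is at least `1/2`. -/
theorem abs_le_of_support_one {X τ : ℝ} (hX : 1 ≤ X) (hτ1 : τ ≤ 1 / 2) {m : ℕ+}
    {c : Modulus n} {u : Pos n → ℝ} {v : Inv (1 : Equiv.Perm (Fin n)) → ℝ} {z : ℝˣ} {h : G n}
    (hh : h ∈ KSharp n X τ)
    (heq : unip u * (orbitPoint (mVec n m) c 1 * unipW 1 v) = central n z * h) (p : Pos n) :
    |u p| ≤ 2 * τ * X ^ ((p.1.2.val : ℤ) - p.1.1.val - 1) := by
  have hX0 : 0 < X := by linarith
  have hnear := NearOne.of_mem_KSharp hX0 hh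
  have hτ0 : 0 ≤ τ := by
    have := (abs_nonneg _).trans (hnear.diag p.1.1)
    by_contra hc
    push Not at hc
    exact absurd this (not_le.mpr (div_neg_of_neg_of_pos hc hX0))
  have hu1 : unipW (1 : Equiv.Perm (Fin n)) v = 1 := by
    apply Units.ext
    ext i j
    rw [unipW_val]
    rcases lt_trichotomy i j with hij | hij | hij
    · simp [unipWMat, unipMat, hij, hij.ne, not_lt.mpr hij.le]
    · subst hij; simp [unipWMat, unipMat]
    · simp [unipWMat, unipMat, not_lt.mpr hij.le, hij.ne']
  rw [hu1, mul_one] at heq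
  obtain ⟨γ, hγ⟩ : ∃ γ : Fin n → ℝ, ∀ i j, (orbitPoint (mVec n m) c 1).val i j =
      if i = j then γ j else 0 := by
    refine ⟨fun j => (orbitPoint (mVec n m) c 1).val j j, fun i j => ?_⟩
    split_ifs with hij
    · rw [hij]
    · rw [orbitPoint_apply (s := fun _ => 1) one_represents, if_neg (by simpa using hij)]
  have hE : ∀ i j, z * h.val i j = (unip u).val i j * γ j := by
    intro i j
    rw [← central_mul_apply, ← heq, Units.val_mul, Matrix.mul_apply, Finset.sum_eq_single j]
    · rw [hγ, if_pos rfl]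
    · intro k _ hk
      rw [hγ, if_neg hk, mul_zero]
    · simp
  have h1 := hE p.1.1 p.1.2
  have h2 := hE p.1.2 p.1.2
  rw [(unip_mem u).1, one_mul] at h2
  rw [unip_val, unipMat_of_lt u p.2, ← h2] at h1
  have hz : (z : ℝ) ≠ 0 := Units.ne_zero z
  have h3 : h.val p.1.1 p.1.2 = u p * h.val p.1.2 p.1.2 := by
    apply mul_left_cancel₀ hz
    rw [h1]; ring
  have h4 := hnear.offDiag p.2.ne
  have h5 := abs_le.mp (hnear.diag p.1.2)
  have h6 : τ / X ≤ 1 / 2 := (div_le_self hτ0 hX).trans hτ1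
  have h7 : 1 / 2 ≤ |h.val p.1.2 p.1.2| := by
    rw [abs_of_nonneg] <;> linarith
  rw [h3, abs_mul] at h4
  nlinarith [abs_nonneg (u p)]

end Identity

/-! ### Kloosterman sums -/

section Integral

variable {n : ℕ}

/-- The integers in `ℝ`. -/
def intR : Subring ℝ := (Int.castRingHom ℝ).range

theorem mem_intR {z : ℝ} : z ∈ intR ↔ ∃ k : ℤ, (k : ℝ) = z := Iff.rfl

theorem apply_mem_intR {γ : G n} (h : γ ∈ Gam n) (i j : Fin n) : γ.val i j ∈ intR := by
  obtain ⟨A, rfl⟩ := h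
  exact ⟨A.val i j, rfl⟩

theorem det_mem_intR {A : Matrix (Fin n) (Fin n) ℝ} (h : ∀ i j, A i j ∈ intR) : A.det ∈ intR := by
  rw [Matrix.det_apply']
  refine sum_mem fun σ _ => mul_mem ?_ (prod_mem fun i _ => h _ _)
  exact ⟨_, rfl⟩

theorem mem_Gam_of_mem_N {γ : G n} (hN : γ ∈ N n) (h : ∀ i j, γ.val i j ∈ intR) : γ ∈ Gam n := by
  choose A hA using fun i j => mem_intR.mp (h i j)
  have hmap : (Matrix.of A).map (Int.castRingHom ℝ) = γ.val := by
    ext i j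
    exact hA i j
  have hdet : (Matrix.of A).det = 1 := by
    have h1 : (((Matrix.of A).det : ℤ) : ℝ) = 1 := by
      rw [← det_of_mem_N hN, ← hmap]
      exact (Int.castRingHom ℝ).map_det _
    exact_mod_cast h1
  refine ⟨Matrix.GeneralLinearGroup.mk'' (Matrix.of A) (by rw [hdet]; exact isUnit_one), ?_⟩
  exact Units.ext hmap

theorem cellSetoid_iff {w : G n} {c : Modulus n} {γ γ' : Cell w c} :
    cellSetoid w c γ γ' ↔ ∃ a, (a ∈ N n ∧ a ∈ Gam n) ∧ ∃ b, (b ∈ Nw w ∧ b ∈ Gam n) ∧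
      γ'.1 = a * γ.1 * b := by
  have h1 : N n ∩ (Gam n : Set (G n)) = ((NSub n ⊓ Gam n : Subgroup (G n)) : Set (G n)) := rfl
  have h2 : Nw w ∩ (Gam n : Set (G n)) = ((NwSub w ⊓ Gam n : Subgroup (G n)) : Set (G n)) := by
    rw [Subgroup.coe_inf, coe_NwSub]
  rw [cellSetoid, h1, h2]
  refine (Iff.trans (DoubleCoset.rel_iff (x := γ.1) (y := γ'.1)) ?_)
  simp only [← SetLike.mem_coe, ← h1, ← h2]
  rfl

/-- Two elements of a cell lie in the same double coset if their components in `N_w` differ by an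
integral matrix. -/
theorem cellSetoid_of_mem {w : G n} {c : Modulus n} {γ γ' : Cell w c} {x x' y y' : G n}
    (hx : x ∈ N n) (hx' : x' ∈ N n) (h : γ.1 = x * cStar c * w * y)
    (h' : γ'.1 = x' * cStar c * w * y') (hy : y⁻¹ * y' ∈ Nw w) (hyΓ : y⁻¹ * y' ∈ Gam n) :
    cellSetoid w c γ γ' := by
  rw [cellSetoid_iff]
  -- The left hand side is integral, so integrality of the `N` part comes for free.
  have e : γ'.1 * (y⁻¹ * y')⁻¹ * γ.1⁻¹ = x' * x⁻¹ := by rw [h, h']; group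
  refine ⟨x' * x⁻¹, ⟨(NSub n).mul_mem hx' ((NSub n).inv_mem hx), ?_⟩, y⁻¹ * y', ⟨hy, hyΓ⟩, ?_⟩
  · rw [← e]
    exact (Gam n).mul_mem ((Gam n).mul_mem γ'.2.1 ((Gam n).inv_mem hyΓ)) ((Gam n).inv_mem γ.2.1)
  · rw [h, h']; group

theorem norm_kloostermanTerm (m m' : Fin (n - 1) → ℕ+) (w : G n) (c : Modulus n)
    (γ : Cell w c) : ‖kloostermanTerm m m' w c γ‖ = 1 := by
  unfold kloostermanTerm
  rw [norm_mul, norm_psi, norm_psi, one_mul]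

/-- All terms have absolute value `1`, so a count of double cosets suffices; the coding `f` also
proves that there are finitely many. -/
theorem norm_kloosterman_le {m m' : Fin (n - 1) → ℕ+} {w : G n} {c : Modulus n} {α : Type*}
    {f : Quotient (cellSetoid w c) → α} (hf : f.Injective) {S : Finset α} (hS : ∀ q, f q ∈ S) :
    ‖kloosterman m m' w c‖ ≤ S.card := by
  unfold kloosterman
  split_ifs
  · let e : Quotient (cellSetoid w c) → S := fun q => ⟨f q, hS q⟩
    have he : e.Injective := fun a b hab => hf (congrArg Subtype.val hab)
    have : Finite (Quotient (cellSetoid w c)) := Finite.of_injective e he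
    have := Fintype.ofFinite (Quotient (cellSetoid w c))
    rw [finsum_eq_sum_of_fintype]
    refine (norm_sum_le _ _).trans ?_
    simp only [norm_kloostermanTerm, Finset.sum_const, nsmul_eq_mul, mul_one]
    have := Fintype.card_le_of_injective e he
    rw [Fintype.card_coe] at this
    exact_mod_cast this
  · simp

end Integral

/-! ### Kloosterman sums in the cell of the identity -/

section IdentityCell

variable {n : ℕ}

theorem eq_one_of_mem_Nw_one {y : G n} (hy : y ∈ Nw (1 : G n)) : y = 1 := by
  obtain ⟨h1, h2⟩ := hy
  rw [one_mul, inv_one, mul_one] at h2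
  apply Units.ext
  ext i j
  rcases lt_trichotomy i j with h | h | h
  · rw [h2.2 _ _ h]; simp [h.ne]
  · subst h; rw [h1.1]; simp
  · rw [h1.2 _ _ h]; simp [h.ne']

theorem norm_kloosterman_one_le (m m' : Fin (n - 1) → ℕ+) (c : Modulus n) :
    ‖kloosterman m m' 1 c‖ ≤ 1 := by
  have h1 : (fun _ : Quotient (cellSetoid (1 : G n) c) => ()).Injective := by
    intro q q' _
    induction q using Quotient.inductionOn with | _ γ
    induction q' using Quotient.inductionOn with | _ γ'
    apply Quotient.sound
    obtain ⟨x, hx, y, hy, h⟩ := γ.2.2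
    obtain ⟨x', hx', y', hy', h'⟩ := γ'.2.2
    have hy1 := eq_one_of_mem_Nw_one hy
    have hy1' := eq_one_of_mem_Nw_one hy'
    subst hy1 hy1'
    refine cellSetoid_of_mem hx hx' h h' ?_ ?_
    · rw [inv_one, mul_one]; exact hy
    · rw [inv_one, mul_one]; exact (Gam n).one_mem
  simpa using norm_kloosterman_le (m := m) (m' := m') h1 (S := {()}) (by simp)

/-- A nonzero sum provides an integral matrix `x c*`, whose diagonal entries `c_{k+1}/c_k` are
nonzero integers. Hence `|c_k|` increases weakly up to `c_n = 1`. -/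
theorem abs_cExt_of_kloosterman_one_ne_zero {m m' : Fin (n - 1) → ℕ+} {c : Modulus n}
    (h : kloosterman m m' 1 c ≠ 0) {k : ℕ} (hk : k ≤ n) : |(cExt c k : ℝ)| = 1 := by
  have hne : Nonempty (Quotient (cellSetoid (1 : G n) c)) := by
    by_contra hemp
    rw [not_nonempty_iff] at hemp
    apply h
    unfold kloosterman
    split_ifs
    · exact finsum_of_isEmpty _
    · rfl
  obtain ⟨q⟩ := hne
  obtain ⟨⟨γ, hΓ, x, hx, y, hy, rfl⟩, -⟩ := q.exists_rep
  have hy1 := eq_one_of_mem_Nw_one hy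
  subst hy1
  have hint : ∀ i, (cs c i : ℝ) ∈ intR := by
    intro i
    have h1 := apply_mem_intR hΓ i i
    rw [mul_one, mul_one, Units.val_mul, Matrix.mul_apply, Finset.sum_eq_single i, hx.1,
      one_mul] at h1
    · convert h1 using 1
      change _ = Matrix.diagonal (fun i => ((cs c i : ℝˣ) : ℝ)) i i
      simp
    · intro j _ hj
      have : (cStar c).val j i = Matrix.diagonal (fun i => ((cs c i : ℝˣ) : ℝ)) j i := rfl
      rw [this, Matrix.diagonal_apply_ne _ hj, mul_zero]
    · simp
  have hstep : ∀ k, k < n → |(cExt c k : ℝ)| ≤ |(cExt c (k + 1) : ℝ)| := by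
    intro k hk
    obtain ⟨a, ha⟩ := mem_intR.mp (hint ⟨n - (k + 1), by omega⟩)
    rw [cs, Units.val_div_eq_div_val] at ha
    simp only [show n - (n - (k + 1)) = k + 1 by omega, Nat.add_sub_cancel] at ha
    have h0 : (cExt c k : ℝ) ≠ 0 := Units.ne_zero _
    have h1 : (cExt c (k + 1) : ℝ) ≠ 0 := Units.ne_zero _
    have ha0 : a ≠ 0 := by
      rintro rfl
      rw [Int.cast_zero, eq_comm, div_eq_zero_iff] at ha
      tauto
    have h2 : (1 : ℝ) ≤ |(a : ℝ)| := by exact_mod_cast Int.one_le_abs ha0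
    rw [eq_div_iff h0] at ha
    rw [← ha, abs_mul]
    nlinarith [abs_nonneg (cExt c k : ℝ)]
  refine le_antisymm ?_ (one_le_abs_cExt c k)
  have hmono : |(cExt c k : ℝ)| ≤ |(cExt c n : ℝ)| := by
    have h1 : ∀ d, k + d ≤ n → |(cExt c k : ℝ)| ≤ |(cExt c (k + d) : ℝ)| := by
      intro d
      induction d with
      | zero => intro _; rfl
      | succ d ih => exact fun hd => (ih (by omega)).trans (hstep (k + d) (by omega))
    simpa [Nat.add_sub_cancel' hk] using h1 (n - k) (by omega)
  simpa [cExt_self] using hmono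

end IdentityCell

/-! ### Integrality conditions in the cell of `w_*` -/

section StarCell

variable {n : ℕ}

theorem starPerm_starPerm (hn : 0 < n) (i : Fin n) : starPerm n hn (starPerm n hn i) = i :=
  Equiv.swap_apply_self _ _ _

theorem Nw_star_apply_eq_zero (hn : 0 < n) {w y : G n}
    (hs : ∀ i j, w.val i j = if i = starPerm n hn j then ((starSign n j : ℤ) : ℝ) else 0)
    (hy : y ∈ Nw w) {i j : Fin n} (h0 : 0 < i.val) (hij : i < j) (h1 : j.val < n - 1) :
    y.val i j = 0 := by
  rw [← range_unipW (σ := starPerm n hn) ⟨starSign n, hs⟩] at hy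
  obtain ⟨v, rfl⟩ := hy
  have hn' : ¬ starPerm n hn j < starPerm n hn i := by
    rw [starPerm_lt_iff hn hij]; omega
  rw [unipW_val, unipWMat, unipMat_of_lt _ hij, dif_neg hn']

/-- The entries of `c* w_* y`. -/
theorem cStar_mul_star_mul_apply (hn : 0 < n) {w : G n}
    (hs : ∀ i j, w.val i j = if i = starPerm n hn j then ((starSign n j : ℤ) : ℝ) else 0)
    (c : Modulus n) (y : G n) (i j : Fin n) : (cStar c * w * y).val i j =
      cs c i * (((starSign n (starPerm n hn i) : ℤ) : ℝ) * y.val (starPerm n hn i) j) := by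
  rw [mul_assoc, show cStar c = diagG (cs c) from rfl, diagG_mul_apply, Units.val_mul,
    Matrix.mul_apply, Finset.sum_eq_single (starPerm n hn i)]
  · rw [hs, starPerm_starPerm, if_pos rfl]
  · intro k _ hk
    rw [hs, if_neg, zero_mul]
    rintro rfl
    exact hk (starPerm_starPerm hn k).symm
  · simp

theorem cStar_mul_star_mul_apply_first (hn : 0 < n) {w : G n}
    (hs : ∀ i j, w.val i j = if i = starPerm n hn j then ((starSign n j : ℤ) : ℝ) else 0)
    (c : Modulus n) (y : G n) (j : Fin n) : (cStar c * w * y).val ⟨0, hn⟩ j =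
      -((cExt c (n - 1) : ℝ)⁻¹ * y.val ⟨n - 1, by omega⟩ j) := by
  rw [cStar_mul_star_mul_apply hn hs, starPerm_zero, cs_zero, starSign, if_pos rfl]
  push_cast
  ring

theorem cStar_mul_star_mul_apply_mid (hn : 0 < n) {w : G n}
    (hs : ∀ i j, w.val i j = if i = starPerm n hn j then ((starSign n j : ℤ) : ℝ) else 0)
    (c : Modulus n) (y : G n) {i : Fin n} (h0 : 0 < i.val) (h1 : i.val < n - 1) (j : Fin n) :
    (cStar c * w * y).val i j = cs c i * y.val i j := by
  rw [cStar_mul_star_mul_apply hn hs, starPerm_mid hn h0 h1, starSign, if_neg (by omega)]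
  simp

theorem cStar_mul_star_mul_apply_last (hn : 2 ≤ n) {w : G n}
    (hs : ∀ i j, w.val i j = if i = starPerm n (by omega) j then ((starSign n j : ℤ) : ℝ) else 0)
    (c : Modulus n) (y : G n) (j : Fin n) : (cStar c * w * y).val ⟨n - 1, by omega⟩ j =
      cExt c 1 * y.val ⟨0, by omega⟩ j := by
  rw [cStar_mul_star_mul_apply (by omega) hs, starPerm_last (by omega), cs_last (by omega), starSign,
    if_neg (by simp; omega)]
  simp

theorem cell_apply_last (hn : 2 ≤ n) {w : G n}
    (hs : ∀ i j, w.val i j = if i = starPerm n (by omega) j then ((starSign n j : ℤ) : ℝ) else 0)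
    (c : Modulus n) {x y : G n} (hx : x ∈ N n) (j : Fin n) :
    (x * cStar c * w * y).val ⟨n - 1, by omega⟩ j = cExt c 1 * y.val ⟨0, by omega⟩ j := by
  rw [mul_assoc, mul_assoc, ← mul_assoc (cStar c), Units.val_mul, Matrix.mul_apply,
    Finset.sum_eq_single ⟨n - 1, by omega⟩, hx.1, one_mul, cStar_mul_star_mul_apply_last hn hs]
  · intro k _ hk
    have : k < ⟨n - 1, by omega⟩ := by
      rw [Fin.lt_def]
      have := Fin.val_ne_of_ne hk
      simp at this ⊢
      omega
    rw [hx.2 _ _ this, zero_mul]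
  · simp

theorem cell_row_mem_intR (hn : 2 ≤ n) {w : G n}
    (hs : ∀ i j, w.val i j = if i = starPerm n (by omega) j then ((starSign n j : ℤ) : ℝ) else 0)
    {c : Modulus n} {x y : G n} (hx : x ∈ N n) (hΓ : x * cStar c * w * y ∈ Gam n) (j : Fin n) :
    (cExt c 1 : ℝ) * y.val ⟨0, by omega⟩ j ∈ intR := by
  rw [← cell_apply_last hn hs c hx]
  exact apply_mem_intR hΓ _ _

theorem cell_col_mem_intR (hn : 2 ≤ n) {w : G n}
    (hs : ∀ i j, w.val i j = if i = starPerm n (by omega) j then ((starSign n j : ℤ) : ℝ) else 0)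
    {c : Modulus n} {x y : G n} (hx : x ∈ N n) (hy : y ∈ Nw w)
    (hΓ : x * cStar c * w * y ∈ Gam n) {i : Fin n} (h0 : 0 < i.val) (h1 : i.val < n - 1) :
    (cExt c (n - 1) : ℝ) * y.val i ⟨n - 1, by omega⟩ ∈ intR := by
  set ρ : G n := (x * cStar c * w * y)⁻¹ with hρ
  have hρΓ : ρ ∈ Gam n := (Gam n).inv_mem hΓ
  -- The unknown `x` enters only through the first column of `x⁻¹`, which is the first unit vector.
  -- This determines the first column of the integral matrix `ρ = γ⁻¹` in terms of `y` and `c`.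
  have hprod : cStar c * w * y * ρ = x⁻¹ := by rw [hρ]; group
  have hxinv : x⁻¹ ∈ N n := (NSub n).inv_mem hx
  have hE : ∀ k, ∑ l, (cStar c * w * y).val k l * ρ.val l ⟨0, by omega⟩ =
      x⁻¹.val k ⟨0, by omega⟩ := by
    intro k
    rw [← hprod, Units.val_mul _ ρ, Matrix.mul_apply]
  have hE0 := hE ⟨0, by omega⟩
  rw [hxinv.1, sum_split_ends hn, Finset.sum_eq_zero] at hE0
  swap
  · intro k _
    split_ifs with hk
    · rw [cStar_mul_star_mul_apply_first (by omega) hs, hy.1.2 _ _ (Fin.lt_def.mpr hk.2)]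
      simp
    · rfl
  rw [cStar_mul_star_mul_apply_first (by omega) hs, cStar_mul_star_mul_apply_first (by omega) hs,
    hy.1.2 _ _ (Fin.lt_def.mpr (show 0 < n - 1 by omega)), hy.1.1] at hE0
  have hc : (cExt c (n - 1) : ℝ) ≠ 0 := Units.ne_zero _
  have hlast : ρ.val ⟨n - 1, by omega⟩ ⟨0, by omega⟩ = -(cExt c (n - 1) : ℝ) := by
    field_simp at hE0
    linarith
  have hEi := hE i
  rw [hxinv.2 _ _ (Fin.lt_def.mpr h0)] at hEi
  have hci : (cs c i : ℝ) ≠ 0 := Units.ne_zero _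
  have hterm : ∀ l, (cStar c * w * y).val i l * ρ.val l ⟨0, by omega⟩ =
      cs c i * (y.val i l * ρ.val l ⟨0, by omega⟩) := by
    intro l
    rw [cStar_mul_star_mul_apply_mid (by omega) hs c y h0 h1, mul_assoc]
  rw [Finset.sum_congr rfl fun l _ => hterm l, ← Finset.mul_sum, mul_eq_zero] at hEi
  have hEi' := hEi.resolve_left hci
  rw [sum_split_ends hn, hy.1.2 _ _ (Fin.lt_def.mpr h0), hlast, Finset.sum_eq_single i,
    if_pos ⟨h0, h1⟩, hy.1.1] at hEi'
  · convert apply_mem_intR hρΓ i ⟨0, by omega⟩ using 1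
    linarith
  · intro k _ hk
    split_ifs with hk'
    · rcases lt_or_gt_of_ne hk with h | h
      · rw [hy.1.2 _ _ h, zero_mul]
      · rw [Nw_star_apply_eq_zero (by omega) hs hy h0 h hk'.2, zero_mul]
    · rfl
  · simp

/-- The minors of `γ` in the rows from `d` on. -/
theorem cell_minor_mem_intR (hn : 2 ≤ n) {w : G n}
    (hs : ∀ i j, w.val i j = if i = starPerm n (by omega) j then ((starSign n j : ℤ) : ℝ) else 0)
    {c : Modulus n} (hc : ∀ i : Fin n, 0 < i.val → i.val < n - 1 → |(cs c i : ℝ)| = 1)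
    {x y : G n} (hx : x ∈ N n) (hy : y ∈ Nw w)
    (hΓ : x * cStar c * w * y ∈ Gam n) {d : ℕ} (hd : 0 < d) (hdn : d ≤ n - 1) :
    (cExt c 1 : ℝ) * (y.val ⟨0, by omega⟩ ⟨n - 1, by omega⟩ -
      ∑ k : Fin n, if d ≤ k.val ∧ k.val < n - 1 then
        y.val ⟨0, by omega⟩ k * y.val k ⟨n - 1, by omega⟩ else 0) ∈ intR := by
  set γ : G n := x * cStar c * w * y with hγ
  set B : G n := cStar c * w * y with hB
  have hγB : γ = x * B := by rw [hγ, hB]; group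
  -- Replacing the first `d` rows by those of the identity turns the lower right minor of `γ` into a
  -- full determinant. As `x` is upper triangular, the same replacement in `x` and in `c* w y` keeps
  -- the factorisation.
  set A : Matrix (Fin n) (Fin n) ℝ := Matrix.of fun i j =>
    if i.val < d then (1 : Matrix (Fin n) (Fin n) ℝ) i j else γ.val i j with hA
  set A' : Matrix (Fin n) (Fin n) ℝ := Matrix.of fun i j =>
    if i.val < d then (1 : Matrix (Fin n) (Fin n) ℝ) i j else x.val i j with hA'
  set B' : Matrix (Fin n) (Fin n) ℝ := Matrix.of fun i j =>
    if i.val < d then (1 : Matrix (Fin n) (Fin n) ℝ) i j else B.val i j with hB'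
  -- A unipotent column operation that clears the middle part of the last column. Afterwards the
  -- matrix is lower triangular and its last diagonal entry is the wanted number; the other diagonal
  -- entries are `±1`.
  set Y : G n := unip fun p => if p.1.2.val = n - 1 ∧ d ≤ p.1.1.val then
    -y.val p.1.1 p.1.2 else 0 with hY
  have hAint : A.det ∈ intR := by
    refine det_mem_intR fun i j => ?_
    simp only [hA, Matrix.of_apply]
    split_ifs
    · rw [Matrix.one_apply]; split_ifs
      · exact one_mem _
      · exact zero_mem _
    · exact apply_mem_intR hΓ i j
  have hAB : A = A' * B' := by
    ext i j
    rw [Matrix.mul_apply]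
    simp only [hA, hA', hB', Matrix.of_apply]
    by_cases hi : i.val < d
    · simp only [hi, if_true]
      rw [Finset.sum_eq_single i]
      · simp [hi]
      · intro k _ hk; rw [Matrix.one_apply_ne hk.symm, zero_mul]
      · simp
    · simp only [hi, if_false]
      rw [hγB, Units.val_mul, Matrix.mul_apply]
      refine Finset.sum_congr rfl fun k _ => ?_
      split_ifs with hk
      · rw [hx.2 _ _ (Fin.lt_def.mpr (by omega)), zero_mul, zero_mul]
      · rfl
  have hA'det : A'.det = 1 := by
    rw [Matrix.det_of_isUpperTriangular]
    · refine Finset.prod_eq_one fun i _ => ?_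
      simp only [hA', Matrix.of_apply]
      split_ifs
      · simp
      · exact hx.1 i
    · intro i j hij
      have hij' : j < i := hij
      simp only [hA', Matrix.of_apply]
      split_ifs
      · exact Matrix.one_apply_ne hij'.ne'
      · exact hx.2 _ _ hij'
  have hYdet : Y.val.det = 1 := det_of_mem_N (unip_mem _)
  have hYne : ∀ k j : Fin n, j.val ≠ n - 1 → Y.val k j = (1 : Matrix (Fin n) (Fin n) ℝ) k j := by
    intro k j hj
    rw [hY, unip_val]
    rcases lt_trichotomy k j with h | h | h
    · rw [unipMat_of_lt _ h, if_neg (fun h' => hj h'.1), Matrix.one_apply_ne h.ne]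
    · subst h; rw [unipMat_self, Matrix.one_apply_eq]
    · rw [unipMat_of_gt _ h, Matrix.one_apply_ne h.ne']
  have hYlast : ∀ k : Fin n, k.val < n - 1 → Y.val k ⟨n - 1, by omega⟩ =
      if d ≤ k.val then -y.val k ⟨n - 1, by omega⟩ else 0 := by
    intro k hk
    rw [hY, unip_val, unipMat_of_lt _ (Fin.lt_def.mpr hk)]
    simp
  have hTne : ∀ i j : Fin n, j.val ≠ n - 1 → (B' * Y.val) i j = B' i j := by
    intro i j hj
    rw [Matrix.mul_apply, Finset.sum_congr rfl fun k _ => by rw [hYne k j hj], ← Matrix.mul_apply,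
      Matrix.mul_one]
  have hTlast : ∀ i, (B' * Y.val) i ⟨n - 1, by omega⟩ = B' i ⟨n - 1, by omega⟩ -
      ∑ k : Fin n, if d ≤ k.val ∧ k.val < n - 1 then
        B' i k * y.val k ⟨n - 1, by omega⟩ else 0 := by
    intro i
    rw [Matrix.mul_apply, sum_split_ends hn, hYlast _ (by simp; omega), if_neg (by simp; omega),
      (unip_mem _).1, mul_zero, zero_add, mul_one, sub_eq_add_neg, ← Finset.sum_neg_distrib]
    congr 1
    refine Finset.sum_congr rfl fun k _ => ?_
    by_cases hk : k.val < n - 1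
    · rw [hYlast k hk]
      split_ifs <;> first | omega | simp
    · rw [if_neg (fun h => hk h.2), if_neg (fun h => hk h.2), neg_zero]
  have hmid : ∀ i j : Fin n, d ≤ i.val → i.val < n - 1 → B' i j = cs c i * y.val i j := by
    intro i j hi hi'
    simp only [hB', Matrix.of_apply]
    rw [if_neg (by omega), hB, cStar_mul_star_mul_apply_mid (by omega) hs c y (by omega) hi']
  have hlow : ∀ i j : Fin n, i.val < d → B' i j = (1 : Matrix (Fin n) (Fin n) ℝ) i j := by
    intro i j hi
    simp only [hB', Matrix.of_apply]
    rw [if_pos hi]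
  have hlast : ∀ j : Fin n, B' ⟨n - 1, by omega⟩ j = cExt c 1 * y.val ⟨0, by omega⟩ j := by
    intro j
    simp only [hB', Matrix.of_apply]
    rw [if_neg (by omega), hB, cStar_mul_star_mul_apply_last hn hs]
  have hyz : ∀ i j : Fin n, 0 < i.val → i ≠ j → j.val < n - 1 → y.val i j = 0 := by
    intro i j h0 hij hj
    rcases lt_or_gt_of_ne hij with h | h
    · exact Nw_star_apply_eq_zero (by omega) hs hy h0 h hj
    · exact hy.1.2 _ _ h
  have hTtri : (B' * Y.val).IsLowerTriangular := by
    intro i j hij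
    have hij' : i.val < j.val := hij
    by_cases hj : j.val = n - 1
    · have hi' : i.val < n - 1 := hj ▸ hij'
      rw [show j = ⟨n - 1, by omega⟩ from Fin.ext hj, hTlast]
      by_cases hi : i.val < d
      · rw [hlow _ _ hi, Matrix.one_apply_ne (Fin.ne_of_val_ne hi'.ne), Finset.sum_eq_zero,
          sub_zero]
        intro k _
        split_ifs with hk
        · rw [hlow _ _ hi, Matrix.one_apply_ne (Fin.ne_of_val_ne (by omega)), zero_mul]
        · rfl
      · rw [Finset.sum_eq_single i, if_pos ⟨by omega, hi'⟩, hmid _ _ (by omega) hi',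
          hmid _ _ (by omega) hi', hy.1.1, mul_one, sub_self]
        · intro k _ hk
          split_ifs with hk'
          · rw [hmid _ _ (by omega) hi', hyz _ _ (by omega) hk.symm hk'.2, mul_zero, zero_mul]
          · rfl
        · simp
    · have hj' := j.2
      rw [hTne _ _ hj]
      by_cases hi : i.val < d
      · rw [hlow _ _ hi, Matrix.one_apply_ne (Fin.ne_of_val_ne (by omega))]
      · rw [hmid _ _ (by omega) (by omega), hyz _ _ (by omega) (Fin.ne_of_val_ne (by omega))
          (by omega), mul_zero]
  have hdet : A.det = ∏ i, (B' * Y.val) i i := by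
    rw [← Matrix.det_of_isLowerTriangular _ hTtri, Matrix.det_mul, hYdet, mul_one, hAB,
      Matrix.det_mul, hA'det, one_mul]
  rw [← Finset.mul_prod_erase _ _ (Finset.mem_univ ⟨n - 1, by omega⟩)] at hdet
  have hunit : |∏ i ∈ Finset.univ.erase ⟨n - 1, by omega⟩, (B' * Y.val) i i| = 1 := by
    rw [Finset.abs_prod]
    refine Finset.prod_eq_one fun i hi => ?_
    have hi1 : i.val ≠ n - 1 := fun h => (Finset.mem_erase.mp hi).1 (Fin.ext h)
    have hi2 := i.2
    rw [hTne _ _ hi1]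
    by_cases hid : i.val < d
    · rw [hlow _ _ hid]; simp
    · rw [hmid _ _ (by omega) (by omega), hy.1.1, mul_one]
      exact hc i (by omega) (by omega)
  have hLL : (B' * Y.val) ⟨n - 1, by omega⟩ ⟨n - 1, by omega⟩ =
      (cExt c 1 : ℝ) * (y.val ⟨0, by omega⟩ ⟨n - 1, by omega⟩ -
      ∑ k : Fin n, if d ≤ k.val ∧ k.val < n - 1 then
        y.val ⟨0, by omega⟩ k * y.val k ⟨n - 1, by omega⟩ else 0) := by
    rw [hTlast, hlast, mul_sub, Finset.mul_sum]
    congr 1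
    refine Finset.sum_congr rfl fun k _ => ?_
    split_ifs
    · rw [hlast, mul_assoc]
    · rw [mul_zero]
  rw [← hLL]
  rcases abs_eq (zero_le_one' ℝ) |>.mp hunit with h | h
  · rw [h, mul_one] at hdet
    rwa [← hdet]
  · rw [h, mul_neg_one] at hdet
    rw [← neg_mem_iff, ← hdet]
    exact hAint

/-- The minors for `d = i` and `d = i + 1` differ by this single summand. -/
theorem cell_mul_mem_intR (hn : 2 ≤ n) {w : G n}
    (hs : ∀ i j, w.val i j = if i = starPerm n (by omega) j then ((starSign n j : ℤ) : ℝ) else 0)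
    {c : Modulus n} (hc : ∀ i : Fin n, 0 < i.val → i.val < n - 1 → |(cs c i : ℝ)| = 1)
    {x y : G n} (hx : x ∈ N n) (hy : y ∈ Nw w)
    (hΓ : x * cStar c * w * y ∈ Gam n) {i : Fin n} (h0 : 0 < i.val) (h1 : i.val < n - 1) :
    (cExt c 1 : ℝ) * (y.val ⟨0, by omega⟩ i * y.val i ⟨n - 1, by omega⟩) ∈ intR := by
  have hA := cell_minor_mem_intR hn hs hc hx hy hΓ h0 h1.le
  have hB := cell_minor_mem_intR hn hs hc hx hy hΓ (d := i.val + 1) (by omega) (by omega)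
  convert sub_mem hB hA using 1
  have hsum : (∑ k : Fin n, if i.val ≤ k.val ∧ k.val < n - 1 then
        y.val ⟨0, by omega⟩ k * y.val k ⟨n - 1, by omega⟩ else 0) =
      (∑ k : Fin n, if i.val + 1 ≤ k.val ∧ k.val < n - 1 then
        y.val ⟨0, by omega⟩ k * y.val k ⟨n - 1, by omega⟩ else 0) +
      ∑ k : Fin n, if k = i then y.val ⟨0, by omega⟩ k * y.val k ⟨n - 1, by omega⟩ else 0 := by
    rw [← Finset.sum_add_distrib]
    refine Finset.sum_congr rfl fun k _ => ?_
    by_cases hk : k = i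
    · subst hk; simp [h1]
    · have := Fin.val_ne_of_ne hk
      simp only [hk, if_false, add_zero]
      congr 1
      simp only [eq_iff_iff]
      omega
  rw [hsum, Finset.sum_ite_eq' Finset.univ i]
  simp only [Finset.mem_univ, if_true]
  ring

end StarCell

/-! ### Residue classes of rational coordinates -/

section Code

/-- The residue class modulo `c` of the integer `c * x`. -/
def code (c : ℕ) (x : ℝ) : ℕ := (⌊(c : ℝ) * x⌋ % (c : ℤ)).toNat

theorem coe_code {c : ℕ} (hc : 0 < c) (x : ℝ) : (code c x : ℤ) = ⌊(c : ℝ) * x⌋ % (c : ℤ) :=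
  Int.toNat_of_nonneg (Int.emod_nonneg _ (by omega))

theorem code_lt {c : ℕ} (hc : 0 < c) (x : ℝ) : code c x < c := by
  have h1 := coe_code hc x
  have h2 := Int.emod_lt_of_pos ⌊(c : ℝ) * x⌋ (show (0 : ℤ) < c by omega)
  omega

theorem sub_mem_intR_of_code_eq {c : ℕ} (hc : 0 < c) {x x' : ℝ} (hx : (c : ℝ) * x ∈ intR)
    (hx' : (c : ℝ) * x' ∈ intR) (h : code c x = code c x') : x' - x ∈ intR := by
  obtain ⟨a, ha⟩ := mem_intR.mp hx
  obtain ⟨b, hb⟩ := mem_intR.mp hx'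
  have h1 := coe_code hc x
  have h2 := coe_code hc x'
  rw [← ha, Int.floor_intCast] at h1
  rw [← hb, Int.floor_intCast] at h2
  rw [h, h2] at h1
  obtain ⟨k, hk⟩ := Int.ModEq.dvd (show a ≡ b [ZMOD c] from h1.symm)
  refine mem_intR.mpr ⟨k, ?_⟩
  have hc0 : (c : ℝ) ≠ 0 := by exact_mod_cast hc.ne'
  apply mul_left_cancel₀ hc0
  rw [mul_sub, ← ha, ← hb]
  exact_mod_cast hk.symm

/-- With `a = c x` and `b = c x'`, integrality of `c x x' = ab/c` says that `c` divides `ab`. -/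
theorem code_mem_zeroPairs {c : ℕ} (hc : 0 < c) {x x' : ℝ} (hx : (c : ℝ) * x ∈ intR)
    (hx' : (c : ℝ) * x' ∈ intR) (h : (c : ℝ) * (x * x') ∈ intR) :
    (code c x, code c x') ∈ zeroPairs c := by
  rw [zeroPairs, Finset.mem_filter, Finset.mem_product, Finset.mem_range, Finset.mem_range]
  refine ⟨⟨code_lt hc x, code_lt hc x'⟩, ?_⟩
  obtain ⟨a, ha⟩ := mem_intR.mp hx
  obtain ⟨b, hb⟩ := mem_intR.mp hx'
  obtain ⟨k, hk⟩ := mem_intR.mp h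
  have hab : a * b = c * k := by
    have : (a : ℝ) * b = c * k := by rw [ha, hb, hk]; ring
    exact_mod_cast this
  have h1 := coe_code hc x
  have h2 := coe_code hc x'
  rw [← ha, Int.floor_intCast] at h1
  rw [← hb, Int.floor_intCast] at h2
  have h3 : a % c * (b % c) ≡ a * b [ZMOD c] := (Int.mod_modEq a c).mul (Int.mod_modEq b c)
  have h4 : a % c * (b % c) ≡ 0 [ZMOD c] := h3.trans (by
    rw [hab]; exact (Int.modEq_zero_iff_dvd).mpr (dvd_mul_right _ _))
  rw [← h1, ← h2] at h4
  have h5 := (Int.modEq_zero_iff_dvd).mp h4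
  exact_mod_cast h5

theorem mul_mem_intR_of_abs_eq {a b z : ℝ} (h : |b| = |a|) (hz : a * z ∈ intR) : b * z ∈ intR := by
  rcases abs_eq_abs.mp h with rfl | rfl
  · exact hz
  · rw [neg_mul]; exact neg_mem hz

end Code

/-! ### Counting double cosets in the cell of `w_*` -/

section StarKloosterman

variable {n : ℕ}

theorem Nw_star_mul_apply_row (hn : 2 ≤ n) {w y ν : G n}
    (hs : ∀ i j, w.val i j = if i = starPerm n (by omega) j then ((starSign n j : ℤ) : ℝ) else 0)
    (hy : y ∈ Nw w) (hν : ν ∈ Nw w) {j : Fin n} (h0 : 0 < j.val) (h1 : j.val < n - 1) :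
    (y * ν).val ⟨0, by omega⟩ j = ν.val ⟨0, by omega⟩ j + y.val ⟨0, by omega⟩ j := by
  rw [Units.val_mul, Matrix.mul_apply, sum_split_ends hn, hy.1.1, one_mul,
    hν.1.2 ⟨n - 1, by omega⟩ j (Fin.lt_def.mpr h1), mul_zero, add_zero, Finset.sum_eq_single j,
    if_pos ⟨h0, h1⟩, hν.1.1, mul_one]
  · intro k _ hk
    split_ifs with hk'
    · rcases lt_or_gt_of_ne hk with h | h
      · rw [Nw_star_apply_eq_zero (by omega) hs hν hk'.1 h h1, mul_zero]
      · rw [hν.1.2 _ _ h, mul_zero]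
    · rfl
  · simp

theorem Nw_star_mul_apply_col (hn : 2 ≤ n) {w y ν : G n}
    (hs : ∀ i j, w.val i j = if i = starPerm n (by omega) j then ((starSign n j : ℤ) : ℝ) else 0)
    (hy : y ∈ Nw w) (hν : ν ∈ Nw w) {i : Fin n} (h0 : 0 < i.val) (h1 : i.val < n - 1) :
    (y * ν).val i ⟨n - 1, by omega⟩ =
      ν.val i ⟨n - 1, by omega⟩ + y.val i ⟨n - 1, by omega⟩ := by
  rw [Units.val_mul, Matrix.mul_apply, sum_split_ends hn, hy.1.2 _ _ (Fin.lt_def.mpr h0), zero_mul,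
    zero_add, hν.1.1, mul_one, Finset.sum_eq_single i, if_pos ⟨h0, h1⟩, hy.1.1, one_mul, add_comm]
  · intro k _ hk
    split_ifs with hk'
    · rcases lt_or_gt_of_ne hk with h | h
      · rw [hy.1.2 _ _ h, zero_mul]
      · rw [Nw_star_apply_eq_zero (by omega) hs hy h0 h hk'.2, zero_mul]
    · rfl
  · simp

theorem Nw_star_mul_apply_corner (hn : 2 ≤ n) {w y ν : G n} (hy : y ∈ Nw w) (hν : ν ∈ Nw w) :
    (y * ν).val ⟨0, by omega⟩ ⟨n - 1, by omega⟩ =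
      ν.val ⟨0, by omega⟩ ⟨n - 1, by omega⟩ + y.val ⟨0, by omega⟩ ⟨n - 1, by omega⟩ +
      ∑ k : Fin n, if 0 < k.val ∧ k.val < n - 1 then
        y.val ⟨0, by omega⟩ k * ν.val k ⟨n - 1, by omega⟩ else 0 := by
  rw [Units.val_mul, Matrix.mul_apply, sum_split_ends hn, hy.1.1, one_mul, hν.1.1, mul_one]

/-- The coordinate of the centre of `N_w`, reduced so that it is invariant under `N_w ∩ Γ` modulo
the integers. -/
def reducedCorner (hn : 0 < n) (y : G n) : ℝ :=
  y.val ⟨0, hn⟩ ⟨n - 1, by omega⟩ - ∑ k : Fin n, if 0 < k.val ∧ k.val < n - 1 then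
    y.val ⟨0, hn⟩ k * (⌊y.val k ⟨n - 1, by omega⟩⌋ : ℝ) else 0

/-- The corner of `y ν` contains the mixed terms `y_{0k} ν_{kL}`. Since `ν_{kL}` is an integer, the
floor in the reduced corner changes by exactly `ν_{kL}` and cancels them. -/
theorem Nw_star_mem_Gam (hn : 2 ≤ n) {w y ν : G n}
    (hs : ∀ i j, w.val i j = if i = starPerm n (by omega) j then ((starSign n j : ℤ) : ℝ) else 0)
    (hy : y ∈ Nw w) (hν : ν ∈ Nw w)
    (hrow : ∀ j : Fin n, 0 < j.val → j.val < n - 1 →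
      (y * ν).val ⟨0, by omega⟩ j - y.val ⟨0, by omega⟩ j ∈ intR)
    (hcol : ∀ i : Fin n, 0 < i.val → i.val < n - 1 →
      (y * ν).val i ⟨n - 1, by omega⟩ - y.val i ⟨n - 1, by omega⟩ ∈ intR)
    (hcorner : reducedCorner (by omega) (y * ν) - reducedCorner (by omega) y ∈ intR) :
    ν ∈ Gam n := by
  refine mem_Gam_of_mem_N hν.1 fun i j => ?_
  have hνcol : ∀ i : Fin n, 0 < i.val → i.val < n - 1 → ν.val i ⟨n - 1, by omega⟩ ∈ intR := by
    intro i h0 h1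
    have := hcol i h0 h1
    rwa [Nw_star_mul_apply_col hn hs hy hν h0 h1, add_sub_cancel_right] at this
  have hνrow : ∀ j : Fin n, 0 < j.val → j.val < n - 1 → ν.val ⟨0, by omega⟩ j ∈ intR := by
    intro j h0 h1
    have := hrow j h0 h1
    rwa [Nw_star_mul_apply_row hn hs hy hν h0 h1, add_sub_cancel_right] at this
  rcases lt_trichotomy i j with hij | rfl | hij
  · have hij' : i.val < j.val := hij
    have hj := j.2
    by_cases hi : i.val = 0
    · rw [show i = ⟨0, by omega⟩ from Fin.ext hi]
      by_cases hjn : j.val < n - 1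
      · exact hνrow j (by omega) hjn
      · rw [show j = ⟨n - 1, by omega⟩ from Fin.ext (by simp; omega)]
        have hdiff : ν.val ⟨0, by omega⟩ ⟨n - 1, by omega⟩ =
            reducedCorner (by omega) (y * ν) - reducedCorner (by omega) y +
            ∑ k : Fin n, if 0 < k.val ∧ k.val < n - 1 then
              ν.val ⟨0, by omega⟩ k * (⌊(y * ν).val k ⟨n - 1, by omega⟩⌋ : ℝ) else 0 := by
          rw [reducedCorner, reducedCorner, Nw_star_mul_apply_corner hn hy hν]
          have hterm : ∀ k : Fin n, (if 0 < k.val ∧ k.val < n - 1 then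
              (y * ν).val ⟨0, by omega⟩ k * (⌊(y * ν).val k ⟨n - 1, by omega⟩⌋ : ℝ) else 0) =
              (if 0 < k.val ∧ k.val < n - 1 then
                y.val ⟨0, by omega⟩ k * ν.val k ⟨n - 1, by omega⟩ else 0) +
              (if 0 < k.val ∧ k.val < n - 1 then
                y.val ⟨0, by omega⟩ k * (⌊y.val k ⟨n - 1, by omega⟩⌋ : ℝ) else 0) +
              (if 0 < k.val ∧ k.val < n - 1 then
                ν.val ⟨0, by omega⟩ k * (⌊(y * ν).val k ⟨n - 1, by omega⟩⌋ : ℝ) else 0) := by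
            intro k
            split_ifs with hk
            · obtain ⟨e, he⟩ := mem_intR.mp (hνcol k hk.1 hk.2)
              rw [Nw_star_mul_apply_row hn hs hy hν hk.1 hk.2,
                Nw_star_mul_apply_col hn hs hy hν hk.1 hk.2, ← he, Int.floor_intCast_add]
              push_cast
              ring
            · simp
          rw [Finset.sum_congr rfl fun k _ => hterm k, Finset.sum_add_distrib,
            Finset.sum_add_distrib]
          ring
        rw [hdiff]
        refine add_mem hcorner (sum_mem fun k _ => ?_)
        split_ifs with hk
        · exact mul_mem (hνrow k hk.1 hk.2) ⟨_, rfl⟩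
        · exact zero_mem _
    · by_cases hjn : j.val < n - 1
      · rw [Nw_star_apply_eq_zero (by omega) hs hν (by omega) hij hjn]
        exact zero_mem _
      · rw [show j = ⟨n - 1, by omega⟩ from Fin.ext (by simp; omega)]
        exact hνcol i (by omega) (by omega)
  · rw [hν.1.1]; exact one_mem _
  · rw [hν.1.2 _ _ hij]; exact zero_mem _

/-- A double coset is determined by `y` modulo `N_w ∩ Γ`. The row and column entries of `y` have
denominator `q`, and for each of the `n - 2` middle indices the two numerators multiply to `0`
modulo `q`. The reduced corner leaves at most `q` further choices. -/
theorem norm_kloosterman_star_le (hn : 2 ≤ n) {w : G n}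
    (hs : ∀ i j, w.val i j = if i = starPerm n (by omega) j then ((starSign n j : ℤ) : ℝ) else 0)
    (m m' : Fin (n - 1) → ℕ+) {c : Modulus n}
    (hc : ∀ i : Fin n, 0 < i.val → i.val < n - 1 → |(cs c i : ℝ)| = 1)
    (hlast : |(cExt c (n - 1) : ℝ)| = |(cExt c 1 : ℝ)|) {q : ℕ} (hq : (q : ℝ) = |(cExt c 1 : ℝ)|) :
    ‖kloosterman m m' w c‖ ≤ q * (zeroPairs q).card ^ (n - 2) := by
  have hq0 : 0 < q := by
    have h1 := one_le_abs_cExt c 1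
    rw [← hq] at h1
    exact_mod_cast h1
  choose x hx y hy hγ using fun γ : Cell w c => γ.2.2
  have hΓ : ∀ γ : Cell w c, x γ * cStar c * w * y γ ∈ Gam n := fun γ => hγ γ ▸ γ.2.1
  have hq1 : |(q : ℝ)| = |(cExt c 1 : ℝ)| := by rw [hq, abs_abs]
  have hrow : ∀ γ j, (q : ℝ) * (y γ).val ⟨0, by omega⟩ j ∈ intR := fun γ j =>
    mul_mem_intR_of_abs_eq hq1 (cell_row_mem_intR hn hs (hx γ) (hΓ γ) j)
  have hcol : ∀ γ (i : Fin n), 0 < i.val → i.val < n - 1 →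
      (q : ℝ) * (y γ).val i ⟨n - 1, by omega⟩ ∈ intR := fun γ i h0 h1 =>
    mul_mem_intR_of_abs_eq (hq1.trans hlast.symm)
      (cell_col_mem_intR hn hs (hx γ) (hy γ) (hΓ γ) h0 h1)
  have hmul : ∀ γ (i : Fin n), 0 < i.val → i.val < n - 1 →
      (q : ℝ) * ((y γ).val ⟨0, by omega⟩ i * (y γ).val i ⟨n - 1, by omega⟩) ∈ intR :=
    fun γ i h0 h1 => mul_mem_intR_of_abs_eq hq1
      (cell_mul_mem_intR hn hs hc (hx γ) (hy γ) (hΓ γ) h0 h1)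
  have hcor : ∀ γ, (q : ℝ) * reducedCorner (by omega) (y γ) ∈ intR := by
    intro γ
    rw [reducedCorner, mul_sub, Finset.mul_sum]
    refine sub_mem (hrow γ _) (sum_mem fun k _ => ?_)
    split_ifs with hk
    · rw [← mul_assoc]
      exact mul_mem (hrow γ k) ⟨_, rfl⟩
    · rw [mul_zero]; exact zero_mem _
  let ι : Fin (n - 2) → Fin n := fun j => ⟨j.val + 1, by omega⟩
  have hι : ∀ j : Fin n, 0 < j.val → j.val < n - 1 → ∃ i, ι i = j := fun j h0 h1 =>
    ⟨⟨j.val - 1, by omega⟩, Fin.ext (by simp [ι]; omega)⟩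
  let f : Quotient (cellSetoid w c) → (Fin (n - 2) → ℕ × ℕ) × ℕ := fun p =>
    (fun j => (code q ((y p.out).val ⟨0, by omega⟩ (ι j)),
      code q ((y p.out).val (ι j) ⟨n - 1, by omega⟩)),
      code q (reducedCorner (by omega) (y p.out)))
  have hf : f.Injective := by
    intro p p' hpp
    obtain ⟨h1, h2⟩ := Prod.ext_iff.mp hpp
    have h3 : ∀ j, _ := fun j => Prod.ext_iff.mp (congrFun h1 j)
    rw [← p.out_eq, ← p'.out_eq]
    apply Quotient.sound
    have hν : (y p.out)⁻¹ * y p'.out ∈ Nw w := by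
      rw [← coe_NwSub]
      refine (NwSub w).mul_mem ((NwSub w).inv_mem ?_) ?_ <;>
        rw [← SetLike.mem_coe, coe_NwSub] <;> exact hy _
    refine cellSetoid_of_mem (hx _) (hx _) (hγ _) (hγ _) hν ?_
    have hyν : y p.out * ((y p.out)⁻¹ * y p'.out) = y p'.out := by group
    refine Nw_star_mem_Gam hn hs (hy p.out) hν ?_ ?_ ?_
    · intro j h0 h1
      obtain ⟨i, rfl⟩ := hι j h0 h1
      rw [hyν]
      exact sub_mem_intR_of_code_eq hq0 (hrow _ _) (hrow _ _) (h3 i).1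
    · intro j h0 h1
      obtain ⟨i, rfl⟩ := hι j h0 h1
      rw [hyν]
      exact sub_mem_intR_of_code_eq hq0 (hcol _ _ h0 h1) (hcol _ _ h0 h1) (h3 i).2
    · rw [hyν]
      exact sub_mem_intR_of_code_eq hq0 (hcor _) (hcor _) h2
  have hmain := norm_kloosterman_le (m := m) (m' := m') hf
    (S := (Fintype.piFinset fun _ => zeroPairs q) ×ˢ Finset.range q) (by
      intro p
      rw [Finset.mem_product, Fintype.mem_piFinset, Finset.mem_range]
      refine ⟨fun j => ?_, code_lt hq0 _⟩
      have h0 : 0 < (ι j).val := Nat.succ_pos _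
      have h1 : (ι j).val < n - 1 := by have := j.2; simp only [ι]; omega
      exact code_mem_zeroPairs hq0 (hrow _ _) (hcol _ _ h0 h1) (hmul _ _ h0 h1))
  refine hmain.trans (le_of_eq ?_)
  rw [Finset.card_product, Fintype.card_piFinset_const, Finset.card_range]
  push_cast
  ring

theorem deltaW_one (a : Fin n → ℝˣ) : deltaW (1 : Equiv.Perm (Fin n)) a = 1 := by
  rw [deltaW, Finset.univ_eq_empty, Finset.prod_empty]

/-- Only pairs whose second index is the last one have ratio different from `1`; for each of the `n
- 1` possible first indices the ratio is `m`. -/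
theorem deltaW_star (hn : 2 ≤ n) (m : ℕ+) :
    deltaW (starPerm n (by omega)) (mEntry (mVec n m)) = ((m : ℕ) : ℝ) ^ (n - 1) := by
  have hm0 : (0 : ℝ) < ((m : ℕ) : ℝ) := by exact_mod_cast m.pos
  rw [deltaW, prod_Inv _ (fun i j =>
    |(mEntry (mVec n m) i : ℝ) / (mEntry (mVec n m) j : ℝ)|)]
  have hrow : ∀ i : Fin n, (∏ j : Fin n, if i < j then
      (if starPerm n (by omega) j < starPerm n (by omega) i then
        |(mEntry (mVec n m) i : ℝ) / (mEntry (mVec n m) j : ℝ)| else 1) else 1) =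
      if i.val < n - 1 then ((m : ℕ) : ℝ) else 1 := by
    intro i
    rw [Finset.prod_eq_single ⟨n - 1, by omega⟩]
    · by_cases hi : i.val < n - 1
      · rw [if_pos (Fin.lt_def.mpr hi), if_pos ((starPerm_lt_iff (by omega) (Fin.lt_def.mpr hi)).mpr
          (Or.inr rfl)), mEntry_mVec hn, mEntry_mVec hn, if_pos (by omega), if_neg (by simp; omega),
          if_pos hi, div_one, abs_of_pos hm0]
      · rw [if_neg hi, if_neg (fun h => hi (Fin.lt_def.mp h))]
    · intro j _ hj
      split_ifs with h1 h2
      · have h3 := Fin.lt_def.mp h1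
        have h4 := Fin.val_ne_of_ne hj
        simp only at h4
        have h5 := j.2
        rw [mEntry_mVec hn, mEntry_mVec hn, if_pos (by omega), if_pos (by omega), div_self hm0.ne',
          abs_one]
      · rfl
      · rfl
    · simp
  rw [Finset.prod_congr rfl fun i _ => hrow i, Finset.prod_ite, Finset.prod_const,
    Finset.prod_const_one, mul_one]
  congr 1
  rw [show (Finset.univ.filter fun i : Fin n => i.val < n - 1) =
    Finset.univ.erase ⟨n - 1, by omega⟩ by
      ext i
      have := i.2
      simp only [Finset.mem_filter, Finset.mem_univ, true_and, Finset.mem_erase, and_true, ne_eq,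
        Fin.ext_iff]
      omega]
  rw [Finset.card_erase_of_mem (Finset.mem_univ _), Finset.card_univ, Fintype.card_fin]

end StarKloosterman

/-! ### The geometric side -/

section Geometric

open scoped ENNReal

variable {n : ℕ}

theorem orbital_one_bound {X τ : ℝ} (hX : 1 ≤ X) (hτ : 0 < τ) (hτ1 : τ ≤ 1 / 2) {F : G n → ℂ}
    (hF : IsTestFunction F) (hsupp : SupportedInZKSharp X τ F) (m : ℕ+) (c : Modulus n) :
    OrbitalConverges 1 F (orbitPoint (mVec n m) c 1) ∧
      ‖orbital 1 F (orbitPoint (mVec n m) c 1)‖ ≤ supNorm F *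
        ((4 * τ) ^ Fintype.card (Pos n) * X ^ ((n : ℝ) * (n - 1) * (n - 2) / 6)) := by
  have hX0 : 0 < X := by linarith
  have hS : ∀ p : (Pos n → ℝ) × (Inv (1 : Equiv.Perm (Fin n)) → ℝ),
      F (unip p.1 * (orbitPoint (mVec n m) c 1 * unipW 1 p.2)) ≠ 0 →
      p ∈ {w : (Pos n → ℝ) × (Inv (1 : Equiv.Perm (Fin n)) → ℝ) |
        ∀ p : Pos n, |w.1 p| ≤ 2 * τ * X ^ ((p.1.2.val : ℤ) - p.1.1.val - 1)} := by
    intro p hp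
    obtain ⟨z, k, hk, h⟩ := hsupp _ hp
    exact abs_le_of_support_one hX hτ1 hk h
  have hvol := lintegral_box_one (n := n) X τ hX0 hτ
  exact ⟨orbitalConverges_of_support hF _ _ hS (hvol.trans_lt ENNReal.ofReal_lt_top),
    norm_orbital_le hF _ _ hS (by positivity) hvol⟩

theorem exists_orbital_star_bound (n : ℕ) (hn : 3 < n) : ∃ τ₀ : ℝ, 0 < τ₀ ∧
    ∀ τ : ℝ, 0 < τ → τ < τ₀ → ∀ e : ℝ, 0 < e → ∃ K : ℝ, 0 < K ∧
    ∀ X : ℝ, 1 ≤ X → ∀ F : G n → ℂ, IsTestFunction F → SupportedInZKSharp X τ F →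
    ∀ m : ℕ+, ((m : ℕ) : ℝ) ≤ X ^ (n + 2) →
    ∀ w : G n, (∀ i j, w.val i j =
      if i = starPerm n (by omega) j then ((starSign n j : ℤ) : ℝ) else 0) →
    ∀ c : Modulus n, Admissible (mVec n m) (mVec n m) w c →
    (∃ (u : Pos n → ℝ) (v : Inv (starPerm n (by omega : 0 < n)) → ℝ),
      F (unip u * (orbitPoint (mVec n m) c w * unipW _ v)) ≠ 0) →
    |(cs c ⟨1, by omega⟩ : ℝ)| = 1 ∧ |(cExt c 1 : ℝ)| ≤ X ^ 2 ∧
    OrbitalConverges (starPerm n (by omega)) F (orbitPoint (mVec n m) c w) ∧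
    ‖orbital (starPerm n (by omega)) F (orbitPoint (mVec n m) c w)‖ ≤ supNorm F *
      (K * X ^ ((n : ℝ) * (n - 1) * (n - 2) / 6 + e) *
        (|(cExt c 1 : ℝ)| / ((m : ℕ) : ℝ) * X)⁻¹ ^ n * (X ^ (n - 2))⁻¹) := by
  obtain ⟨τ₁, C, hτ₁, hC, hbox⟩ := starBox_of_support n hn
  refine ⟨min τ₁ (1 / 2), by positivity, ?_⟩
  intro τ hτ hττ e he
  rw [lt_min_iff] at hττ
  obtain ⟨K, hK, hvol⟩ := exists_lintegral_starBox_le hn hτ hττ.2.le hC he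
  refine ⟨K, hK, ?_⟩
  intro X hX F hF hsupp m hm w hs c hadm ⟨u₀, v₀, hne⟩
  have hX0 : 0 < X := by linarith
  have hm0 : (0 : ℝ) < ((m : ℕ) : ℝ) := by exact_mod_cast m.pos
  have hall : ∀ p : (Pos n → ℝ) × (Inv (starPerm n (by omega)) → ℝ),
      F (unip p.1 * (orbitPoint (mVec n m) c w * unipW (starPerm n (by omega)) p.2)) ≠ 0 →
      |(cs c ⟨1, by omega⟩ : ℝ)| = 1 ∧ |(cExt c 1 : ℝ)| ≤ 2 * τ * X ^ 2 ∧
      |(cExt c 1 : ℝ) / ((m : ℕ) : ℝ)| * X ≤ 2 * τ ∧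
      StarBox (by omega : 0 < n) X τ C (cExt c 1 / ((m : ℕ) : ℝ)) (cs c ⟨1, by omega⟩)
        (unipMat p.1) (unipWMat _ p.2) := by
    intro p hp
    obtain ⟨z, k, hk, h⟩ := hsupp _ hp
    refine hbox X τ hX hτ hττ.1 m hm w hs c hadm (unip p.1) (unip_mem _)
      (unipW (starPerm n (by omega)) p.2) (unip_mem _) ?_ z k hk h
    intro i j h0 hij h1
    have hn' : ¬ starPerm n (by omega) j < starPerm n (by omega) i := by
      rw [starPerm_lt_iff (by omega) hij]; omega
    rw [unipW_val, unipWMat, unipMat_of_lt _ hij, dif_neg hn']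
  -- A single point of the support already fixes `|r| = 1` and the size of `c_1`, since these do not
  -- depend on the point.
  obtain ⟨hr, hc1, hα, -⟩ := hall (u₀, v₀) hne
  have hαlow : (X ^ (n + 2))⁻¹ ≤ |(cExt c 1 : ℝ) / ((m : ℕ) : ℝ)| := by
    rw [abs_div, abs_of_pos hm0, inv_eq_one_div]
    exact div_le_div₀ (abs_nonneg _) (one_le_abs_cExt c 1) hm0 hm
  have hv := hvol X _ (cs c ⟨1, by omega⟩ : ℝ) hX hαlow hα
  have hS := fun p hp => (hall p hp).2.2.2
  refine ⟨hr, ?_, orbitalConverges_of_support hF _ _ hS (hv.trans_lt ENNReal.ofReal_lt_top), ?_⟩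
  · refine hc1.trans ?_
    have : 0 ≤ X ^ 2 := by positivity
    nlinarith [hττ.2]
  · have := norm_orbital_le hF _ _ hS (by positivity) hv
    rwa [abs_div, abs_of_pos hm0] at this

/-- Counting powers: `q^(n-1+e)` from the Kloosterman sum against `q^(-n)` from the volume leaves
`q^(e-1)`, and `m^n/m^(n-1)` leaves one `m` against `X^(2n-2)`. -/
theorem star_term_arith {n : ℕ} (hn : 3 < n) {q m X D K Z d e s : ℝ} (hq : 1 ≤ q) (hm : 0 < m)
    (hX : 1 ≤ X) (hmX : m ≤ X ^ (n + 2)) (hqX : q ≤ X ^ 2) (hK : 0 ≤ K) (hZ0 : 0 ≤ Z)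
    (hZ : Z ≤ q * d) (hd : d ^ (n - 2) ≤ D * q ^ e) (he : 0 < e) :
    q * Z ^ (n - 2) / m ^ (n - 1) *
      (K * X ^ (s + e) * (q / m * X)⁻¹ ^ n * (X ^ (n - 2))⁻¹) ≤
      D * K * X ^ (s + 5 * e) * q ^ (-(1 + e)) := by
  obtain ⟨k, rfl⟩ : ∃ k, n = k + 4 := ⟨n - 4, by omega⟩
  rw [show k + 4 - 2 = k + 2 by omega] at *
  rw [show k + 4 - 1 = k + 3 by omega]
  have hq0 : 0 < q := by linarith
  have hX0 : 0 < X := by linarith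
  have hZ1 : Z ^ (k + 2) ≤ q ^ (k + 2) * (D * q ^ e) :=
    calc Z ^ (k + 2) ≤ (q * d) ^ (k + 2) := pow_le_pow_left₀ hZ0 hZ _
      _ = q ^ (k + 2) * d ^ (k + 2) := mul_pow _ _ _
      _ ≤ _ := by gcongr
  have hD : 0 ≤ D * q ^ e := by
    have h0 : 0 ≤ d := by
      by_contra h
      push Not at h
      nlinarith
    exact (pow_nonneg h0 _).trans hd
  -- This is `n + 2 ≤ n + (n - 2)`, an equality for `n = 4`.
  have hm1 : m / (X ^ (k + 4) * X ^ (k + 2)) ≤ 1 := by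
    rw [div_le_one (by positivity), ← pow_add]
    exact hmX.trans (pow_le_pow_right₀ hX (by omega))
  -- Since `q ≤ X²`, a factor `q^(2e)` is traded for `X^(4e)`, which makes the later sum over `q`
  -- converge.
  have hqe : q ^ e / q ≤ q ^ (-(1 + e)) * X ^ (4 * e) := by
    have h1 : q ^ e / q = q ^ (-(1 + e)) * q ^ (2 * e) := by
      rw [← Real.rpow_add hq0, ← Real.rpow_sub_one hq0.ne']
      congr 1; ring
    have h2 : q ^ (2 * e) ≤ X ^ (4 * e) := by
      calc q ^ (2 * e) ≤ (X ^ 2) ^ (2 * e) := Real.rpow_le_rpow hq0.le hqX (by positivity)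
        _ = X ^ (4 * e) := by
          rw [← Real.rpow_natCast X 2, ← Real.rpow_mul hX0.le]
          congr 1; push_cast; ring
    rw [h1]
    gcongr
  have hD' : 0 ≤ D := nonneg_of_mul_nonneg_left hD (Real.rpow_pos_of_pos hq0 e)
  calc q * Z ^ (k + 2) / m ^ (k + 3) *
      (K * X ^ (s + e) * (q / m * X)⁻¹ ^ (k + 4) * (X ^ (k + 2))⁻¹)
      ≤ q * (q ^ (k + 2) * (D * q ^ e)) / m ^ (k + 3) *
      (K * X ^ (s + e) * (q / m * X)⁻¹ ^ (k + 4) * (X ^ (k + 2))⁻¹) := by gcongr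
    _ = D * K * X ^ (s + e) * (q ^ e / q) * (m / (X ^ (k + 4) * X ^ (k + 2))) := by
        have h1 : (q / m * X)⁻¹ ^ (k + 4) = m ^ (k + 4) / (q ^ (k + 4) * X ^ (k + 4)) := by
          rw [← mul_pow, ← div_pow]
          congr 1
          field_simp
        rw [h1]
        field_simp
        ring
    _ ≤ D * K * X ^ (s + e) * (q ^ (-(1 + e)) * X ^ (4 * e)) * 1 := by gcongr
    _ = _ := by
        rw [show s + 5 * e = s + e + 4 * e by ring, Real.rpow_add hX0 (s + e)]
        ring

theorem cExt_succ (c : Modulus n) (k : Fin (n - 1)) :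
    (cExt c (k.val + 1) : ℝ) = (((c k : {k : ℤ // k ≠ 0}) : ℤ) : ℝ) := by
  have hk := k.2
  rw [cExt, dif_pos ⟨by omega, by omega⟩]
  rfl


theorem exists_norm_kloosterman_star_le (n : ℕ) (hn : 3 < n) {e : ℝ} (he : 0 < e) :
    ∃ D : ℝ, 0 < D ∧ ∀ (m : ℕ+) (w : G n), (∀ i j, w.val i j =
      if i = starPerm n (by omega) j then ((starSign n j : ℤ) : ℝ) else 0) →
    ∀ c : Modulus n, Admissible (mVec n m) (mVec n m) w c → |(cs c ⟨1, by omega⟩ : ℝ)| = 1 →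
    ∃ Z d : ℝ, 0 ≤ Z ∧ Z ≤ |(cExt c 1 : ℝ)| * d ∧ d ^ (n - 2) ≤ D * |(cExt c 1 : ℝ)| ^ e ∧
      ‖kloosterman (mVec n m) (mVec n m) w c‖ ≤ |(cExt c 1 : ℝ)| * Z ^ (n - 2) := by
  have hn2 : (0 : ℝ) < ((n - 2 : ℕ) : ℝ) := by
    have : 0 < n - 2 := by omega
    exact_mod_cast this
  obtain ⟨C, hC, hdiv⟩ := exists_card_divisors_le (ε := e / ((n - 2 : ℕ) : ℝ)) (by positivity)
  refine ⟨C ^ (n - 2), by positivity, ?_⟩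
  intro m w hs c hadm hr
  obtain ⟨a, ha0, ha⟩ := exists_cExt_eq_int c 1
  have hq : ((a.natAbs : ℕ) : ℝ) = |(cExt c 1 : ℝ)| := by
    rw [ha, Nat.cast_natAbs, Int.cast_abs]
  have hq0 : a.natAbs ≠ 0 := Int.natAbs_ne_zero.mpr ha0
  refine ⟨(zeroPairs a.natAbs).card, a.natAbs.divisors.card, by positivity, ?_, ?_, ?_⟩
  · rw [← hq]
    exact_mod_cast card_zeroPairs_le _
  · rw [← hq]
    refine (pow_le_pow_left₀ (by positivity) (hdiv _ hq0) _).trans (le_of_eq ?_)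
    rw [mul_pow, ← Real.rpow_mul_natCast (by positivity), div_mul_cancel₀ _ hn2.ne']
  · rw [← hq]
    refine norm_kloosterman_star_le (by omega) hs _ _ ?_ ?_ hq
    · intro i h0 h1
      rw [cs_mid (by omega) hs hadm h0 h1, hr]
    · have h1 := cExt_star (by omega) hs hadm (n - 2) (by omega)
      rw [show n - 2 + 1 = n - 1 by omega] at h1
      rw [h1, abs_mul, abs_pow, hr, one_pow, one_mul]

/-- Bounds for all terms of the geometric side. -/
theorem exists_geomTerm_bound (n : ℕ) (hn : 3 < n) : ∃ τ₀ : ℝ, 0 < τ₀ ∧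
    ∀ τ : ℝ, 0 < τ → τ < τ₀ → ∀ e : ℝ, 0 < e → ∃ K : ℝ, 0 < K ∧
    ∀ X : ℝ, 1 ≤ X → ∀ rep : Equiv.Perm (Fin n) → G n, IsWeylSystem (by omega : 0 < n) rep →
    ∀ F : G n → ℂ, IsTestFunction F → SupportedInZKSharp X τ F →
    ∀ m : ℕ+, ((m : ℕ) : ℝ) ≤ X ^ (n + 2) → ∀ p : GeomIndex (mVec n m) rep,
      OrbitalConverges p.1.1 F (orbitPoint (mVec n m) p.1.2 (rep p.1.1)) ∧
      (p.1.1 ≠ 1 → p.1.1 ≠ starPerm n (by omega) →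
        orbital p.1.1 F (orbitPoint (mVec n m) p.1.2 (rep p.1.1)) = 0) ∧
      (geomTerm (mVec n m) rep F p ≠ 0 →
        (∀ k, |((p.1.2 k : {k : ℤ // k ≠ 0}) : ℤ)| =
          |((p.1.2 ⟨0, by omega⟩ : {k : ℤ // k ≠ 0}) : ℤ)|) ∧
        ‖geomTerm (mVec n m) rep F p‖ ≤
          K * supNorm F * X ^ ((n : ℝ) * (n - 1) * (n - 2) / 6 + 5 * e) *
            |(((p.1.2 ⟨0, by omega⟩ : {k : ℤ // k ≠ 0}) : ℤ) : ℝ)| ^ (-(1 + e))) := by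
  obtain ⟨τ₁, hτ₁, hcells⟩ := exists_eq_one_or_star_of_support n hn
  obtain ⟨τ₂, hτ₂, hstar⟩ := exists_orbital_star_bound n hn
  refine ⟨min τ₁ (min τ₂ (1 / 2)), by positivity, ?_⟩
  intro τ hτ hττ e he
  simp only [lt_min_iff] at hττ
  obtain ⟨K, hK, hstarK⟩ := hstar τ hτ hττ.2.1 e he
  obtain ⟨D, hD, hkl⟩ := exists_norm_kloosterman_star_le n hn he
  refine ⟨max ((4 * τ) ^ Fintype.card (Pos n)) (D * K), by positivity, ?_⟩
  rintro X hX rep hrep F hF hsupp m hm ⟨⟨σ, c⟩, hadm⟩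
  dsimp only at hadm ⊢
  have hX0 : 0 < X := by linarith
  have hm0 : (0 : ℝ) < ((m : ℕ) : ℝ) := by exact_mod_cast m.pos
  have hsup := supNorm_nonneg hF
  have hzero : orbital σ F (orbitPoint (mVec n m) c (rep σ)) ≠ 0 →
      ∃ u v, F (unip u * (orbitPoint (mVec n m) c (rep σ) * unipW σ v)) ≠ 0 := by
    intro h
    by_contra hall
    push Not at hall
    exact h (orbital_eq_zero _ _ hall)
  have hconv_zero : (∀ u v, F (unip u * (orbitPoint (mVec n m) c (rep σ) * unipW σ v)) = 0) →
      OrbitalConverges σ F (orbitPoint (mVec n m) c (rep σ)) := by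
    intro h
    refine orbitalConverges_of_support hF σ _ (S := ∅) (fun p hp => absurd (h _ _) hp) ?_
    simp
  have hcell : (∃ u v, F (unip u * (orbitPoint (mVec n m) c (rep σ) * unipW σ v)) ≠ 0) →
      σ = 1 ∨ σ = starPerm n (by omega) := by
    rintro ⟨u, v, h⟩
    obtain ⟨z, k, hk, hE⟩ := hsupp _ h
    exact hcells X τ hX hτ hττ.1 m hm σ (rep σ) (hrep.represents σ) c hadm _ (unip_mem _) _
      (unip_mem _) z k hk hE
  have hc0 := cExt_succ c ⟨0, by omega⟩
  simp only [zero_add] at hc0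
  have hterm : geomTerm (mVec n m) rep F ⟨(σ, c), hadm⟩ =
      kloosterman (mVec n m) (mVec n m) (rep σ) c / (deltaW σ (mEntry (mVec n m)) : ℂ) *
        orbital σ F (orbitPoint (mVec n m) c (rep σ)) := rfl
  have hexp : X ^ ((n : ℝ) * (n - 1) * (n - 2) / 6) ≤
      X ^ ((n : ℝ) * (n - 1) * (n - 2) / 6 + 5 * e) :=
    Real.rpow_le_rpow_of_exponent_le hX (by linarith)
  refine ⟨?_, ?_, ?_⟩
  -- The structural results need a point where the integrand does not vanish; without one the
  -- integral converges trivially.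
  · by_cases hex : ∃ u v, F (unip u * (orbitPoint (mVec n m) c (rep σ) * unipW σ v)) ≠ 0
    · rcases hcell hex with rfl | rfl
      · rw [hrep.one]
        exact (orbital_one_bound hX hτ hττ.2.2.le hF hsupp m c).1
      · exact (hstarK X hX F hF hsupp m hm _ hrep.star_apply c hadm hex).2.2.1
    · push Not at hex
      exact hconv_zero hex
  · intro h1 h2
    by_contra h
    rcases hcell (hzero h) with h | h <;> contradiction
  · intro hne
    rw [hterm] at hne ⊢
    have hne' := mul_ne_zero_iff.mp hne
    have hkl0 := (div_ne_zero_iff.mp hne'.1).1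
    have hex := hzero hne'.2
    rcases hcell hex with rfl | rfl
    · rw [hrep.one] at hkl0 ⊢
      have habs : ∀ k : Fin (n - 1), |((c k : {k : ℤ // k ≠ 0}) : ℤ)| = 1 := by
        intro k
        have hk := k.2
        have := abs_cExt_of_kloosterman_one_ne_zero hkl0 (k := k.val + 1) (by omega)
        rw [cExt_succ] at this
        exact_mod_cast this
      refine ⟨fun k => by rw [habs, habs], ?_⟩
      rw [deltaW_one, ← Int.cast_abs, habs, Int.cast_one, Real.one_rpow, mul_one, norm_mul,
        norm_div, Complex.ofReal_one, norm_one, div_one]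
      calc _ ≤ 1 * (supNorm F *
          ((4 * τ) ^ Fintype.card (Pos n) * X ^ ((n : ℝ) * (n - 1) * (n - 2) / 6))) :=
            mul_le_mul (norm_kloosterman_one_le _ _ _)
              (orbital_one_bound hX hτ hττ.2.2.le hF hsupp m c).2 (norm_nonneg _) zero_le_one
        _ ≤ 1 * (supNorm F * (max ((4 * τ) ^ Fintype.card (Pos n)) (D * K) *
            X ^ ((n : ℝ) * (n - 1) * (n - 2) / 6 + 5 * e))) := by
            gcongr
            exact le_max_left _ _
        _ = _ := by ring
    · have hs := hrep.star_apply
      obtain ⟨hr, hcX, -, horb⟩ := hstarK X hX F hF hsupp m hm _ hs c hadm hex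
      obtain ⟨Z, d, hZ0, hZ, hd, hS⟩ := hkl m _ hs c hadm hr
      refine ⟨fun k => ?_, ?_⟩
      · have hk := k.2
        have h1 := cExt_star (by omega) hs hadm k.val (by omega)
        rw [cExt_succ, hc0] at h1
        have h2 := congrArg abs h1
        rw [abs_mul, abs_pow, hr, one_pow, one_mul] at h2
        exact_mod_cast h2
      · rw [← hc0, deltaW_star (by omega), norm_mul, norm_div]
        have hδ : ‖(((((m : ℕ) : ℝ) ^ (n - 1) : ℝ)) : ℂ)‖ = ((m : ℕ) : ℝ) ^ (n - 1) := by
          rw [Complex.norm_real, Real.norm_of_nonneg (by positivity)]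
        rw [hδ]
        have harith := star_term_arith hn (s := (n : ℝ) * (n - 1) * (n - 2) / 6)
          (one_le_abs_cExt c 1) hm0 hX hm hcX hK.le hZ0 hZ hd he
        calc _ ≤ |(cExt c 1 : ℝ)| * Z ^ (n - 2) / ((m : ℕ) : ℝ) ^ (n - 1) * (supNorm F *
              (K * X ^ ((n : ℝ) * (n - 1) * (n - 2) / 6 + e) *
                (|(cExt c 1 : ℝ)| / ((m : ℕ) : ℝ) * X)⁻¹ ^ n * (X ^ (n - 2))⁻¹)) := by
              gcongr
          _ = supNorm F * (|(cExt c 1 : ℝ)| * Z ^ (n - 2) / ((m : ℕ) : ℝ) ^ (n - 1) *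
              (K * X ^ ((n : ℝ) * (n - 1) * (n - 2) / 6 + e) *
                (|(cExt c 1 : ℝ)| / ((m : ℕ) : ℝ) * X)⁻¹ ^ n * (X ^ (n - 2))⁻¹)) := by ring
          _ ≤ supNorm F * (D * K * X ^ ((n : ℝ) * (n - 1) * (n - 2) / 6 + 5 * e) *
              |(cExt c 1 : ℝ)| ^ (-(1 + e))) := mul_le_mul_of_nonneg_left harith hsup
          _ ≤ supNorm F * (max ((4 * τ) ^ Fintype.card (Pos n)) (D * K) *
              X ^ ((n : ℝ) * (n - 1) * (n - 2) / 6 + 5 * e) *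
              |(cExt c 1 : ℝ)| ^ (-(1 + e))) := by
              gcongr
              exact le_max_right _ _
          _ = _ := by ring

/-- A function that is dominated along an injective coding of its support is summable. -/
theorem summable_of_injOn_support {ι κ : Type*} {f : ι → ℂ} {h : κ → ℝ} (hh : Summable h)
    (hh0 : ∀ k, 0 ≤ h k) {code : ι → κ} (hinj : Set.InjOn code f.support) {A : ℝ} (hA : 0 ≤ A)
    (hle : ∀ i, f i ≠ 0 → ‖f i‖ ≤ A * h (code i)) :
    Summable f ∧ ‖∑' i, f i‖ ≤ A * ∑' k, h k := by
  have hcomp : Summable fun i : f.support => h (code i) := hh.comp_injective hinj.injective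
  have hnorm : Summable fun i : f.support => ‖f i‖ :=
    Summable.of_nonneg_of_le (fun _ => norm_nonneg _) (fun i => hle i i.2) (hcomp.mul_left A)
  have hsum : Summable f := summable_subtype_iff_indicator.mp hnorm.of_norm |>.congr fun i => by
    rw [Set.indicator_support]
  refine ⟨hsum, ?_⟩
  rw [← tsum_subtype_support]
  calc _ ≤ ∑' i : f.support, ‖f i‖ := norm_tsum_le_tsum_norm hnorm
    _ ≤ ∑' i : f.support, A * h (code i) :=
      hnorm.tsum_le_tsum (fun i => hle i i.2) (hcomp.mul_left A)
    _ = A * ∑' i : f.support, h (code i) := tsum_mul_left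
    _ ≤ _ := mul_le_mul_of_nonneg_left
      (tsum_comp_le_tsum_of_inj hh hh0 hinj.injective) hA

end Geometric

end GLKuznetsov

end

theorem proposition4p1 (n : ℕ) (hn : 4 ≤ n) :
    ∃ τ₀ X₀ : ℝ, 0 < τ₀ ∧ 1 < X₀ ∧
      ∀ τ : ℝ, 0 < τ → τ < τ₀ → ∀ ε : ℝ, 0 < ε →
        ∃ C : ℝ, ∀ X : ℝ, X₀ ≤ X →
          ∀ rep : Equiv.Perm (Fin n) → GLKuznetsov.G n,
            GLKuznetsov.IsWeylSystem (by omega : 0 < n) rep →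
          ∀ F : GLKuznetsov.G n → ℂ, GLKuznetsov.IsTestFunction F →
            GLKuznetsov.SupportedInZKSharp X τ F →
          ∀ m : ℕ+, ((m : ℕ) : ℝ) ≤ X ^ (n + 2) →
            (∀ p : GLKuznetsov.GeomIndex (GLKuznetsov.mVec n m) rep,
              GLKuznetsov.OrbitalConverges p.1.1 F
                (GLKuznetsov.orbitPoint (GLKuznetsov.mVec n m) p.1.2 (rep p.1.1))) ∧
            (∀ p : GLKuznetsov.GeomIndex (GLKuznetsov.mVec n m) rep,
              p.1.1 ≠ 1 → p.1.1 ≠ GLKuznetsov.starPerm n (by omega) →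
                GLKuznetsov.orbital p.1.1 F
                  (GLKuznetsov.orbitPoint (GLKuznetsov.mVec n m) p.1.2 (rep p.1.1)) = 0) ∧
            Summable (GLKuznetsov.geomTerm (GLKuznetsov.mVec n m) rep F) ∧
            ‖∑' p, GLKuznetsov.geomTerm (GLKuznetsov.mVec n m) rep F p‖ ≤
              C * GLKuznetsov.supNorm F *
                X ^ ((n : ℝ) * ((n : ℝ) - 1) * ((n : ℝ) - 2) / 6 + ε) := by
  obtain ⟨τ₀, hτ₀, hbound⟩ := GLKuznetsov.exists_geomTerm_bound n hn
  refine ⟨τ₀, 2, hτ₀, by norm_num, ?_⟩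
  intro τ hτ hττ ε hε
  -- The bounds for single terms lose `X^(5e)`.
  obtain ⟨K, hK, hbound⟩ := hbound τ hτ hττ (ε / 5) (by positivity)
  -- A nonzero term has all `|c_k|` equal, so it is determined by the permutation, the signs of the
  -- `c_k` and `c_1`. The first two range over finite sets, and the dominating series runs over
  -- `c_1` alone.
  let h : (Equiv.Perm (Fin n) × (Fin (n - 1) → Prop)) × ℤ → ℝ :=
    fun k => 1 * |(k.2 : ℝ)| ^ (-(1 + ε / 5))
  have hh : Summable h := by
    have h1 : Summable fun _ : Equiv.Perm (Fin n) × (Fin (n - 1) → Prop) => (1 : ℝ) :=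
      (hasSum_fintype _).summable
    exact h1.mul_of_nonneg (Real.summable_abs_int_rpow (by linarith)) (fun _ => zero_le_one)
      fun _ => by positivity
  have hh0 : ∀ k, 0 ≤ h k := fun k => by positivity
  refine ⟨K * ∑' k, h k, ?_⟩
  intro X hX rep hrep F hF hsupp m hm
  have hb := hbound X (by linarith) rep hrep F hF hsupp m hm
  refine ⟨fun p => (hb p).1, fun p => (hb p).2.1, ?_⟩
  have hsup := GLKuznetsov.supNorm_nonneg hF
  have hmain := GLKuznetsov.summable_of_injOn_support (f := GLKuznetsov.geomTerm (GLKuznetsov.mVec n m) rep F) hh hh0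
    (code := fun p => ((p.1.1, fun k => 0 < (p.1.2 k).1), (p.1.2 ⟨0, by omega⟩).1))
    (A := K * GLKuznetsov.supNorm F *
      X ^ ((n : ℝ) * ((n : ℝ) - 1) * ((n : ℝ) - 2) / 6 + ε)) ?_ (by positivity) ?_
  · refine ⟨hmain.1, hmain.2.trans (le_of_eq ?_)⟩
    ring
  · rintro ⟨⟨σ, c⟩, hp⟩ hpne ⟨⟨σ', c'⟩, hp'⟩ hpne' heq
    have h1 := ((hb _).2.2 hpne).1
    have h1' := ((hb _).2.2 hpne').1
    simp only [Prod.mk.injEq] at heq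
    obtain ⟨⟨rfl, hsign⟩, h0⟩ := heq
    apply Subtype.ext
    refine Prod.ext rfl (funext fun k => Subtype.ext ?_)
    have h2 := h1 k
    have h2' := h1' k
    dsimp only at h2 h2'
    rw [h0, ← h2'] at h2
    have h3 := (congrFun hsign k).to_iff
    rcases abs_eq_abs.mp h2 with h | h
    · exact h
    -- Opposite values of `c_k` are excluded by the equal signs and by `c_k ≠ 0`.
    · have h4 := (c' k).2
      rw [h] at h3
      dsimp only at h3 ⊢
      omega
  · intro p hp
    have := ((hb p).2.2 hp).2
    rw [show (5 : ℝ) * (ε / 5) = ε by ring] at this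
    simpa only [h, one_mul] using this
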